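/- **Corollary 1.2 (integrate–maximize).** Let $P=\{x\in\mathbb R^n : Ax=b,\ x\ge 0\}$ with $A\in\mathbb Z^{s\times n}$, $b\in\mathbb Z^s$ be bounded, and let $Q(x)=\{y\in\mathbb R^m : Cy=Dx,\ y\ge 0\}$ with $C\in\mathbb Z^{r\times m}$, $D\in\mathbb Z^{r\times n}$ be bounded for every $x\in\mathbb R^n$. For $x\in\mathbb Z^n$ put $w(x)=|Q(x)\cap\mathbb Z^m|$, and let $$P^*=\Big\{(x,y)\in\mathbb R^{n+m} : \begin{pmatrix}A&0\\ D&-C\end{pmatrix}\begin{pmatrix}x\\y\end{pmatrix}=\begin{pmatrix}b\\0\end{pmatrix},\ x\ge0,\ y\ge 0\Big\}$$ be the weight lifting polytope. The normalized volume of a polytope is its volume in its affine hull, for the Lebesgue measure that gives measure $1$ to a fundamental parallelepiped of the lattice of integer vectors parallel to that hull; integrals over $P$ are taken with respect to this measure on the affine hull of $P$. **(1) Integration.** Suppose that $P\neq\emptyset$ and that $\{x\in P: Q(x)\ne\emptyset\}$ has the same affine hull as $P$. Put $d=\dim P$. Then there is an integer $M\ge0$ with $\dim P^*=d+M$, and the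 following hold. * For all integers $t\ge0$, $\sum_{x\in tP\cap\mathbb Z^n}w(x)=|tP^*\cap\mathbb Z^{n+m}|$, and both sides are a quasi-polynomial $\sum_{j=0}^{d+M}E_j(t)t^j$ with $E_0,\dots,E_{d+M}$ periodic. For $t\ge1$ its leading coefficient $E_{d+M}(t)$ is the normalized volume of $P^*$, which is positive, if the affine hull of $tP^*$ contains an integer point, and $0$ otherwise. * Call functions $g_\rho$, $\rho\in(\mathbb Z/N)^n$, $N\ge1$, a *homogeneous leading part of degree $M$ of $w$* if each $g_\rho$ satisfies $g_\rho(tx)=t^Mg_\rho(x)$ for $x\in P$ and real $t>0$, is bounded on $P$ and continuous (relative to $P$) at almost every point of $P$, and $w(x)=g_{x\bmod N}(x)+o(t^M)$ uniformly for $x\in tP\cap\mathbb Z^n$, as $t\to\infty$. Such a leading part exists. For every such leading part and every integer $t\ge1$, the mean of $\int_P g_\rho\,dx$ over all classes $\rho$ modulo $N$ of integer points of the affine hull of $tP$ (read as $0$ if there are none) equals $E_{d+M}(t)$. * In particular, if $w$ has a leading part $f$ with $N=1$ (no periodic coefficients), then $\int_P f(x)\,dx$ is the normalized volume of $P^*$.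 **(2) Maximization.** Suppose that $P\cap\mathbb Z^n\ne\emptyset$. For $k\ge1$ let $$P^*_k=\{(x,y_1,\dots,y_k)\in\mathbb R^{n+km} : Ax=b,\ Dx-Cy_i=0\ (1\le i\le k),\ x\ge0,\ y_i\ge0\}.$$ This is the weight lifting polytope of $P$ for the family $Q(x)^k$, whose weight is $w^k$; one has $P^*_k=\{(x,y_1,\dots,y_k):(x,y_j)\in P^*\ \text{for all } j\}$. For all $t\ge 1$, $\sum_{\alpha\in tP\cap\mathbb Z^n}w(\alpha)^k=|tP^*_k\cap\mathbb Z^{n+km}|$. Put $$L_k=\Big(\frac{|P^*_k\cap\mathbb Z^{n+km}|}{|P\cap\mathbb Z^n|}\Big)^{1/k},\qquad U_k=|P_k^*\cap\mathbb Z^{n+km}|^{1/k}.$$ Then the maximum $\mu=\max_{\alpha\in P\cap\mathbb Z^n}w(\alpha)$ exists and: * $L_k\le\mu\le U_k$ for all $k\ge1$; $L_k$ is nondecreasing and $U_k$ nonincreasing in $k\ge1$, and both converge to $\mu$. * There is $K\ge1$ with $U_k-L_k<1$ for all $k\ge K$; and whenever $k\ge1$ and $U_k-L_k<1$ or $\lfloor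 U_k\rfloor-\lceil L_k\rceil<1$, one has $\mu=\lceil L_k\rceil$. * The polytopes contain each other: for $k\ge1$ the injective map $(x,y_1,\dots,y_k)\mapsto(x,y_1,\dots,y_k,y_k)$ sends $P^*_k$ into $P^*_{k+1}$, and forgetting $y_{k+1}$ maps $P^*_{k+1}$ onto $P^*_k$. * They are read efficiently from $P^*$: an explicit program, depending only on $n,m,s,r,k$, fills in the array (constraint matrix and right-hand side) that describes $P^*_k$ by steps that each write one cell, either as $0$ or as a copy of one entry of the array that describes $P^*$. It uses at most $k^2(s+r)(n+m+1)$ steps, where $(s+r)(n+m+1)$ is the number of entries of the array for $P^*$. -/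

import Mathlib

open Set Filter Topology MeasureTheory
open scoped Pointwise

noncomputable section

namespace WeightLifting

/-! Lattice points, and polytopes in standard form. -/

/-- An integer vector, seen as a real vector. -/
def intVec {ι : Type*} (z : ι → ℤ) : ι → ℝ := fun i => (z i : ℝ)

/-- The lattice points `S ∩ ℤ^ι` of a set of real vectors, as integer vectors. -/
def latticePoints {ι : Type*} (S : Set (ι → ℝ)) : Set (ι → ℤ) := {z | intVec z ∈ S}

/-- The number of lattice points of a set. -/
def latticeCount {ι : Type*} (S : Set (ι → ℝ)) : ℕ := (latticePoints S).ncard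

/-- `{x | A x = b, x ≥ 0}`. -/
def stdPolytope {σ ι : Type*} [Fintype ι] (A : Matrix σ ι ℤ) (b : σ → ℤ) : Set (ι → ℝ) :=
  {x | (A.map (fun a : ℤ => (a : ℝ))).mulVec x = intVec b ∧ ∀ i, 0 ≤ x i}

/-- The parametric family `Q(x) = {y | C y = ∑ i, x i • d i, y ≥ 0}`, where `d i` is the `i`-th
column of `D`. -/
def paramPolytope {ρ ι μ : Type*} [Fintype ι] [Fintype μ] (C : Matrix ρ μ ℤ) (D : Matrix ρ ι ℤ)
    (x : ι → ℝ) : Set (μ → ℝ) :=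
  {y | (C.map (fun a : ℤ => (a : ℝ))).mulVec y = (D.map (fun a : ℤ => (a : ℝ))).mulVec x ∧
    ∀ j, 0 ≤ y j}

/-- The weight `w(x) = |Q(x) ∩ ℤ^μ|` of an integer vector `x`. -/
def weight {ρ ι μ : Type*} [Fintype ι] [Fintype μ] (C : Matrix ρ μ ℤ) (D : Matrix ρ ι ℤ)
    (x : ι → ℤ) : ℕ :=
  latticeCount (paramPolytope C D (intVec x))

/-- The constraint matrix `A* = [A 0; D -C]`. -/
def liftMatrix {σ ρ ι μ : Type*} (A : Matrix σ ι ℤ) (C : Matrix ρ μ ℤ) (D : Matrix ρ ι ℤ) :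
    Matrix (σ ⊕ ρ) (ι ⊕ μ) ℤ :=
  Matrix.fromBlocks A 0 D (-C)

/-- The weight lifting polytope `P* = {(x, y) | A* (x, y) = (b, 0), x ≥ 0, y ≥ 0}`. -/
def liftPolytope {σ ρ ι μ : Type*} [Fintype ι] [Fintype μ] (A : Matrix σ ι ℤ) (b : σ → ℤ)
    (C : Matrix ρ μ ℤ) (D : Matrix ρ ι ℤ) : Set (ι ⊕ μ → ℝ) :=
  stdPolytope (liftMatrix A C D) (Sum.elim b 0)

/-- The weighted sum `∑ w(x)` over the lattice points `x` of the dilate `tP`. -/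
def weightedSum {ι : Type*} (P : Set (ι → ℝ)) (w : (ι → ℤ) → ℕ) (t : ℕ) : ℕ :=
  ∑ᶠ x ∈ latticePoints ((t : ℝ) • P), w x

/-! The integral Lebesgue measure on the affine hull of a rational polytope. -/

/-- The lattice of integer vectors parallel to the affine hull of `S`. -/
def latticeDirection {ι : Type*} (S : Set (ι → ℝ)) : Submodule ℤ (ι → ℤ) where
  carrier := {z | intVec z ∈ vectorSpan ℝ S}
  zero_mem' := by
    have h : intVec (0 : ι → ℤ) = 0 := by ext i; simp [intVec]
    simp only [Set.mem_ofPred_eq, h]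
    exact Submodule.zero_mem _
  add_mem' := by
    intro a c ha hc
    have h : intVec (a + c) = intVec a + intVec c := by ext i; simp [intVec]
    simp only [Set.mem_ofPred_eq, h] at *
    exact Submodule.add_mem _ ha hc
  smul_mem' := by
    intro k a ha
    have h : intVec (k • a) = (k : ℝ) • intVec a := by ext i; simp [intVec]
    simp only [Set.mem_ofPred_eq, h] at *
    exact Submodule.smul_mem _ _ ha

open Classical in
/-- Lebesgue measure on the affine hull of `S`, normalized so that a fundamental parallelepiped of
the lattice of integer vectors parallel to the affine hull has measure one. It is the image of the
standard Lebesgue measure under `c ↦ p + ∑ i, c i • v i`, for a point `p` of `S` and a basis `v` of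
that lattice; neither choice matters, since two bases differ by an integer matrix of determinant
`1` or `-1`. If the affine hull is a point, this is the unit mass at the point. -/
def latticeMeasure {ι : Type*} [Fintype ι] (S : Set (ι → ℝ)) : Measure (ι → ℝ) :=
  if h : S.Nonempty then
    Measure.map
      (fun c : Module.Free.ChooseBasisIndex ℤ (latticeDirection S) → ℝ =>
        h.some + ∑ i, c i • intVec (Module.Free.chooseBasis ℤ (latticeDirection S) i : ι → ℤ))
      volume
  else 0

/-- The normalized (relative) volume of a polytope. -/
def normVol {ι : Type*} [Fintype ι] (S : Set (ι → ℝ)) : ℝ := (latticeMeasure S S).toReal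

/-- The dimension of (the affine hull of) a set. -/
def affDim {ι : Type*} (S : Set (ι → ℝ)) : ℕ := Module.finrank ℝ (vectorSpan ℝ S)

/-- The lattice points of the affine hull of the dilate `tS`. -/
def affLattice {ι : Type*} (S : Set (ι → ℝ)) (t : ℕ) : Set (ι → ℤ) :=
  latticePoints (affineSpan ℝ ((t : ℝ) • S) : Set (ι → ℝ))

/-! Quasi-polynomials, and the integral of a homogeneous quasi-polynomial weight. -/

/-- `f` is the quasi-polynomial function `f t = ∑ j ≤ d, E j t * t ^ j`, with coefficients
`E 0, …, E d` that are periodic in `t`, of common period `p`. -/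
def IsQuasiPolynomial (f : ℕ → ℝ) (d p : ℕ) (E : ℕ → ℕ → ℝ) : Prop :=
  0 < p ∧ (∀ j t, E j (t + p) = E j t) ∧
    ∀ t, f t = ∑ j ∈ Finset.range (d + 1), E j t * (t : ℝ) ^ j

/-- The residue vector modulo `N` of an integer vector. -/
def residue {ι : Type*} (N : ℕ) (x : ι → ℤ) : ι → ZMod N := fun i => (x i : ZMod N)

/-- `g` is a homogeneous part of degree `M` that represents the weight `w` to leading order on the
cone over `P`. As for any quasi-polynomial, there is one constituent `g r` for each class `r` of
lattice points modulo a period `N`. Each constituent is homogeneous of degree `M` on that cone and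
Riemann integrable over `P` (bounded, and continuous almost everywhere; for instance polynomial,
or polynomial on each of finitely many chambers), and `w x = g (x mod N) x + o(t ^ M)`, uniformly
for lattice points `x` of `tP`. -/
structure IsLeadingPart {ι : Type*} [Fintype ι] (P : Set (ι → ℝ)) (w : (ι → ℤ) → ℕ) (M N : ℕ)
    (g : (ι → ZMod N) → (ι → ℝ) → ℝ) : Prop where
  period_pos : 0 < N
  homogeneous : ∀ r, ∀ x ∈ P, ∀ t : ℝ, 0 < t → g r (t • x) = t ^ M * g r x
  bounded : ∃ B : ℝ, ∀ r, ∀ x ∈ P, |g r x| ≤ B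
  ae_continuous : ∀ r, ∀ᵐ x ∂(latticeMeasure P).restrict P, ContinuousWithinAt (g r) P x
  approx : ∀ ε : ℝ, 0 < ε → ∃ T : ℕ, ∀ t : ℕ, T ≤ t → ∀ x ∈ latticePoints ((t : ℝ) • P),
    |(w x : ℝ) - g (residue N x) (intVec x)| ≤ ε * (t : ℝ) ^ M

/-- The integral over `P` of a homogeneous quasi-polynomial with constituents `g r`: the mean of
the integrals of its constituents over the residue classes that occur in the affine hull of the
dilate `tP`, `t ≥ 1` (these depend on `t` modulo a period only); it is `0` if no
class occurs. If `N = 1` and some class occurs, it is the integral of the one constituent. -/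
def quasiIntegral {ι : Type*} [Fintype ι] (P : Set (ι → ℝ)) (N : ℕ)
    (g : (ι → ZMod N) → (ι → ℝ) → ℝ) (t : ℕ) : ℝ :=
  (∑ᶠ r ∈ residue N '' affLattice P t, ∫ x in P, g r x ∂(latticeMeasure P)) /
    ((residue N '' affLattice P t).ncard : ℝ)

/-! Powers of a weight. -/

/-- The matrix `diag(C, …, C)`, with `k` blocks. -/
def powC {ρ μ : Type*} (C : Matrix ρ μ ℤ) (k : ℕ) : Matrix (ρ × Fin k) (μ × Fin k) ℤ :=
  Matrix.blockDiagonal (fun _ : Fin k => C)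

/-- The matrix `(D; …; D)`, with `k` blocks on top of each other. -/
def powD {ρ ι : Type*} (D : Matrix ρ ι ℤ) (k : ℕ) : Matrix (ρ × Fin k) ι ℤ :=
  Matrix.of fun p i => D p.1 i

/-- The weight lifting polytope for the weight `w ^ k`, the weight of the family `Q(x)^k`. -/
def powLift {σ ρ ι μ : Type*} [Fintype ι] [Fintype μ] (A : Matrix σ ι ℤ) (b : σ → ℤ)
    (C : Matrix ρ μ ℤ) (D : Matrix ρ ι ℤ) (k : ℕ) : Set (ι ⊕ μ × Fin k → ℝ) :=
  liftPolytope A b (powC C k) (powD D k)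

/-- The map `(x, y₁, …, y_{k+1}) ↦ (x, y₁, …, y_{k+1}, y_{k+1})`. -/
def dupLast {ι μ : Type*} (k : ℕ) (z : ι ⊕ μ × Fin (k + 1) → ℝ) : ι ⊕ μ × Fin (k + 2) → ℝ :=
  fun i => z (Sum.map id (Prod.map id (Fin.predAbove (Fin.last k))) i)

/-- The coordinate projection `(x, y₁, …, y_{k+2}) ↦ (x, y₁, …, y_{k+1})`. -/
def dropLast {ι μ : Type*} (k : ℕ) (z : ι ⊕ μ × Fin (k + 2) → ℝ) : ι ⊕ μ × Fin (k + 1) → ℝ :=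
  fun i => z (Sum.map id (Prod.map id Fin.castSucc) i)

/-- The coordinate projection `(x, y₁, …, y_k) ↦ (x, y_j)`. -/
def projAt {ι μ : Type*} {k : ℕ} (j : Fin k) (z : ι ⊕ μ × Fin k → ℝ) : ι ⊕ μ → ℝ :=
  Sum.elim (fun i => z (Sum.inl i)) (fun c => z (Sum.inr (c, j)))

/-- The lower bound `(|P*_k ∩ ℤ| / |P ∩ ℤ|) ^ (1/k)`. -/
def lowerBound {σ ρ ι μ : Type*} [Fintype ι] [Fintype μ] (A : Matrix σ ι ℤ) (b : σ → ℤ)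
    (C : Matrix ρ μ ℤ) (D : Matrix ρ ι ℤ) (k : ℕ) : ℝ :=
  ((latticeCount (powLift A b C D k) : ℝ) / (latticeCount (stdPolytope A b) : ℝ)) ^ ((1 : ℝ) / k)

/-- The upper bound `|P*_k ∩ ℤ| ^ (1/k)`. -/
def upperBound {σ ρ ι μ : Type*} [Fintype ι] [Fintype μ] (A : Matrix σ ι ℤ) (b : σ → ℤ)
    (C : Matrix ρ μ ℤ) (D : Matrix ρ ι ℤ) (k : ℕ) : ℝ :=
  (latticeCount (powLift A b C D k) : ℝ) ^ ((1 : ℝ) / k)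

/-! Reading the description of `P*_k` off the description of `P*`, with a step count. -/

/-- The description of `{z | A z = b, z ≥ 0}`: the integer array `[A | b]`. -/
def description {σ ι : Type*} (A : Matrix σ ι ℤ) (b : σ → ℤ) : σ × (ι ⊕ Unit) → ℤ :=
  fun p => Sum.elim (fun j => A p.1 j) (fun _ => b p.1) p.2

/-- An instruction fills one cell `p` of an output array: `(p, some q)` copies the cell `q` of the
input array, and `(p, none)` writes a zero. A program is a list of instructions, and its number
of steps is the length of the list. -/
abbrev CopyProgram (α β : Type*) := List (β × Option α)

/-- Running a program on an input array; the output array starts out as zero. -/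
def CopyProgram.run {α β : Type*} [DecidableEq β] (prog : CopyProgram α β) (input : α → ℤ) :
    β → ℤ :=
  prog.foldl (fun out c => Function.update out c.1 (c.2.elim 0 input)) 0

/-- The number of steps of a program. -/
def CopyProgram.steps {α β : Type*} (prog : CopyProgram α β) : ℕ := prog.length

/-- Where the entries of the description of `P*_k` are found in the description of `P*`. -/
def powSource {σ ρ ι μ : Type*} (k : ℕ) :
    (σ ⊕ ρ × Fin k) × ((ι ⊕ μ × Fin k) ⊕ Unit) → Option ((σ ⊕ ρ) × ((ι ⊕ μ) ⊕ Unit))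
  | (Sum.inl i, Sum.inl (Sum.inl j)) => some (Sum.inl i, Sum.inl (Sum.inl j))
  | (Sum.inl _, Sum.inl (Sum.inr _)) => none
  | (Sum.inl i, Sum.inr u) => some (Sum.inl i, Sum.inr u)
  | (Sum.inr (a, _), Sum.inl (Sum.inl j)) => some (Sum.inr a, Sum.inl (Sum.inl j))
  | (Sum.inr (a, p), Sum.inl (Sum.inr (c, q))) =>
      if p = q then some (Sum.inr a, Sum.inl (Sum.inr c)) else none
  | (Sum.inr _, Sum.inr _) => none

/-- The program that fills the cells of the description of `P*_k` one after the other. It depends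
on the format of the data only, not on the entries. -/
def powProgram (n m s r k : ℕ) :
    CopyProgram ((Fin s ⊕ Fin r) × ((Fin n ⊕ Fin m) ⊕ Unit))
      ((Fin s ⊕ Fin r × Fin k) × ((Fin n ⊕ Fin m × Fin k) ⊕ Unit)) :=
  let rows : List (Fin s ⊕ Fin r × Fin k) :=
    (List.finRange s).map Sum.inl ++
      ((List.finRange r).product (List.finRange k)).map Sum.inr
  let cols : List ((Fin n ⊕ Fin m × Fin k) ⊕ Unit) :=
    ((List.finRange n).map Sum.inl ++
      ((List.finRange m).product (List.finRange k)).map Sum.inr).map Sum.inl ++ [Sum.inr ()]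
  (rows.product cols).map fun p => (p, powSource k p)

end WeightLifting

end

open WeightLifting

/-! A lattice point of tP* is a lattice point x of tP together with one of Q(x), so weighted sums
over tP are lattice point counts of tP*. The same fact for the family Q(x)^k, whose weight is w^k,
underlies the maximization.

Integration. Ehrhart's theorem is proved from first principles (`isQuasi_latticeCount`). The
polytope is homogenized to a cone cut out of an orthant by integer equations, and these are
eliminated one by one: cutting along x X = x Y, for two variables whose coefficients have opposite
signs, and substituting makes the coefficients smaller, until all have one sign and the equation
merely kills variables. The pieces are made disjoint by removing facets according to the signs of
the coordinates of a point w of positive height. Because of w, no final orthant loses all its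
facets, and this is why the count is a quasi-polynomial from t = 0 on. Its leading coefficient is a
limit of Riemann sums over arbitrarily shifted grids (`tendsto_riemann_sum`): the lattice points in
the hull of tP, divided by t, form such a grid in lattice coordinates.

The hypothesis on affine hulls makes C y = D x solvable for all x in P, linearly in x, with y
supported in the largest support that occurs (`nonempty_liftFrame`); M is the dimension of the fibre
over a point of maximal support. For x in tP, w(x) / t^M is a Riemann sum for the volume of the
fibre over x / t if C y = D x has an integer solution with that support, and 0 otherwise; which case
occurs depends only on x modulo some N. So the fibre volume, on these classes, is a leading part
(`exists_isLeadingPart`), uniformly by compactness. For an arbitrary leading part, summation along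
dilates whose hulls meet the same residue classes yields the mean of the integrals
(`exists_tendsto_quasiIntegral`), and the limit along such a progression can only be the top
coefficient (`IsQuasiPolynomial.leadingCoeff_eq`).

Maximization. U_k is the ℓ^k norm of the weights on P ∩ ℤ^n and L_k their k-th power mean. Both
converge to the maximum, from above and from below (`maximize_weight`); an integer between them is
determined once the gap is small. -/

namespace WeightLifting

/-! ### Polytopes in standard form: recession, lattice points, affine hulls. -/

section Basics

variable {σ ρ ι μ : Type*}

@[simp] lemma intVec_apply (z : ι → ℤ) (i : ι) : intVec z i = (z i : ℝ) := rfl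

lemma intVec_injective : Function.Injective (intVec : (ι → ℤ) → ι → ℝ) := by
  intro a b h
  ext i
  have := congrFun h i
  simpa using this

lemma intVec_add (a b : ι → ℤ) : intVec (a + b) = intVec a + intVec b := by
  ext i; simp

lemma intVec_sub (a b : ι → ℤ) : intVec (a - b) = intVec a - intVec b := by
  ext i; simp

lemma intVec_smul (k : ℤ) (a : ι → ℤ) : intVec (k • a) = (k : ℝ) • intVec a := by
  ext i; simp

@[simp] lemma intVec_zero : intVec (0 : ι → ℤ) = 0 := by
  ext i; simp

@[simp] lemma mem_latticePoints {S : Set (ι → ℝ)} {z : ι → ℤ} :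
    z ∈ latticePoints S ↔ intVec z ∈ S := Iff.rfl

/-- The real linear map of an integer matrix. -/
def realMap [Fintype ι] (A : Matrix σ ι ℤ) : (ι → ℝ) →ₗ[ℝ] (σ → ℝ) :=
  (A.map (fun a : ℤ => (a : ℝ))).mulVecLin

lemma realMap_apply [Fintype ι] (A : Matrix σ ι ℤ) (x : ι → ℝ) (i : σ) :
    realMap A x i = ∑ j, (A i j : ℝ) * x j := by
  simp [realMap, Matrix.mulVec, dotProduct]

lemma realMap_intVec [Fintype ι] (A : Matrix σ ι ℤ) (x : ι → ℤ) :
    realMap A (intVec x) = intVec (A.mulVec x) := by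
  ext i
  simp [realMap_apply, Matrix.mulVec, dotProduct]

lemma mem_stdPolytope [Fintype ι] {A : Matrix σ ι ℤ} {b : σ → ℤ} {x : ι → ℝ} :
    x ∈ stdPolytope A b ↔ realMap A x = intVec b ∧ ∀ i, 0 ≤ x i := Iff.rfl

lemma mem_paramPolytope [Fintype ι] [Fintype μ] {C : Matrix ρ μ ℤ} {D : Matrix ρ ι ℤ}
    {x : ι → ℝ} {y : μ → ℝ} :
    y ∈ paramPolytope C D x ↔ realMap C y = realMap D x ∧ ∀ j, 0 ≤ y j := Iff.rfl

/-- P* fibres over P with fibre Q(x); the block matrix enters the geometry only through this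
splitting. -/
lemma mem_liftPolytope [Fintype ι] [Fintype μ] {A : Matrix σ ι ℤ} {b : σ → ℤ} {C : Matrix ρ μ ℤ}
    {D : Matrix ρ ι ℤ} {z : ι ⊕ μ → ℝ} :
    z ∈ liftPolytope A b C D ↔
      z ∘ Sum.inl ∈ stdPolytope A b ∧ z ∘ Sum.inr ∈ paramPolytope C D (z ∘ Sum.inl) := by
  rw [liftPolytope, mem_stdPolytope, mem_stdPolytope, mem_paramPolytope]
  simp only [funext_iff, realMap_apply, liftMatrix, Sum.forall, Fintype.sum_sum_type,
    Matrix.fromBlocks_apply₁₁, Matrix.fromBlocks_apply₁₂, Matrix.fromBlocks_apply₂₁,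
    Matrix.fromBlocks_apply₂₂, Matrix.zero_apply, Matrix.neg_apply, Function.comp_apply,
    intVec_apply, Sum.elim_inl, Sum.elim_inr, Pi.zero_apply, Int.cast_zero, zero_mul,
    Finset.sum_const_zero, add_zero, Int.cast_neg, neg_mul, Finset.sum_neg_distrib]
  constructor
  · rintro ⟨⟨h1, h2⟩, h3, h4⟩
    exact ⟨⟨h1, h3⟩, fun i => by linarith [h2 i], h4⟩
  · rintro ⟨⟨h1, h3⟩, h2, h4⟩
    exact ⟨⟨h1, fun i => by linarith [h2 i]⟩, h3, h4⟩

lemma convex_stdPolytope [Fintype ι] (A : Matrix σ ι ℤ) (b : σ → ℤ) :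
    Convex ℝ (stdPolytope A b) := by
  intro x hx y hy a c ha hc hac
  rw [mem_stdPolytope] at *
  refine ⟨?_, fun i => ?_⟩
  · rw [map_add, map_smul, map_smul, hx.1, hy.1, ← add_smul, hac, one_smul]
  · have := mul_nonneg ha (hx.2 i)
    have := mul_nonneg hc (hy.2 i)
    simp only [Pi.add_apply, Pi.smul_apply, smul_eq_mul]
    linarith

lemma continuous_realMap [Fintype ι] (A : Matrix σ ι ℤ) : Continuous (realMap A) := by
  refine continuous_pi fun i => ?_
  simp only [realMap_apply]
  fun_prop

lemma isClosed_stdPolytope [Fintype ι] (A : Matrix σ ι ℤ) (b : σ → ℤ) :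
    IsClosed (stdPolytope A b) := by
  have : stdPolytope A b = {x | realMap A x = intVec b} ∩ ⋂ i, {x | 0 ≤ x i} := by
    ext x; simp [mem_stdPolytope]
  rw [this]
  exact (isClosed_eq (continuous_realMap A) continuous_const).inter
    (isClosed_iInter fun i => isClosed_le continuous_const (continuous_apply i))

lemma smul_stdPolytope_of_pos [Fintype ι] (A : Matrix σ ι ℤ) (b : σ → ℤ) {t : ℕ} (ht : 1 ≤ t) :
    (t : ℝ) • stdPolytope A b = stdPolytope A ((t : ℤ) • b) := by
  have ht0 : (0 : ℝ) < t := by exact_mod_cast ht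
  ext x
  rw [Set.mem_smul_set_iff_inv_smul_mem₀ ht0.ne', mem_stdPolytope, mem_stdPolytope, map_smul,
    inv_smul_eq_iff₀ ht0.ne', intVec_smul]
  simp [ht0]

/-- A bounded polytope in standard form has no direction of recession. -/
lemma eq_zero_of_recession [Fintype ι] {A : Matrix σ ι ℤ} {x₀ : σ → ℝ}
    {x v : ι → ℝ} (hx : realMap A x = x₀) (hx0 : ∀ i, 0 ≤ x i)
    (hb : Bornology.IsBounded {y : ι → ℝ | realMap A y = x₀ ∧ ∀ i, 0 ≤ y i})
    (hv : realMap A v = 0) (hv0 : ∀ i, 0 ≤ v i) : v = 0 := by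
  obtain ⟨R, hR⟩ := hb.exists_norm_le
  by_contra hne
  obtain ⟨i, hi⟩ : ∃ i, v i ≠ 0 := by
    by_contra h
    push Not at h
    exact hne (funext h)
  have hi' : 0 < v i := lt_of_le_of_ne (hv0 i) (Ne.symm hi)
  -- The multiple moves coordinate i by |R| + 1, beyond the bound R on norms.
  have hmem : x + ((|R| + 1) / v i) • v ∈ {y : ι → ℝ | realMap A y = x₀ ∧ ∀ i, 0 ≤ y i} := by
    refine ⟨by rw [map_add, map_smul, hv, hx, smul_zero, add_zero], fun j => ?_⟩
    have := hx0 j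
    have := hv0 j
    simp only [Pi.add_apply, Pi.smul_apply, smul_eq_mul]
    positivity
  have h1 := hR _ hmem
  have h2 := norm_le_pi_norm (x + ((|R| + 1) / v i) • v) i
  simp only [Pi.add_apply, Pi.smul_apply, smul_eq_mul, div_mul_cancel₀ _ hi,
    Real.norm_eq_abs] at h2
  have := hx0 i
  have h3 := le_abs_self (x i + (|R| + 1))
  have := le_abs_self R
  linarith

lemma eq_zero_of_mem_recession [Fintype ι] {A : Matrix σ ι ℤ} {b : σ → ℤ}
    (hb : Bornology.IsBounded (stdPolytope A b)) (hne : (stdPolytope A b).Nonempty)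
    {v : ι → ℝ} (hv : realMap A v = 0) (hv0 : ∀ i, 0 ≤ v i) : v = 0 := by
  obtain ⟨x, hx⟩ := hne
  exact eq_zero_of_recession hx.1 hx.2 hb hv hv0

/-- At t = 0 the right side is the recession cone, which is {0} only because the polytope is bounded
and nonempty. -/
lemma smul_stdPolytope [Fintype ι] {A : Matrix σ ι ℤ} {b : σ → ℤ}
    (hb : Bornology.IsBounded (stdPolytope A b)) (hne : (stdPolytope A b).Nonempty) (t : ℕ) :
    (t : ℝ) • stdPolytope A b = stdPolytope A ((t : ℤ) • b) := by
  rcases Nat.eq_zero_or_pos t with rfl | ht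
  · rw [Nat.cast_zero, Set.zero_smul_set hne]
    ext x
    simp only [Set.mem_zero, mem_stdPolytope, CharP.cast_eq_zero, zero_smul, intVec_zero]
    constructor
    · rintro rfl
      simp
    · rintro ⟨h1, h2⟩
      exact eq_zero_of_mem_recession hb hne h1 h2
  · exact smul_stdPolytope_of_pos A b ht

/-- If `C y = 0`, `y ≥ 0` has the trivial solution only, then `y ≥ 0` is controlled by `C y`. -/
lemma exists_norm_le_mul_norm_realMap [Fintype ρ] [Fintype μ] (C : Matrix ρ μ ℤ)
    (h : ∀ y : μ → ℝ, realMap C y = 0 → (∀ j, 0 ≤ y j) → y = 0) :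
    ∃ K : ℝ, 0 ≤ K ∧ ∀ y : μ → ℝ, (∀ j, 0 ≤ y j) → ‖y‖ ≤ K * ‖realMap C y‖ := by
  -- By homogeneity it suffices to bound ‖C y‖ from below on the compact set of nonnegative unit
  -- vectors.
  set S : Set (μ → ℝ) := Metric.sphere 0 1 ∩ ⋂ j, {y | 0 ≤ y j} with hS
  have hScomp : IsCompact S := (isCompact_sphere 0 1).inter_right
    (isClosed_iInter fun i => isClosed_le continuous_const (continuous_apply i))
  have hscale : ∀ y : μ → ℝ, (∀ j, 0 ≤ y j) → y ≠ 0 → ‖y‖⁻¹ • y ∈ S := by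
    intro y hy hy0
    refine ⟨?_, ?_⟩
    · rw [mem_sphere_zero_iff_norm, norm_smul, norm_inv, norm_norm,
        inv_mul_cancel₀ (norm_ne_zero_iff.mpr hy0)]
    · simp only [Set.mem_iInter]
      intro j
      exact mul_nonneg (inv_nonneg.mpr (norm_nonneg y)) (hy j)
  rcases S.eq_empty_or_nonempty with hE | hN
  · refine ⟨0, le_rfl, fun y hy => ?_⟩
    by_cases hy0 : y = 0
    · simp [hy0]
    · have := hscale y hy hy0
      rw [hE] at this
      exact this.elim
  · obtain ⟨y₁, hy₁, hmin⟩ := hScomp.exists_isMinOn hN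
      ((continuous_realMap C).norm.continuousOn)
    have hpos : 0 < ‖realMap C y₁‖ := by
      rw [norm_pos_iff]
      intro h0
      have hz := h y₁ h0 (by simpa using hy₁.2)
      have := hy₁.1
      rw [hz] at this
      simp at this
    refine ⟨‖realMap C y₁‖⁻¹, by positivity, fun y hy => ?_⟩
    by_cases hy0 : y = 0
    · simp [hy0]
    · have h1 : ‖realMap C y₁‖ ≤ ‖realMap C (‖y‖⁻¹ • y)‖ := hmin (hscale y hy hy0)
      rw [map_smul, norm_smul, norm_inv, norm_norm] at h1
      have hn : 0 < ‖y‖ := norm_pos_iff.mpr hy0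
      rw [inv_mul_eq_div, le_div_iff₀ hpos]
      rw [inv_mul_eq_div, le_div_iff₀ hn] at h1
      linarith

/-- The fibres of a bounded family are bounded by a multiple of the norm of the parameter. -/
lemma exists_norm_le_of_mem_paramPolytope [Fintype ρ] [Fintype ι] [Fintype μ] {C : Matrix ρ μ ℤ}
    {D : Matrix ρ ι ℤ} (hQ : ∀ x : ι → ℝ, Bornology.IsBounded (paramPolytope C D x)) :
    ∃ K : ℝ, 0 ≤ K ∧ ∀ x : ι → ℝ, ∀ y ∈ paramPolytope C D x, ‖y‖ ≤ K * ‖x‖ := by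
  -- Boundedness of the single fibre Q(0), a cone, already excludes nonzero solutions of C y = 0, y
  -- ≥ 0.
  obtain ⟨K, hK0, hK⟩ := exists_norm_le_mul_norm_realMap C (fun y hy hy0 => by
    refine eq_zero_of_recession (A := C) (x₀ := 0) (x := 0) (by simp) (by simp) ?_ hy hy0
    have := hQ 0
    simpa [paramPolytope, realMap] using this)
  set D' := LinearMap.toContinuousLinearMap (realMap D) with hD'
  refine ⟨K * ‖D'‖, by positivity, fun x y hy => ?_⟩
  rw [mem_paramPolytope] at hy
  have h1 := hK y hy.2
  rw [hy.1] at h1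
  have h2 : ‖realMap D x‖ ≤ ‖D'‖ * ‖x‖ := D'.le_opNorm x
  calc ‖y‖ ≤ K * ‖realMap D x‖ := h1
    _ ≤ K * (‖D'‖ * ‖x‖) := by gcongr
    _ = K * ‖D'‖ * ‖x‖ := by ring

lemma isBounded_liftPolytope [Fintype ρ] [Fintype ι] [Fintype μ] {A : Matrix σ ι ℤ} {b : σ → ℤ}
    {C : Matrix ρ μ ℤ} {D : Matrix ρ ι ℤ} (hP : Bornology.IsBounded (stdPolytope A b))
    (hQ : ∀ x : ι → ℝ, Bornology.IsBounded (paramPolytope C D x)) :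
    Bornology.IsBounded (liftPolytope A b C D) := by
  obtain ⟨K, hK0, hK⟩ := exists_norm_le_of_mem_paramPolytope hQ
  obtain ⟨R, hR⟩ := hP.exists_norm_le
  refine isBounded_iff_forall_norm_le.mpr ⟨|R| + K * |R|, fun z hz => ?_⟩
  rw [mem_liftPolytope] at hz
  have h1 : ‖z ∘ Sum.inl‖ ≤ |R| := (hR _ hz.1).trans (le_abs_self R)
  have h2 : ‖z ∘ Sum.inr‖ ≤ K * |R| := (hK _ _ hz.2).trans (by gcongr)
  rw [pi_norm_le_iff_of_nonneg (by positivity)]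
  rintro (i | j)
  · have := norm_le_pi_norm (z ∘ Sum.inl) i
    simp only [Function.comp_apply] at this
    have : 0 ≤ K * |R| := by positivity
    linarith
  · have := norm_le_pi_norm (z ∘ Sum.inr) j
    simp only [Function.comp_apply] at this
    have : 0 ≤ |R| := by positivity
    linarith

lemma finite_latticePoints [Finite ι] {S : Set (ι → ℝ)} (hS : Bornology.IsBounded S) :
    (latticePoints S).Finite := by
  classical
  cases nonempty_fintype ι
  obtain ⟨R, hR⟩ := hS.exists_norm_le
  refine (Set.finite_Icc (fun _ : ι => -⌈|R|⌉) (fun _ => ⌈|R|⌉)).subset fun z hz => ?_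
  have h1 : ∀ i, |(z i : ℝ)| ≤ |R| := fun i =>
    ((norm_le_pi_norm (intVec z) i).trans (hR _ hz)).trans (le_abs_self R)
  have h2 : ∀ i, |z i| ≤ ⌈|R|⌉ := fun i => by
    have := (h1 i).trans (Int.le_ceil |R|)
    exact_mod_cast this
  exact ⟨fun i => (abs_le.mp (h2 i)).1, fun i => (abs_le.mp (h2 i)).2⟩

/-- The weighted lattice point sum over a polytope counts the lattice points of the lift. -/
lemma finsum_weight_eq_latticeCount [Fintype ρ] [Fintype ι] [Fintype μ] {A : Matrix σ ι ℤ}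
    {b : σ → ℤ} {C : Matrix ρ μ ℤ} {D : Matrix ρ ι ℤ}
    (hP : Bornology.IsBounded (stdPolytope A b))
    (hQ : ∀ x : ι → ℝ, Bornology.IsBounded (paramPolytope C D x)) :
    ∑ᶠ x ∈ latticePoints (stdPolytope A b), weight C D x =
      latticeCount (liftPolytope A b C D) := by
  have hfin := finite_latticePoints hP
  have hfinQ : ∀ x : ι → ℝ, (latticePoints (paramPolytope C D x)).Finite := fun x =>
    finite_latticePoints (hQ x)
  classical
  rw [finsum_mem_eq_finite_toFinset_sum _ hfin]
  have h1 : ∀ x : ι → ℤ, weight C D x = (hfinQ (intVec x)).toFinset.card := fun x =>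
    Set.ncard_eq_toFinset_card _ _
  simp only [h1]
  rw [← Finset.card_sigma, latticeCount, ← Set.ncard_coe_finset]
  symm
  refine Set.ncard_congr' ⟨fun z => ⟨⟨fun i => z.1 (Sum.inl i), fun j => z.1 (Sum.inr j)⟩, ?_⟩,
    fun p => ⟨Sum.elim p.1.1 p.1.2, ?_⟩, ?_, ?_⟩
  · have := z.2
    rw [mem_latticePoints, mem_liftPolytope] at this
    rw [Finset.mem_coe, Finset.mem_sigma, Set.Finite.mem_toFinset, Set.Finite.mem_toFinset]
    exact this
  · have := p.2
    simp only [Finset.mem_coe, Finset.mem_sigma,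
      Set.Finite.mem_toFinset] at this
    rw [mem_latticePoints, mem_liftPolytope]
    exact this
  · intro z
    ext (i | i) <;> rfl
  · rintro ⟨⟨x, y⟩, h⟩
    rfl

/-- A convex set of nonnegative vectors has an element of maximal support. -/
lemma exists_maximal_support [Finite ι] {S : Set (ι → ℝ)} (hS : Convex ℝ S) (hne : S.Nonempty)
    (h0 : ∀ x ∈ S, ∀ i, 0 ≤ x i) : ∃ x ∈ S, ∀ i, x i = 0 → ∀ y ∈ S, y i = 0 := by
  cases nonempty_fintype ι
  classical
  suffices h : ∀ F : Finset ι, ∃ x ∈ S, ∀ i ∈ F, x i = 0 → ∀ y ∈ S, y i = 0 by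
    obtain ⟨x, hx, h⟩ := h Finset.univ
    exact ⟨x, hx, fun i => h i (Finset.mem_univ i)⟩
  intro F
  induction F using Finset.induction_on with
  | empty =>
    obtain ⟨x, hx⟩ := hne
    exact ⟨x, hx, by simp⟩
  | insert i F _ ih =>
    obtain ⟨x, hx, h⟩ := ih
    by_cases hi : ∀ y ∈ S, y i = 0
    · refine ⟨x, hx, fun j hj hj0 => ?_⟩
      rcases Finset.mem_insert.mp hj with rfl | hj
      · exact hi
      · exact h j hj hj0
    · push Not at hi
      obtain ⟨y, hy, hyi⟩ := hi
      -- The midpoint of two nonnegative vectors vanishes only where both do.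
      refine ⟨(1 / 2 : ℝ) • x + (1 / 2 : ℝ) • y, hS hx hy (by norm_num) (by norm_num)
        (by norm_num), fun j hj hj0 => ?_⟩
      simp only [Pi.add_apply, Pi.smul_apply, smul_eq_mul] at hj0
      have hxj := h0 x hx j
      have hyj := h0 y hy j
      rcases Finset.mem_insert.mp hj with rfl | hj
      · exact absurd (by linarith) hyi
      · exact h j hj (by linarith)

/-- The real solutions of `A v = 0` that vanish where `x` does. -/
def facialKernel [Fintype ι] (A : Matrix σ ι ℤ) (x : ι → ℝ) : Submodule ℝ (ι → ℝ) where
  carrier := {v | realMap A v = 0 ∧ ∀ i, x i = 0 → v i = 0}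
  zero_mem' := by simp
  add_mem' := by
    rintro v w ⟨hv, hv'⟩ ⟨hw, hw'⟩
    exact ⟨by rw [map_add, hv, hw, add_zero], fun i hi => by
      rw [Pi.add_apply, hv' i hi, hw' i hi, add_zero]⟩
  smul_mem' := by
    rintro c v ⟨hv, hv'⟩
    exact ⟨by rw [map_smul, hv, smul_zero], fun i hi => by
      rw [Pi.smul_apply, hv' i hi, smul_zero]⟩

lemma mem_facialKernel [Fintype ι] {A : Matrix σ ι ℤ} {x v : ι → ℝ} :
    v ∈ facialKernel A x ↔ realMap A v = 0 ∧ ∀ i, x i = 0 → v i = 0 := Iff.rfl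

/-- A small multiple of a vector that is supported in the support of `x ≥ 0` may be added. -/
lemma exists_pos_add_smul_nonneg [Finite ι] {x v : ι → ℝ} (hx : ∀ i, 0 ≤ x i)
    (hv : ∀ i, x i = 0 → v i = 0) : ∃ ε : ℝ, 0 < ε ∧ ∀ i, 0 ≤ (x + ε • v) i := by
  have h : ∀ i, ∀ᶠ ε in 𝓝[>] (0 : ℝ), 0 ≤ (x + ε • v) i := by
    intro i
    by_cases hi : x i = 0
    · simp [hi, hv i hi]
    · have hpos : 0 < x i := lt_of_le_of_ne (hx i) (Ne.symm hi)
      have hc : Tendsto (fun ε : ℝ => (x + ε • v) i) (𝓝[>] 0) (𝓝 (x i)) := by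
        have : Continuous (fun ε : ℝ => (x + ε • v) i) := by
          simp only [Pi.add_apply, Pi.smul_apply, smul_eq_mul]; fun_prop
        have := this.tendsto 0
        simp only [zero_smul, add_zero] at this
        exact this.mono_left nhdsWithin_le_nhds
      exact (hc.eventually (lt_mem_nhds hpos)).mono fun ε h => h.le
  obtain ⟨ε, hε, hε0⟩ := ((eventually_all.mpr h).and self_mem_nhdsWithin).exists
  exact ⟨ε, hε0, hε⟩

/-- The direction of the affine hull of a slice of the nonnegative orthant. -/
lemma vectorSpan_eq_facialKernel [Fintype ι] {A : Matrix σ ι ℤ} {a : σ → ℝ} {S : Set (ι → ℝ)}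
    (hS : ∀ x, x ∈ S ↔ realMap A x = a ∧ ∀ i, 0 ≤ x i) {x : ι → ℝ} (hx : x ∈ S)
    (hmax : ∀ i, x i = 0 → ∀ y ∈ S, y i = 0) : vectorSpan ℝ S = facialKernel A x := by
  apply le_antisymm
  · rw [vectorSpan_def, Submodule.span_le]
    rintro _ ⟨y, hy, z, hz, rfl⟩
    change realMap A (y - z) = 0 ∧ ∀ i, x i = 0 → (y - z) i = 0
    refine ⟨?_, fun i hi => ?_⟩
    · rw [map_sub, ((hS y).1 hy).1, ((hS z).1 hz).1, sub_self]
    · rw [Pi.sub_apply, hmax i hi y hy, hmax i hi z hz, sub_self]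
  · rintro v ⟨hv, hv0⟩
    -- A vector supported in the support of x is a multiple of the difference of x + εv and x, both
    -- in S.
    obtain ⟨ε, hε, h⟩ := exists_pos_add_smul_nonneg ((hS x).1 hx).2 hv0
    have hmem : x + ε • v ∈ S :=
      (hS _).2 ⟨by rw [map_add, map_smul, hv, smul_zero, add_zero, ((hS x).1 hx).1], h⟩
    have := vsub_mem_vectorSpan ℝ hmem hx
    rw [vsub_eq_sub, add_sub_cancel_left] at this
    exact ((vectorSpan ℝ S).smul_mem_iff hε.ne').mp this

lemma smul_mem_smul_stdPolytope_maximal [Fintype ι] {A : Matrix σ ι ℤ} {b : σ → ℤ}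
    {x : ι → ℝ} (hmax : ∀ i, x i = 0 → ∀ y ∈ stdPolytope A b, y i = 0) (t : ℝ) :
    ∀ i, x i = 0 → ∀ y ∈ t • stdPolytope A b, y i = 0 := by
  rintro i hi _ ⟨y, hy, rfl⟩
  simp [hmax i hi y hy]

/-- The affine hull of a dilate, in equations. -/
lemma mem_affineSpan_smul_stdPolytope [Fintype ι] {A : Matrix σ ι ℤ} {b : σ → ℤ} {x : ι → ℝ}
    (hx : x ∈ stdPolytope A b) (hmax : ∀ i, x i = 0 → ∀ y ∈ stdPolytope A b, y i = 0) {t : ℕ}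
    (ht : 1 ≤ t) {z : ι → ℝ} :
    z ∈ affineSpan ℝ ((t : ℝ) • stdPolytope A b) ↔
      realMap A z = intVec ((t : ℤ) • b) ∧ ∀ i, x i = 0 → z i = 0 := by
  have ht0 : (t : ℝ) ≠ 0 := by positivity
  have hmem : (t : ℝ) • x ∈ (t : ℝ) • stdPolytope A b := Set.smul_mem_smul_set hx
  have hmax' : ∀ i, ((t : ℝ) • x) i = 0 → ∀ y ∈ (t : ℝ) • stdPolytope A b, y i = 0 := by
    intro i hi
    refine smul_mem_smul_stdPolytope_maximal hmax t i ?_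
    simpa [ht0] using hi
  have hV : vectorSpan ℝ ((t : ℝ) • stdPolytope A b) = facialKernel A ((t : ℝ) • x) := by
    refine vectorSpan_eq_facialKernel (a := intVec ((t : ℤ) • b)) (fun y => ?_) hmem hmax'
    rw [smul_stdPolytope_of_pos A b ht]
    rfl
  have hdir := AffineSubspace.vsub_right_mem_direction_iff_mem
    (mem_affineSpan ℝ hmem) z
  rw [direction_affineSpan, hV, mem_facialKernel, vsub_eq_sub, map_sub, map_smul] at hdir
  have he : intVec ((t : ℤ) • b) = (t : ℝ) • intVec b := by rw [intVec_smul]; simp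
  have hx1 : realMap A x = intVec b := hx.1
  rw [← hdir, he, sub_eq_zero]
  refine and_congr (by rw [← hx1]) (forall_congr' fun i => ?_)
  simp only [Pi.smul_apply, smul_eq_mul, mul_eq_zero, ht0, false_or, Pi.sub_apply]
  exact imp_congr_right fun hi => by simp [hi]

/-- Only the right-hand side of the integer system depends on t. Hence integer solutions can be
shifted from one dilate to another. -/
lemma mem_affLattice_stdPolytope [Fintype ι] {A : Matrix σ ι ℤ} {b : σ → ℤ} {x : ι → ℝ}
    (hx : x ∈ stdPolytope A b) (hmax : ∀ i, x i = 0 → ∀ y ∈ stdPolytope A b, y i = 0) {t : ℕ}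
    (ht : 1 ≤ t) {z : ι → ℤ} :
    z ∈ affLattice (stdPolytope A b) t ↔
      A.mulVec z = (t : ℤ) • b ∧ ∀ i, x i = 0 → z i = 0 := by
  have := mem_affineSpan_smul_stdPolytope hx hmax ht (z := intVec z)
  rw [affLattice, mem_latticePoints, SetLike.mem_coe, this, realMap_intVec,
    intVec_injective.eq_iff]
  simp

end Basics

end WeightLifting

namespace WeightLifting

noncomputable section

/-! ### Descent from real to rational and integer solutions. -/

section Rational

variable {σ ι : Type*}

lemma exists_common_denominator [Fintype ι] (q : ι → ℚ) :
    ∃ N : ℕ, 0 < N ∧ ∃ z : ι → ℤ, ∀ i, (z i : ℚ) = N * q i := by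
  refine ⟨∏ i, (q i).den, Finset.prod_pos fun i _ => (q i).den_pos, ?_⟩
  have h : ∀ i, ∃ z : ℤ, (z : ℚ) = ((∏ j, (q j).den : ℕ) : ℚ) * q i := by
    intro i
    obtain ⟨k, hk⟩ := Finset.dvd_prod_of_mem (fun j => (q j).den) (Finset.mem_univ i)
    refine ⟨k * (q i).num, ?_⟩
    rw [hk]
    have := Rat.mul_den_eq_num (q i)
    push_cast
    rw [← this]
    ring
  choose z hz using h
  exact ⟨z, hz⟩

/-- A ℚ-linear functional, applied to each coordinate, respects integer equations and preserves zero
coordinates, so it turns real solutions into rational ones. -/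
lemma map_sum_intCast_mul [Fintype ι] (π : ℝ →ₗ[ℚ] ℚ) (a : ι → ℤ) (x : ι → ℝ) :
    π (∑ j, (a j : ℝ) * x j) = ∑ j, (a j : ℚ) * π (x j) := by
  rw [map_sum]
  refine Finset.sum_congr rfl fun j _ => ?_
  have : (a j : ℝ) * x j = (a j : ℚ) • x j := by rw [Rat.smul_def]; simp
  rw [this, map_smul, smul_eq_mul]

/-- A real solution of an integer system gives a rational one, by a projection of `ℝ` onto `ℚ`. -/
lemma exists_integer_multiple_solution [Fintype ι] {A : Matrix σ ι ℤ} {a : σ → ℤ} {x : ι → ℝ}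
    (h : realMap A x = intVec a) :
    ∃ N : ℕ, 0 < N ∧ ∃ z : ι → ℤ, A.mulVec z = (N : ℤ) • a ∧ ∀ i, x i = 0 → z i = 0 := by
  obtain ⟨π, hπ⟩ := LinearMap.exists_leftInverse_of_injective (Algebra.linearMap ℚ ℝ)
    (LinearMap.ker_eq_bot.mpr (algebraMap ℚ ℝ).injective)
  have hπ' : ∀ q : ℚ, π (q : ℝ) = q := fun q => by
    have := LinearMap.congr_fun hπ q
    simpa using this
  obtain ⟨N, hN, z, hz⟩ := exists_common_denominator (fun i => π (x i))
  refine ⟨N, hN, z, ?_, fun i hi => ?_⟩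
  · ext i
    have h1 := congrArg π (congrFun h i)
    rw [realMap_apply, map_sum_intCast_mul, intVec_apply] at h1
    have h2 : π ((a i : ℤ) : ℝ) = a i := by simpa using hπ' (a i)
    rw [h2] at h1
    have : ((A.mulVec z i : ℤ) : ℚ) = N * a i := by
      rw [← h1, Finset.mul_sum]
      simp only [Matrix.mulVec, dotProduct, Int.cast_sum, Int.cast_mul, hz]
      exact Finset.sum_congr rfl fun j _ => by ring
    simp only [Pi.smul_apply, smul_eq_mul]
    exact_mod_cast this
  · have := hz i
    rw [hi, map_zero, mul_zero] at this
    exact_mod_cast this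

/-- The real solutions of a homogeneous integer system are spanned by the integer ones. -/
lemma facialKernel_le_span [Fintype ι] (A : Matrix σ ι ℤ) (x : ι → ℝ) :
    facialKernel A x ≤
      Submodule.span ℝ (intVec '' {z : ι → ℤ | intVec z ∈ facialKernel A x}) := by
  classical
  rintro v ⟨hv, hv0⟩
  -- In a Hamel basis of ℝ over ℚ, v is a finite real combination of the rational vectors formed by
  -- the coordinates of its entries, and each of these solves the system.
  set e := Module.Basis.ofVectorSpace ℚ ℝ
  set F : Finset (Module.Basis.ofVectorSpaceIndex ℚ ℝ) :=
    Finset.univ.biUnion fun i => (e.repr (v i)).support with hF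
  have hsum : v = ∑ k ∈ F, e k • (fun i => ((e.repr (v i) k : ℚ) : ℝ)) := by
    ext i
    rw [Finset.sum_apply]
    have h1 := e.linearCombination_repr (v i)
    rw [Finsupp.linearCombination_apply, Finsupp.sum_of_support_subset (s := F)] at h1
    · conv_lhs => rw [← h1]
      refine Finset.sum_congr rfl fun k _ => ?_
      rw [Rat.smul_def, Pi.smul_apply, smul_eq_mul, mul_comm]
    · exact Finset.subset_biUnion_of_mem (fun i => (e.repr (v i)).support) (Finset.mem_univ i)
    · simp
  rw [hsum]
  refine Submodule.sum_mem _ fun k _ => Submodule.smul_mem _ _ ?_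
  obtain ⟨N, hN, z, hz⟩ := exists_common_denominator (fun i => e.repr (v i) k)
  have hz' : (fun i => ((e.repr (v i) k : ℚ) : ℝ)) = (N : ℝ)⁻¹ • intVec z := by
    ext i
    have hN' : (N : ℝ) ≠ 0 := by positivity
    rw [Pi.smul_apply, smul_eq_mul, eq_inv_mul_iff_mul_eq₀ hN', intVec_apply]
    have := hz i
    exact_mod_cast this.symm
  rw [hz']
  refine Submodule.smul_mem _ _ (Submodule.subset_span ⟨z, ⟨?_, fun i hi => ?_⟩, rfl⟩)
  · ext i
    have h1 := congrArg (e.coord k) (congrFun hv i)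
    rw [realMap_apply, map_sum_intCast_mul, Pi.zero_apply, map_zero] at h1
    simp only [Module.Basis.coord_apply] at h1
    rw [realMap_apply, Pi.zero_apply]
    have : (∑ j, (A i j : ℚ) * z j) = 0 := by
      simp only [hz]
      rw [← mul_zero (N : ℚ), ← h1, Finset.mul_sum]
      exact Finset.sum_congr rfl fun j _ => by ring
    simp only [intVec_apply]
    exact_mod_cast this
  · have := hz i
    rw [hv0 i hi] at this
    simp only [map_zero, Finsupp.coe_zero, Pi.zero_apply, mul_zero, Int.cast_eq_zero] at this
    simp [this]

/-- Integer vectors that are linearly independent over `ℤ` are so over `ℝ`. -/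
lemma linearIndependent_intVec {κ : Type*} [Fintype κ] [Fintype ι] {v : κ → ι → ℤ}
    (hv : LinearIndependent ℤ v) : LinearIndependent ℝ (fun k => intVec (v k)) := by
  rw [Fintype.linearIndependent_iff] at hv ⊢
  intro c hc k
  set e := Module.Basis.ofVectorSpace ℚ ℝ
  -- The l-th rational coordinates of the coefficients form a rational relation; cleared of
  -- denominators, it is an integer relation, hence trivial.
  have key : ∀ l, e.repr (c k) l = 0 := by
    intro l
    obtain ⟨N, hN, z, hz⟩ := exists_common_denominator (fun i => e.repr (c i) l)
    have h0 := hv z (by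
      ext i
      have h1 := congrArg (e.coord l) (congrFun hc i)
      have h2 : (∑ j, c j • intVec (v j)) i = ∑ j, (v j i : ℝ) * c j := by
        simp [Finset.sum_apply, mul_comm]
      rw [h2, map_sum_intCast_mul, Pi.zero_apply, map_zero] at h1
      simp only [Module.Basis.coord_apply] at h1
      have : (∑ j, (v j i : ℚ) * z j) = 0 := by
        simp only [hz]
        rw [← mul_zero (N : ℚ), ← h1, Finset.mul_sum]
        exact Finset.sum_congr rfl fun j _ => by ring
      rw [Finset.sum_apply, Pi.zero_apply]
      simp only [Pi.smul_apply, smul_eq_mul]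
      have h3 : (∑ j, v j i * z j) = 0 := by exact_mod_cast this
      rw [← h3]
      exact Finset.sum_congr rfl fun j _ => by ring) k
    have := hz k
    rw [h0] at this
    have hN' : (N : ℚ) ≠ 0 := by positivity
    simpa [hN'] using this.symm
  have : e.repr (c k) = 0 := Finsupp.ext key
  simpa using this

end Rational

/-! ### Lattice coordinates on the affine hull. -/

section Coordinates

variable {ι : Type*} [Fintype ι]

/-- The index set of the chosen basis of the lattice parallel to a set. -/
abbrev LatticeIndex (S : Set (ι → ℝ)) := Module.Free.ChooseBasisIndex ℤ (latticeDirection S)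

/-- Real coordinates with respect to the chosen basis of the lattice parallel to a set. -/
def latticeMap (S : Set (ι → ℝ)) : (LatticeIndex S → ℝ) →ₗ[ℝ] (ι → ℝ) :=
  Fintype.linearCombination ℝ
    (fun i => intVec (Module.Free.chooseBasis ℤ (latticeDirection S) i : ι → ℤ))

lemma latticeMap_apply (S : Set (ι → ℝ)) (c : LatticeIndex S → ℝ) :
    latticeMap S c =
      ∑ i, c i • intVec (Module.Free.chooseBasis ℤ (latticeDirection S) i : ι → ℤ) := rfl

/-- Integer coordinates with respect to the chosen basis of the lattice parallel to a set. -/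
def latticeVec (S : Set (ι → ℝ)) (c : LatticeIndex S → ℤ) : ι → ℤ :=
  ((Module.Free.chooseBasis ℤ (latticeDirection S)).equivFun.symm c : latticeDirection S)

lemma latticeMap_intVec (S : Set (ι → ℝ)) (c : LatticeIndex S → ℤ) :
    latticeMap S (intVec c) = intVec (latticeVec S c) := by
  rw [latticeMap_apply, latticeVec, Module.Basis.equivFun_symm_apply]
  ext j
  simp [Finset.sum_apply]

lemma exists_latticeVec_eq {S : Set (ι → ℝ)} {z : ι → ℤ} (hz : intVec z ∈ vectorSpan ℝ S) :
    ∃ c, latticeVec S c = z :=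
  ⟨(Module.Free.chooseBasis ℤ (latticeDirection S)).equivFun ⟨z, hz⟩, by simp [latticeVec]⟩

lemma latticeVec_injective (S : Set (ι → ℝ)) : Function.Injective (latticeVec S) :=
  Subtype.val_injective.comp
    (Module.Free.chooseBasis ℤ (latticeDirection S)).equivFun.symm.injective

lemma latticeMap_injective (S : Set (ι → ℝ)) : Function.Injective (latticeMap S) := by
  have h : LinearIndependent ℤ
      (fun i => (Module.Free.chooseBasis ℤ (latticeDirection S) i : ι → ℤ)) :=
    (Module.Free.chooseBasis ℤ (latticeDirection S)).linearIndependent.map'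
      (latticeDirection S).subtype (Submodule.ker_subtype _)
  exact (linearIndependent_intVec h).fintypeLinearCombination_injective

lemma continuous_latticeMap (S : Set (ι → ℝ)) : Continuous (latticeMap S) :=
  LinearMap.continuous_of_finiteDimensional _

/-- The direction of the affine hull is spanned by integer vectors. -/
def RationalDirection (S : Set (ι → ℝ)) : Prop :=
  vectorSpan ℝ S ≤ Submodule.span ℝ (intVec '' {z : ι → ℤ | intVec z ∈ vectorSpan ℝ S})

/-- The integer vectors parallel to the hull could have too small a rank; rationality of the
direction is what makes them span it. -/
lemma range_latticeMap {S : Set (ι → ℝ)} (hS : RationalDirection S) :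
    LinearMap.range (latticeMap S) = vectorSpan ℝ S := by
  apply le_antisymm
  · rintro _ ⟨c, rfl⟩
    rw [latticeMap_apply]
    exact Submodule.sum_mem _ fun i _ => Submodule.smul_mem _ _
      (Module.Free.chooseBasis ℤ (latticeDirection S) i).2
  · refine hS.trans (Submodule.span_le.mpr ?_)
    rintro _ ⟨z, hz, rfl⟩
    obtain ⟨c, rfl⟩ := exists_latticeVec_eq hz
    exact ⟨intVec c, latticeMap_intVec S c⟩

lemma card_latticeIndex {S : Set (ι → ℝ)} (hS : RationalDirection S) :
    Fintype.card (LatticeIndex S) = affDim S := by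
  rw [affDim, ← range_latticeMap hS, LinearMap.finrank_range_of_inj (latticeMap_injective S),
    Module.finrank_fintype_fun_eq_card]

/-- The parametrization that defines `latticeMeasure`. -/
def latticeChart (S : Set (ι → ℝ)) (hS : S.Nonempty) (c : LatticeIndex S → ℝ) : ι → ℝ :=
  hS.some + latticeMap S c

lemma latticeMeasure_eq {S : Set (ι → ℝ)} (hS : S.Nonempty) :
    latticeMeasure S = Measure.map (latticeChart S hS) volume := by
  rw [latticeMeasure, dif_pos hS]
  rfl

lemma continuous_latticeChart {S : Set (ι → ℝ)} (hS : S.Nonempty) :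
    Continuous (latticeChart S hS) := continuous_const.add (continuous_latticeMap S)

lemma isClosedEmbedding_latticeChart {S : Set (ι → ℝ)} (hS : S.Nonempty) :
    IsClosedEmbedding (latticeChart S hS) :=
  (Homeomorph.addLeft hS.some).isClosedEmbedding.comp
    (LinearMap.isClosedEmbedding_of_injective (LinearMap.ker_eq_bot.mpr (latticeMap_injective S)))

lemma measurableEmbedding_latticeChart {S : Set (ι → ℝ)} (hS : S.Nonempty) :
    MeasurableEmbedding (latticeChart S hS) :=
  (isClosedEmbedding_latticeChart hS).measurableEmbedding

end Coordinates

/-! ### Riemann sums over shifted grids. -/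

section RiemannSum

variable {κ : Type*}

/-- The corner of the cell of the grid `θ + δ ℤ^κ` that contains `u`. -/
def gridFloor (δ : ℝ) (θ u : κ → ℝ) : κ → ℝ :=
  θ + δ • intVec (fun i => ⌊(u i - θ i) / δ⌋)

lemma norm_gridFloor_sub_le [Fintype κ] {δ : ℝ} (hδ : 0 < δ) (θ u : κ → ℝ) : ‖gridFloor δ θ u - u‖ ≤ δ := by
  rw [pi_norm_le_iff_of_nonneg hδ.le]
  intro i
  have h1 := Int.floor_le ((u i - θ i) / δ)
  have h2 := Int.lt_floor_add_one ((u i - θ i) / δ)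
  rw [le_div_iff₀ hδ] at h1
  rw [div_lt_iff₀ hδ] at h2
  simp only [gridFloor, Pi.sub_apply, Pi.add_apply, Pi.smul_apply, intVec_apply, smul_eq_mul,
    Real.norm_eq_abs]
  rw [abs_le]
  constructor <;> nlinarith

lemma tendsto_gridFloor [Fintype κ] {δ : ℕ → ℝ} (hδ : ∀ k, 0 < δ k) (hδ0 : Tendsto δ atTop (𝓝 0))
    (θ : ℕ → κ → ℝ) (u : κ → ℝ) :
    Tendsto (fun k => gridFloor (δ k) (θ k) u) atTop (𝓝 u) := by
  rw [tendsto_iff_norm_sub_tendsto_zero]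
  exact squeeze_zero (fun _ => norm_nonneg _) (fun k => norm_gridFloor_sub_le (hδ k) _ _) hδ0

/-- The cell of the grid `θ + δ ℤ^κ` with corner `θ + δ c`. -/
def gridCell (δ : ℝ) (θ : κ → ℝ) (c : κ → ℤ) : Set (κ → ℝ) :=
  Set.pi univ fun i => Ico (θ i + δ * c i) (θ i + δ * c i + δ)

lemma mem_gridCell {δ : ℝ} (hδ : 0 < δ) {θ : κ → ℝ} {c : κ → ℤ} {u : κ → ℝ} :
    u ∈ gridCell δ θ c ↔ (fun i => ⌊(u i - θ i) / δ⌋) = c := by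
  simp only [gridCell, Set.mem_pi, mem_univ, true_implies, mem_Ico, funext_iff, Int.floor_eq_iff,
    le_div_iff₀ hδ, div_lt_iff₀ hδ]
  refine forall_congr' fun i => and_congr ?_ ?_ <;> constructor <;> intro h <;> linarith

lemma measurableSet_gridCell [Fintype κ] (δ : ℝ) (θ : κ → ℝ) (c : κ → ℤ) : MeasurableSet (gridCell δ θ c) :=
  MeasurableSet.univ_pi fun _ => measurableSet_Ico

lemma volume_gridCell [Fintype κ] {δ : ℝ} (hδ : 0 < δ) (θ : κ → ℝ) (c : κ → ℤ) :
    volume (gridCell δ θ c) = ENNReal.ofReal (δ ^ Fintype.card κ) := by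
  rw [gridCell, Real.volume_pi_Ico]
  simp only [add_sub_cancel_left, Finset.prod_const, Finset.card_univ]
  rw [ENNReal.ofReal_pow hδ.le]

lemma finite_support_grid [Fintype κ] {h : (κ → ℝ) → ℝ} {R : ℝ} (hR : ∀ u, h u ≠ 0 → ‖u‖ ≤ R) {δ : ℝ}
    (hδ : 0 < δ) (θ : κ → ℝ) :
    (Function.support fun c : κ → ℤ => h (θ + δ • intVec c)).Finite := by
  have hb : Bornology.IsBounded {u : κ → ℝ | ‖θ + δ • u‖ ≤ R} := by
    refine isBounded_iff_forall_norm_le.mpr ⟨δ⁻¹ * (R + ‖θ‖), fun u hu => ?_⟩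
    rw [mem_ofPred_eq] at hu
    have h1 : ‖δ • u‖ ≤ R + ‖θ‖ := by
      calc ‖δ • u‖ = ‖(θ + δ • u) - θ‖ := by rw [add_sub_cancel_left]
        _ ≤ ‖θ + δ • u‖ + ‖θ‖ := norm_sub_le _ _
        _ ≤ R + ‖θ‖ := by gcongr
    rw [norm_smul, Real.norm_eq_abs, abs_of_pos hδ] at h1
    rw [inv_mul_eq_div, le_div_iff₀ hδ]
    linarith
  exact (finite_latticePoints hb).subset fun c hc => hR _ hc

/-- Each point lies in exactly one cell, so sampling h at cell corners gives a finite combination of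
indicators. Its exact integral is the Riemann sum. -/
lemma comp_gridFloor_eq_sum {h : (κ → ℝ) → ℝ} {δ : ℝ} (hδ : 0 < δ) (θ : κ → ℝ)
    (hfin : (Function.support fun c : κ → ℤ => h (θ + δ • intVec c)).Finite) (u : κ → ℝ) :
    h (gridFloor δ θ u) =
      ∑ c ∈ hfin.toFinset, (gridCell δ θ c).indicator (fun _ => h (θ + δ • intVec c)) u := by
  set c₀ : κ → ℤ := fun i => ⌊(u i - θ i) / δ⌋ with hc₀
  have h1 : ∀ c, c ≠ c₀ →
      (gridCell δ θ c).indicator (fun _ => h (θ + δ • intVec c)) u = 0 := by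
    intro c hc
    refine indicator_of_notMem (fun hmem => hc ?_) _
    exact ((mem_gridCell hδ).mp hmem).symm
  have h2 : (gridCell δ θ c₀).indicator (fun _ => h (θ + δ • intVec c₀)) u
      = h (gridFloor δ θ u) := by
    rw [indicator_of_mem ((mem_gridCell hδ).mpr rfl)]
    rfl
  rw [← h2]
  symm
  refine Finset.sum_eq_single c₀ (fun c _ hc => h1 c hc) (fun hc => ?_)
  rw [Set.Finite.mem_toFinset, Function.mem_support, not_not] at hc
  rw [h2]
  exact hc

lemma measurable_comp_gridFloor [Fintype κ] {h : (κ → ℝ) → ℝ} {δ : ℝ} (hδ : 0 < δ) (θ : κ → ℝ)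
    (hfin : (Function.support fun c : κ → ℤ => h (θ + δ • intVec c)).Finite) :
    Measurable fun u => h (gridFloor δ θ u) := by
  simp only [comp_gridFloor_eq_sum hδ θ hfin]
  exact Finset.measurable_sum _ fun c _ =>
    measurable_const.indicator (measurableSet_gridCell δ θ c)

lemma integral_comp_gridFloor [Fintype κ] {h : (κ → ℝ) → ℝ} {δ : ℝ} (hδ : 0 < δ) (θ : κ → ℝ)
    (hfin : (Function.support fun c : κ → ℤ => h (θ + δ • intVec c)).Finite) :
    ∫ u, h (gridFloor δ θ u) =
      δ ^ Fintype.card κ * ∑ᶠ c : κ → ℤ, h (θ + δ • intVec c) := by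
  simp only [comp_gridFloor_eq_sum hδ θ hfin]
  rw [integral_finsetSum, finsum_eq_sum_of_support_subset _ (s := hfin.toFinset) (by simp),
    Finset.mul_sum]
  · refine Finset.sum_congr rfl fun c _ => ?_
    rw [integral_indicator_const _ (measurableSet_gridCell δ θ c), measureReal_def,
      volume_gridCell hδ, ENNReal.toReal_ofReal (by positivity), smul_eq_mul]
  · intro c _
    refine (integrable_indicator_iff (measurableSet_gridCell δ θ c)).mpr ?_
    exact integrableOn_const (by rw [volume_gridCell hδ]; exact ENNReal.ofReal_ne_top)

/-- A point is within δ ≤ 1 of its cell corner, so sampling enlarges the support by at most 1. This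
is a dominating function independent of the grid. -/
lemma norm_comp_gridFloor_le [Fintype κ] {h : (κ → ℝ) → ℝ} {B R : ℝ} (hB : ∀ u, |h u| ≤ B)
    (hR : ∀ u, h u ≠ 0 → ‖u‖ ≤ R) {δ : ℝ} (hδ : 0 < δ) (hδ1 : δ ≤ 1) (θ u : κ → ℝ) :
    ‖h (gridFloor δ θ u)‖ ≤ (Metric.closedBall (0 : κ → ℝ) (R + 1)).indicator (fun _ => B) u := by
  by_cases hu : u ∈ Metric.closedBall (0 : κ → ℝ) (R + 1)
  · rw [indicator_of_mem hu]
    exact hB _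
  · rw [indicator_of_notMem hu, norm_le_zero_iff]
    by_contra hne
    refine hu (mem_closedBall_zero_iff.mpr ?_)
    have h1 := hR _ hne
    have h2 := norm_gridFloor_sub_le hδ θ u
    calc ‖u‖ = ‖gridFloor δ θ u - (gridFloor δ θ u - u)‖ := by congr 1; abel
      _ ≤ ‖gridFloor δ θ u‖ + ‖gridFloor δ θ u - u‖ := norm_sub_le _ _
      _ ≤ R + 1 := by linarith

lemma integrable_indicator_closedBall [Fintype κ] (B R : ℝ) :
    Integrable ((Metric.closedBall (0 : κ → ℝ) R).indicator (fun _ => B)) := by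
  refine (integrable_indicator_iff measurableSet_closedBall).mpr ?_
  exact integrableOn_const measure_closedBall_lt_top.ne

/-- Riemann sums over arbitrarily shifted grids converge to the integral. -/
theorem tendsto_riemann_sum [Fintype κ] {h : (κ → ℝ) → ℝ} {B R : ℝ} (hB : ∀ u, |h u| ≤ B)
    (hR : ∀ u, h u ≠ 0 → ‖u‖ ≤ R) (hc : ∀ᵐ u, ContinuousAt h u) {δ : ℕ → ℝ}
    (hδ : ∀ k, 0 < δ k) (hδ0 : Tendsto δ atTop (𝓝 0)) (θ : ℕ → κ → ℝ) :
    Tendsto (fun k => δ k ^ Fintype.card κ * ∑ᶠ c : κ → ℤ, h (θ k + δ k • intVec c)) atTop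
      (𝓝 (∫ u, h u)) := by
  -- Written as integrals of sampled functions, the sums converge by domination: cell corners tend
  -- to u however the grids are shifted.
  have h1 : ∀ k, δ k ^ Fintype.card κ * ∑ᶠ c : κ → ℤ, h (θ k + δ k • intVec c) =
      ∫ u, h (gridFloor (δ k) (θ k) u) := fun k =>
    (integral_comp_gridFloor (hδ k) (θ k) (finite_support_grid hR (hδ k) (θ k))).symm
  simp only [h1]
  refine tendsto_integral_filter_of_dominated_convergence
    ((Metric.closedBall (0 : κ → ℝ) (R + 1)).indicator (fun _ => B)) ?_ ?_
    (integrable_indicator_closedBall B (R + 1)) ?_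
  · exact Eventually.of_forall fun k => (measurable_comp_gridFloor (hδ k) (θ k)
      (finite_support_grid hR (hδ k) (θ k))).aestronglyMeasurable
  · filter_upwards [hδ0.eventually (gt_mem_nhds one_pos)] with k hk
    exact Eventually.of_forall fun u => norm_comp_gridFloor_le hB hR (hδ k) hk.le (θ k) u
  · filter_upwards [hc] with u hu
    exact hu.tendsto.comp (tendsto_gridFloor hδ hδ0 θ u)

end RiemannSum

end

end WeightLifting

namespace WeightLifting

noncomputable section

/-! ### Lattice points of dilates as shifted grids. -/

section LatticeSums

variable {σ ι : Type*}

lemma inv_smul_mem_affineSpan {S : Set (ι → ℝ)} {t : ℝ} (ht : t ≠ 0) {z : ι → ℝ}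
    (hz : z ∈ affineSpan ℝ (t • S)) : t⁻¹ • z ∈ affineSpan ℝ S := by
  have h := AffineSubspace.map_span (LinearMap.toAffineMap (t⁻¹ • LinearMap.id (R := ℝ))) (t • S)
  have h1 : (LinearMap.toAffineMap (t⁻¹ • LinearMap.id (R := ℝ) (M := ι → ℝ))) '' (t • S) = S := by
    change (fun x : ι → ℝ => t⁻¹ • x) '' (t • S) = S
    rw [image_smul, inv_smul_smul₀ ht]
  rw [h1] at h
  rw [← h]
  exact ⟨z, hz, rfl⟩

variable [Fintype ι]

/-- Any integer point of the hull of the t-th dilate, divided by t, can serve as origin of the grid.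
No control over its position is needed. -/
lemma exists_latticeChart_eq {S : Set (ι → ℝ)} (hS : S.Nonempty) (hrat : RationalDirection S)
    {t : ℕ} (ht : 1 ≤ t) {x : ι → ℤ} (hx : x ∈ affLattice S t) :
    ∃ θ, latticeChart S hS θ = (t : ℝ)⁻¹ • intVec x := by
  have h1 := inv_smul_mem_affineSpan (by positivity) hx
  have h2 := AffineSubspace.vsub_mem_direction h1 (mem_affineSpan ℝ hS.some_mem)
  rw [direction_affineSpan, ← range_latticeMap hrat] at h2
  obtain ⟨θ, hθ⟩ := h2
  refine ⟨θ, ?_⟩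
  rw [latticeChart, hθ, vsub_eq_sub, add_sub_cancel]

lemma latticeChart_add {S : Set (ι → ℝ)} (hS : S.Nonempty) (θ : LatticeIndex S → ℝ) (r : ℝ)
    (c : LatticeIndex S → ℤ) :
    latticeChart S hS (θ + r • intVec c) = latticeChart S hS θ + r • intVec (latticeVec S c) := by
  rw [latticeChart, latticeChart, map_add, map_smul, latticeMap_intVec, add_assoc]

/-- The lattice points of a dilate that are congruent to `x` modulo `N`, in coordinates. -/
lemma congruent_latticePoints_eq_image {S : Set (ι → ℝ)} (hS : S.Nonempty)
    {t N : ℕ} (ht : 1 ≤ t) (hN : 1 ≤ N) {x : ι → ℤ}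
    (hx : x ∈ affLattice S t) {θ : LatticeIndex S → ℝ}
    (hθ : latticeChart S hS θ = (t : ℝ)⁻¹ • intVec x) :
    {z ∈ latticePoints ((t : ℝ) • S) | ∀ i, (N : ℤ) ∣ z i - x i} =
      (fun c => x + (N : ℤ) • latticeVec S c) ''
        {c | latticeChart S hS (θ + ((N : ℝ) / t) • intVec c) ∈ S} := by
  have ht0 : (t : ℝ) ≠ 0 := by positivity
  have hN0 : (N : ℝ) ≠ 0 := by positivity
  have hval : ∀ c, latticeChart S hS (θ + ((N : ℝ) / t) • intVec c) =
      (t : ℝ)⁻¹ • intVec (x + (N : ℤ) • latticeVec S c) := by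
    intro c
    rw [latticeChart_add, hθ, intVec_add, intVec_smul, smul_add, smul_smul, div_eq_inv_mul,
      Int.cast_natCast]
  ext z
  constructor
  · rintro ⟨hz, hdvd⟩
    choose u hu using hdvd
    have hzx : z = x + (N : ℤ) • u := by
      ext i
      have := hu i
      simp only [Pi.add_apply, Pi.smul_apply, smul_eq_mul]
      linarith
    have hu' : intVec u ∈ vectorSpan ℝ S := by
      have h1 := inv_smul_mem_affineSpan ht0 (subset_affineSpan ℝ _ hz)
      have h2 := inv_smul_mem_affineSpan ht0 hx
      have h3 := AffineSubspace.vsub_mem_direction h1 h2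
      rw [direction_affineSpan, vsub_eq_sub, ← smul_sub, ← intVec_sub, hzx, add_sub_cancel_left,
        intVec_smul, smul_smul] at h3
      refine ((vectorSpan ℝ S).smul_mem_iff ?_).mp h3
      exact mul_ne_zero (inv_ne_zero ht0) (by exact_mod_cast hN0)
    obtain ⟨c, rfl⟩ := exists_latticeVec_eq hu'
    refine ⟨c, ?_, hzx.symm⟩
    rw [mem_ofPred_eq, hval, ← hzx]
    exact (Set.mem_smul_set_iff_inv_smul_mem₀ ht0 _ _).mp hz
  · rintro ⟨c, hc, rfl⟩
    refine ⟨?_, fun i => ⟨latticeVec S c i, by simp⟩⟩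
    rw [mem_ofPred_eq, hval] at hc
    exact (Set.mem_smul_set_iff_inv_smul_mem₀ ht0 _ _).mpr hc

/-- In the chart, one residue class modulo N is a grid of mesh N / t; extending g by zero off S
allows summation over the whole grid. -/
lemma finsum_congruent_latticePoints {S : Set (ι → ℝ)} (hS : S.Nonempty)
    {t N : ℕ} (ht : 1 ≤ t) (hN : 1 ≤ N) {x : ι → ℤ}
    (hx : x ∈ affLattice S t) {θ : LatticeIndex S → ℝ}
    (hθ : latticeChart S hS θ = (t : ℝ)⁻¹ • intVec x) (g : (ι → ℝ) → ℝ) :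
    ∑ᶠ z ∈ {z ∈ latticePoints ((t : ℝ) • S) | ∀ i, (N : ℤ) ∣ z i - x i},
        g ((t : ℝ)⁻¹ • intVec z) =
      ∑ᶠ c : LatticeIndex S → ℤ, (latticeChart S hS ⁻¹' S).indicator
        (fun u => g (latticeChart S hS u)) (θ + ((N : ℝ) / t) • intVec c) := by
  have hinj : Function.Injective (fun c => x + (N : ℤ) • latticeVec S c) := by
    intro c c' h
    have h1 := add_left_cancel h
    have hN0 : (N : ℤ) ≠ 0 := by positivity
    exact latticeVec_injective S (smul_right_injective _ hN0 h1)
  rw [congruent_latticePoints_eq_image hS ht hN hx hθ,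
    finsum_mem_image hinj.injOn, finsum_mem_def]
  refine finsum_congr fun c => ?_
  have hval : latticeChart S hS (θ + ((N : ℝ) / t) • intVec c) =
      (t : ℝ)⁻¹ • intVec (x + (N : ℤ) • latticeVec S c) := by
    rw [latticeChart_add, hθ, intVec_add, intVec_smul, smul_add, smul_smul, div_eq_inv_mul,
      Int.cast_natCast]
  by_cases hc : latticeChart S hS (θ + ((N : ℝ) / t) • intVec c) ∈ S
  · rw [indicator_of_mem (by exact hc), indicator_of_mem (by exact hc), hval]
  · rw [indicator_of_notMem (by exact hc), indicator_of_notMem (by exact hc)]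

lemma isCompact_preimage_latticeChart {S : Set (ι → ℝ)} (hS : S.Nonempty) (hcomp : IsCompact S) :
    IsCompact (latticeChart S hS ⁻¹' S) :=
  (isClosedEmbedding_latticeChart hS).isCompact_preimage hcomp

lemma convex_preimage_latticeChart {S : Set (ι → ℝ)} (hS : S.Nonempty) (hconv : Convex ℝ S) :
    Convex ℝ (latticeChart S hS ⁻¹' S) := by
  have h : latticeChart S hS ⁻¹' S = latticeMap S ⁻¹' ((fun y => hS.some + y) ⁻¹' S) := rfl
  rw [h]
  exact (hconv.translate_preimage_right _).linear_preimage (latticeMap S)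

/-- Extension by zero creates new discontinuities only on the boundary of a convex set, which is a
null set. -/
lemma ae_continuousAt_indicator_latticeChart {S : Set (ι → ℝ)} (hS : S.Nonempty)
    (hcomp : IsCompact S) (hconv : Convex ℝ S) {g : (ι → ℝ) → ℝ}
    (hg : ∀ᵐ x ∂(latticeMeasure S).restrict S, ContinuousWithinAt g S x) :
    ∀ᵐ u, ContinuousAt ((latticeChart S hS ⁻¹' S).indicator
      (fun u => g (latticeChart S hS u))) u := by
  have h1 : ∀ᵐ u, latticeChart S hS u ∈ S → ContinuousWithinAt g S (latticeChart S hS u) := by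
    rw [ae_restrict_iff' hcomp.measurableSet, latticeMeasure_eq hS,
      (measurableEmbedding_latticeChart hS).ae_map_iff] at hg
    exact hg
  have h2 : ∀ᵐ u, u ∉ frontier (latticeChart S hS ⁻¹' S) :=
    measure_eq_zero_iff_ae_notMem.mp
      ((convex_preimage_latticeChart hS hconv).addHaar_frontier volume)
  filter_upwards [h1, h2] with u hu hfr
  have hclosed := (isCompact_preimage_latticeChart hS hcomp).isClosed
  by_cases hmem : latticeChart S hS u ∈ S
  · have hnhds : latticeChart S hS ⁻¹' S ∈ 𝓝 u := by
      rw [← mem_interior_iff_mem_nhds]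
      by_contra hint
      exact hfr ⟨subset_closure hmem, hint⟩
    have hc : ContinuousAt (fun u => g (latticeChart S hS u)) u := by
      have := (hu hmem).comp (continuous_latticeChart hS).continuousWithinAt
        (fun v (hv : v ∈ latticeChart S hS ⁻¹' S) => hv)
      exact this.continuousAt hnhds
    refine hc.congr ?_
    filter_upwards [hnhds] with v hv
    rw [indicator_of_mem hv]
  · have hnhds : (latticeChart S hS ⁻¹' S)ᶜ ∈ 𝓝 u := hclosed.isOpen_compl.mem_nhds hmem
    refine (continuousAt_const (y := (0 : ℝ))).congr ?_
    filter_upwards [hnhds] with v hv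
    rw [indicator_of_notMem hv]

lemma setIntegral_latticeMeasure {S : Set (ι → ℝ)} (hS : S.Nonempty) (hcomp : IsCompact S)
    (g : (ι → ℝ) → ℝ) :
    ∫ x in S, g x ∂(latticeMeasure S) = ∫ u, (latticeChart S hS ⁻¹' S).indicator
      (fun u => g (latticeChart S hS u)) u := by
  rw [latticeMeasure_eq hS, (measurableEmbedding_latticeChart hS).setIntegral_map,
    integral_indicator (isCompact_preimage_latticeChart hS hcomp).measurableSet]

/-- Sums over congruent lattice points of dilates converge to the integral. -/
theorem tendsto_congruent_sum {S : Set (ι → ℝ)} (hS : S.Nonempty) (hcomp : IsCompact S)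
    (hconv : Convex ℝ S) (hrat : RationalDirection S) {g : (ι → ℝ) → ℝ} {B : ℝ}
    (hB : ∀ x ∈ S, |g x| ≤ B)
    (hg : ∀ᵐ x ∂(latticeMeasure S).restrict S, ContinuousWithinAt g S x)
    {N : ℕ} (hN : 1 ≤ N) {t : ℕ → ℕ} (ht : ∀ k, 1 ≤ t k) (ht' : Tendsto t atTop atTop)
    {x : ℕ → ι → ℤ} (hx : ∀ k, x k ∈ affLattice S (t k)) :
    Tendsto (fun k => ((N : ℝ) / t k) ^ affDim S *
      ∑ᶠ z ∈ {z ∈ latticePoints ((t k : ℝ) • S) | ∀ i, (N : ℤ) ∣ z i - x k i},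
        g ((t k : ℝ)⁻¹ • intVec z)) atTop (𝓝 (∫ x in S, g x ∂(latticeMeasure S))) := by
  choose θ hθ using fun k => exists_latticeChart_eq hS hrat (ht k) (hx k)
  have h1 : ∀ k, ∑ᶠ z ∈ {z ∈ latticePoints ((t k : ℝ) • S) | ∀ i, (N : ℤ) ∣ z i - x k i},
        g ((t k : ℝ)⁻¹ • intVec z) = _ := fun k =>
    finsum_congruent_latticePoints hS (ht k) hN (hx k) (hθ k) g
  simp only [h1, setIntegral_latticeMeasure hS hcomp, ← card_latticeIndex hrat]
  obtain ⟨R, hR⟩ := (isCompact_preimage_latticeChart hS hcomp).isBounded.exists_norm_le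
  have hB0 : 0 ≤ B := (abs_nonneg _).trans (hB _ hS.some_mem)
  refine tendsto_riemann_sum (B := B) (R := R) (fun u => ?_) (fun u hu => ?_)
    (ae_continuousAt_indicator_latticeChart hS hcomp hconv hg) (fun k => ?_) ?_ θ
  · by_cases hu : latticeChart S hS u ∈ S
    · rw [indicator_of_mem (by exact hu)]
      exact hB _ hu
    · rw [indicator_of_notMem (by exact hu), abs_zero]
      exact hB0
  · exact hR u (mem_of_indicator_ne_zero hu)
  · have := ht k
    positivity
  · exact tendsto_const_nhds.div_atTop (tendsto_natCast_atTop_atTop.comp ht')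

lemma normVol_eq_setIntegral {S : Set (ι → ℝ)} :
    normVol S = ∫ _ in S, (1 : ℝ) ∂(latticeMeasure S) := by
  rw [setIntegral_const, smul_eq_mul, mul_one, normVol, measureReal_def]

/-- The number of lattice points of a dilate grows like the normalized volume. -/
theorem tendsto_latticeCount {S : Set (ι → ℝ)} (hS : S.Nonempty) (hcomp : IsCompact S)
    (hconv : Convex ℝ S) (hrat : RationalDirection S) {t : ℕ → ℕ} (ht : ∀ k, 1 ≤ t k)
    (ht' : Tendsto t atTop atTop) (hx : ∀ k, (affLattice S (t k)).Nonempty) :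
    Tendsto (fun k => (latticeCount ((t k : ℝ) • S) : ℝ) / (t k : ℝ) ^ affDim S) atTop
      (𝓝 (normVol S)) := by
  have h := tendsto_congruent_sum hS hcomp hconv hrat (g := fun _ => 1) (B := 1) (by simp)
    (Eventually.of_forall fun x => continuousWithinAt_const) le_rfl ht ht'
    (x := fun k => (hx k).some) (fun k => (hx k).some_mem)
  rw [← normVol_eq_setIntegral] at h
  refine h.congr fun k => ?_
  have hset : {z ∈ latticePoints ((t k : ℝ) • S) | ∀ i, ((1 : ℕ) : ℤ) ∣ z i - (hx k).some i} =
      latticePoints ((t k : ℝ) • S) := by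
    ext z; simp
  rw [hset]
  have hcast : (∑ᶠ z ∈ latticePoints ((t k : ℝ) • S), (1 : ℝ)) =
      (latticeCount ((t k : ℝ) • S) : ℝ) := by
    rw [finsum_mem_eq_finite_toFinset_sum _
      (finite_latticePoints ((hcomp.smul (t k : ℝ)).isBounded))]
    rw [latticeCount, Set.ncard_eq_toFinset_card _
      (finite_latticePoints ((hcomp.smul (t k : ℝ)).isBounded))]
    simp
  rw [hcast, Nat.cast_one, one_div, inv_pow, inv_mul_eq_div]

lemma isCompact_stdPolytope {A : Matrix σ ι ℤ} {b : σ → ℤ}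
    (hb : Bornology.IsBounded (stdPolytope A b)) : IsCompact (stdPolytope A b) :=
  Metric.isCompact_of_isClosed_isBounded (isClosed_stdPolytope A b) hb

lemma rationalDirection_of_eq_facialKernel {A : Matrix σ ι ℤ} {x : ι → ℝ} {S : Set (ι → ℝ)}
    (h : vectorSpan ℝ S = facialKernel A x) : RationalDirection S := by
  rw [RationalDirection, h]
  exact facialKernel_le_span A x

lemma rationalDirection_stdPolytope {A : Matrix σ ι ℤ} {b : σ → ℤ}
    (hne : (stdPolytope A b).Nonempty) : RationalDirection (stdPolytope A b) := by
  obtain ⟨x, hx, hmax⟩ := exists_maximal_support (convex_stdPolytope A b) hne fun x hx => hx.2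
  exact rationalDirection_of_eq_facialKernel
    (vectorSpan_eq_facialKernel (fun _ => Iff.rfl) hx hmax)

/-- A point of maximal support is relatively interior: nearby points of the hull keep its zero
coordinates at zero and its other coordinates positive. -/
lemma normVol_stdPolytope_pos {A : Matrix σ ι ℤ} {b : σ → ℤ}
    (hb : Bornology.IsBounded (stdPolytope A b)) (hne : (stdPolytope A b).Nonempty) :
    0 < normVol (stdPolytope A b) := by
  obtain ⟨x, hx, hmax⟩ := exists_maximal_support (convex_stdPolytope A b) hne fun x hx => hx.2
  have hV : vectorSpan ℝ (stdPolytope A b) = facialKernel A x :=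
    vectorSpan_eq_facialKernel (fun _ => Iff.rfl) hx hmax
  have hrat := rationalDirection_stdPolytope hne
  have hcomp := isCompact_preimage_latticeChart hne (isCompact_stdPolytope hb)
  rw [normVol, latticeMeasure_eq hne, (measurableEmbedding_latticeChart hne).map_apply]
  refine ENNReal.toReal_pos ?_ hcomp.measure_lt_top.ne
  have h2 := vsub_mem_vectorSpan ℝ hx hne.some_mem
  rw [← range_latticeMap hrat] at h2
  obtain ⟨c₀, hc₀⟩ := h2
  have hc₀' : latticeChart _ hne c₀ = x := by
    rw [latticeChart, hc₀, vsub_eq_sub, add_sub_cancel]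
  refine (Measure.measure_pos_of_mem_nhds volume (x := c₀) ?_).ne'
  have hdir : ∀ c, latticeChart _ hne c - x ∈ facialKernel A x := by
    intro c
    rw [← hV, ← range_latticeMap hrat]
    have : latticeChart _ hne c - x = latticeMap (stdPolytope A b) (c - c₀) := by
      rw [← hc₀', latticeChart, latticeChart, add_sub_add_left_eq_sub, ← map_sub]
    rw [this]
    exact LinearMap.mem_range_self _ _
  have hev : ∀ i, ∀ᶠ c in 𝓝 c₀, 0 ≤ latticeChart _ hne c i := by
    intro i
    by_cases hi : x i = 0
    · refine Eventually.of_forall fun c => ?_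
      have := (hdir c).2 i hi
      rw [Pi.sub_apply, hi, sub_zero] at this
      exact this.ge
    · have hpos : 0 < latticeChart _ hne c₀ i := by
        rw [hc₀']
        exact lt_of_le_of_ne (hx.2 i) (Ne.symm hi)
      have hcont : ContinuousAt (fun c => latticeChart _ hne c i) c₀ :=
        ((continuous_apply i).comp (continuous_latticeChart hne)).continuousAt
      exact (hcont.eventually (lt_mem_nhds hpos)).mono fun c hc => hc.le
  filter_upwards [eventually_all.mpr hev] with c hc
  refine ⟨?_, hc⟩
  have h3 := (hdir c).1
  rw [map_sub, sub_eq_zero] at h3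
  exact h3.trans hx.1

end LatticeSums

end

end WeightLifting

namespace WeightLifting

noncomputable section

/-! ### Quasi-polynomial sequences as solutions of recurrences. -/

section QuasiPolynomials

open Polynomial in
/-- Polynomials act on sequences, where the variable acts by the shift. -/
def shiftEval (Q : ℝ[X]) : Module.End ℝ (ℕ → ℝ) :=
  aeval (LinearMap.funLeft ℝ ℝ (fun t : ℕ => t + 1)) Q

lemma shiftEval_mul (P Q : Polynomial ℝ) (f : ℕ → ℝ) :
    shiftEval (P * Q) f = shiftEval P (shiftEval Q f) := by
  simp [shiftEval]

lemma shiftEval_X_pow (s : ℕ) (f : ℕ → ℝ) (t : ℕ) :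
    shiftEval (Polynomial.X ^ s) f t = f (t + s) := by
  induction s generalizing t with
  | zero => simp [shiftEval]
  | succ s ih =>
    rw [pow_succ', shiftEval_mul]
    have : shiftEval (Polynomial.X) (shiftEval (Polynomial.X ^ s) f) t =
        shiftEval (Polynomial.X ^ s) f (t + 1) := by
      rw [shiftEval, Polynomial.aeval_X, LinearMap.funLeft_apply]
    rw [this, ih]
    congr 1
    ring

lemma shiftEval_X_pow_sub_one (s : ℕ) (f : ℕ → ℝ) (t : ℕ) :
    shiftEval (Polynomial.X ^ s - 1) f t = f (t + s) - f t := by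
  have : shiftEval (Polynomial.X ^ s - 1) f = shiftEval (Polynomial.X ^ s) f - f := by
    simp [shiftEval]
  rw [this, Pi.sub_apply, shiftEval_X_pow]

lemma shiftEval_eq_zero_of_dvd {P Q : Polynomial ℝ} (h : P ∣ Q) {f : ℕ → ℝ}
    (hf : shiftEval P f = 0) : shiftEval Q f = 0 := by
  obtain ⟨R, rfl⟩ := h
  rw [mul_comm, shiftEval_mul, hf, map_zero]

/-- Quasi-polynomial sequences, as solutions of a recurrence. -/
def IsQuasi (f : ℕ → ℝ) : Prop :=
  ∃ p d : ℕ, 0 < p ∧ shiftEval ((Polynomial.X ^ p - 1) ^ d) f = 0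

lemma X_pow_sub_one_dvd_of_dvd {p q : ℕ} (h : p ∣ q) :
    (Polynomial.X ^ p - 1 : Polynomial ℝ) ∣ Polynomial.X ^ q - 1 := by
  obtain ⟨k, rfl⟩ := h
  exact pow_one_sub_dvd_pow_mul_sub_one _ _ _

lemma IsQuasi.zero : IsQuasi 0 := ⟨1, 0, one_pos, by simp⟩

lemma IsQuasi.add {f g : ℕ → ℝ} (hf : IsQuasi f) (hg : IsQuasi g) : IsQuasi (f + g) := by
  obtain ⟨p, d, hp, hf⟩ := hf
  obtain ⟨q, e, hq, hg⟩ := hg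
  refine ⟨p * q, max d e, Nat.mul_pos hp hq, ?_⟩
  rw [map_add, shiftEval_eq_zero_of_dvd _ hf, shiftEval_eq_zero_of_dvd _ hg, add_zero]
  · exact (pow_dvd_pow_of_dvd (X_pow_sub_one_dvd_of_dvd (dvd_mul_left q p)) e).trans
      (pow_dvd_pow _ (le_max_right d e))
  · exact (pow_dvd_pow_of_dvd (X_pow_sub_one_dvd_of_dvd (dvd_mul_right p q)) d).trans
      (pow_dvd_pow _ (le_max_left d e))

/-- Summation of a quasi-polynomial sequence. -/
lemma IsQuasi.of_step {f F : ℕ → ℝ} (hf : IsQuasi f) {h s : ℕ} (hh : 0 < h)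
    (hF : ∀ t, F (t + h) = F t + f (t + s)) : IsQuasi F := by
  obtain ⟨p, d, hp, hf⟩ := hf
  -- Both X^p - 1 and X^h - 1 divide X^(ph) - 1; the summation costs one more factor.
  refine ⟨p * h, d + 1, Nat.mul_pos hp hh, ?_⟩
  have h1 : shiftEval (Polynomial.X ^ h - 1) F = shiftEval (Polynomial.X ^ s) f := by
    ext t
    rw [shiftEval_X_pow_sub_one, shiftEval_X_pow, hF, add_sub_cancel_left]
  have h2 : shiftEval ((Polynomial.X ^ p - 1) ^ d * (Polynomial.X ^ h - 1)) F = 0 := by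
    rw [shiftEval_mul, h1, ← shiftEval_mul, mul_comm, shiftEval_mul, hf, map_zero]
  refine shiftEval_eq_zero_of_dvd ?_ h2
  rw [pow_succ]
  exact mul_dvd_mul (pow_dvd_pow_of_dvd (X_pow_sub_one_dvd_of_dvd (dvd_mul_right p h)) d)
    (X_pow_sub_one_dvd_of_dvd (dvd_mul_left h p))

/-- Along a progression of step p, the operator X^p - 1 is the forward difference, so Newton's
interpolation applies. -/
lemma shiftEval_pow_apply_residue (p r d : ℕ) (f : ℕ → ℝ) (m : ℕ) :
    shiftEval ((Polynomial.X ^ p - 1) ^ d) f (r + p * m) =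
      (fwdDiff 1)^[d] (fun m => f (r + p * m)) m := by
  induction d generalizing f with
  | zero => simp [shiftEval]
  | succ d ih =>
    rw [pow_succ, shiftEval_mul, ih, Function.iterate_succ_apply]
    have : (fun m => shiftEval (Polynomial.X ^ p - 1) f (r + p * m)) =
        fwdDiff 1 (fun m => f (r + p * m)) := by
      ext m
      rw [shiftEval_X_pow_sub_one, fwdDiff, mul_add, mul_one, add_assoc]
    rw [this]

/-- A quasi-polynomial sequence is polynomial on residue classes. -/
lemma IsQuasi.exists_polynomial {f : ℕ → ℝ} (hf : IsQuasi f) :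
    ∃ p : ℕ, 0 < p ∧ ∀ r, ∃ Q : Polynomial ℝ, ∀ m : ℕ,
      f (r + p * m) = Q.eval ((r + p * m : ℕ) : ℝ) := by
  obtain ⟨p, d, hp, hf⟩ := hf
  refine ⟨p, hp, fun r => ?_⟩
  set G : ℕ → ℝ := fun m => f (r + p * m) with hG
  have h0 : ∀ k, d ≤ k → (fwdDiff 1)^[k] G = 0 := by
    intro k hk
    ext m
    rw [hG, ← shiftEval_pow_apply_residue,
      shiftEval_eq_zero_of_dvd (pow_dvd_pow _ hk) hf]
    rfl
  -- The coefficients of Newton's series, which stops at order d since all higher differences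
  -- vanish.
  set c : ℕ → ℝ := fun k => (fwdDiff 1)^[k] G 0 with hc
  have h1 : ∀ m : ℕ, G m = ∑ k ∈ Finset.range d, (m.choose k : ℝ) * c k := by
    intro m
    have h2 := shift_eq_sum_fwdDiff_iter (1 : ℕ) G m 0
    rw [smul_eq_mul, mul_one, zero_add] at h2
    rw [h2]
    simp only [nsmul_eq_mul]
    rw [Finset.sum_subset (Finset.range_mono (le_max_left (m + 1) d)),
      Finset.sum_subset (Finset.range_mono (le_max_right (m + 1) d))]
    · intro k _ hk
      rw [Finset.mem_range, not_lt] at hk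
      rw [hc]
      simp [h0 k hk]
    · intro k _ hk
      rw [Finset.mem_range, not_lt] at hk
      rw [Nat.choose_eq_zero_of_lt (by omega)]
      simp
  set q : Polynomial ℝ :=
    ∑ k ∈ Finset.range d, Polynomial.C (c k / k.factorial) * descPochhammer ℝ k with hq
  have h3 : ∀ m : ℕ, G m = q.eval (m : ℝ) := by
    intro m
    rw [h1, hq, Polynomial.eval_finsetSum]
    refine Finset.sum_congr rfl fun k _ => ?_
    rw [Polynomial.eval_mul, Polynomial.eval_C, descPochhammer_eval_eq_descFactorial,
      Nat.descFactorial_eq_factorial_mul_choose]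
    have : (k.factorial : ℝ) ≠ 0 := by positivity
    push_cast
    field_simp
  -- The substitution m = (t - r) / p makes it a polynomial in the argument of f itself.
  refine ⟨q.comp (Polynomial.C (p : ℝ)⁻¹ * (Polynomial.X - Polynomial.C (r : ℝ))), fun m => ?_⟩
  have hp0 : (p : ℝ) ≠ 0 := by positivity
  change G m = _
  rw [h3, Polynomial.eval_comp]
  congr 1
  simp
  field_simp

end QuasiPolynomials

/-! ### Half-open cones and the elimination of equations. -/

section HalfOpenCones

set_option linter.unusedSectionVars false

variable {ι : Type*} [Fintype ι] [DecidableEq ι]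

/-- Add the `X`-coordinate of a vector to its `Y`-coordinate. -/
def transfer {R : Type*} [AddCommMonoid R] (X Y : ι) (a : ι → R) : ι → R :=
  a + Pi.single Y (a X)

/-- Substituting x X + x Y for x X in a linear form adds its X-coefficient to its Y-coefficient:
transfers of forms and of points are adjoint. -/
lemma transfer_dotProduct {R : Type*} [CommRing R] (X Y : ι) (a x : ι → R) :
    transfer X Y a ⬝ᵥ x = a ⬝ᵥ transfer Y X x := by
  rw [transfer, transfer, add_dotProduct, dotProduct_add, single_dotProduct, dotProduct_single]

lemma transfer_apply_of_ne {R : Type*} [AddCommMonoid R] {X Y j : ι} (h : j ≠ Y) (a : ι → R) :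
    transfer X Y a j = a j := by
  simp [transfer, h]

lemma transfer_apply_self {R : Type*} [AddCommMonoid R] (X Y : ι) (a : ι → R) :
    transfer X Y a Y = a Y + a X := by
  simp [transfer]

lemma transfer_sub_single {R : Type*} [AddCommGroup R] {X Y : ι} (h : X ≠ Y) (a : ι → R) :
    transfer Y X (a - Pi.single X (a Y)) = a := by
  rw [transfer, Pi.sub_apply, Pi.single_eq_of_ne h.symm, sub_zero, sub_add_cancel]

lemma sub_single_transfer {R : Type*} [AddCommGroup R] {X Y : ι} (h : X ≠ Y) (a : ι → R) :
    transfer Y X a - Pi.single X (transfer Y X a Y) = a := by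
  rw [transfer_apply_of_ne h.symm, transfer, add_sub_cancel_right]

lemma intVec_transfer (X Y : ι) (a : ι → ℤ) : intVec (transfer X Y a) = transfer X Y (intVec a) := by
  ext j
  by_cases h : j = Y
  · subst h
    simp [transfer_apply_self]
  · simp [transfer_apply_of_ne h]

/-- The integer points of height `t` of a cone, defined by equations in the coordinates in `F`,
with some of its facets removed: those where `e` is one. -/
def coneSlice (F : Finset ι) (e : ι → ℤ) (eqs : List (ι → ℤ)) (h : ι → ℤ) (t : ℕ) :
    Set (ι → ℤ) :=
  {x | (∀ j ∈ F, e j ≤ x j) ∧ (∀ j, j ∉ F → x j = 0) ∧ (∀ a ∈ eqs, a ⬝ᵥ x = 0) ∧ h ⬝ᵥ x = t}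

/-- The slices are finite and their numbers form a quasi-polynomial sequence. -/
def QuasiSlices (F : Finset ι) (e : ι → ℤ) (eqs : List (ι → ℤ)) (h : ι → ℤ) : Prop :=
  (∀ t, (coneSlice F e eqs h t).Finite) ∧
    IsQuasi (fun t => ((coneSlice F e eqs h t).ncard : ℝ))

/-- The removed facets are those that are not visible from a point `w` of positive height. -/
structure HalfOpen (F : Finset ι) (e : ι → ℤ) (eqs : List (ι → ℤ)) (h : ι → ℤ) (w : ι → ℝ) :
    Prop where
  flag : ∀ j ∈ F, (e j = 0 ∧ 0 ≤ w j) ∨ (e j = 1 ∧ w j ≤ 0)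
  off : ∀ j, j ∉ F → w j = 0
  eqs_zero : ∀ a ∈ eqs, intVec a ⬝ᵥ w = 0
  height : 0 < intVec h ⬝ᵥ w
  pointed : ∀ x : ι → ℤ, (∀ j, 0 ≤ x j) → (∀ j, j ∉ F → x j = 0) → (∀ a ∈ eqs, a ⬝ᵥ x = 0) →
    x ≠ 0 → 0 < h ⬝ᵥ x

variable {F : Finset ι} {e h : ι → ℤ} {eqs : List (ι → ℤ)} {w : ι → ℝ}

lemma HalfOpen.flag_nonneg (H : HalfOpen F e eqs h w) {j : ι} (hj : j ∈ F) : 0 ≤ e j := by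
  rcases H.flag j hj with h | h <;> omega

/-- The half x Y + δ ≤ x X is described by the coordinate x X - x Y in place of x X, and w is
rewritten accordingly. `hδ` is the sign condition on w at the new wall. Equations and height keep
their values on w, because the change of forms is adjoint to that of points. -/
lemma HalfOpen.transfer (H : HalfOpen F e eqs h w) {X Y : ι} (hX : X ∈ F)
    (hXY : X ≠ Y) {δ : ℤ} (hδ : (δ = 0 ∧ w Y ≤ w X) ∨ (δ = 1 ∧ w X ≤ w Y)) :
    HalfOpen F (Function.update e X δ) (eqs.map (transfer X Y)) (transfer X Y h)
      (w - Pi.single X (w Y)) where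
  flag j hj := by
    by_cases hjX : j = X
    · subst hjX
      simp only [Function.update_self, Pi.sub_apply, Pi.single_eq_same, sub_nonneg, sub_nonpos]
      exact hδ
    · simp only [Function.update_of_ne hjX, Pi.sub_apply, Pi.single_eq_of_ne hjX, sub_zero]
      exact H.flag j hj
  off j hj := by
    have hjX : j ≠ X := fun h => hj (h ▸ hX)
    simp [hjX, H.off j hj]
  eqs_zero a ha := by
    obtain ⟨a, ha', rfl⟩ := List.mem_map.mp ha
    rw [intVec_transfer, transfer_dotProduct, transfer_sub_single hXY]
    exact H.eqs_zero a ha'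
  height := by
    rw [intVec_transfer, transfer_dotProduct, transfer_sub_single hXY]
    exact H.height
  pointed x hx hx0 hxe hne := by
    rw [transfer_dotProduct]
    refine H.pointed _ (fun j => ?_) (fun j hj => ?_) (fun a ha => ?_) (fun h0 => hne ?_)
    · by_cases hjX : j = X
      · subst hjX
        rw [transfer_apply_self]
        exact add_nonneg (hx _) (hx _)
      · rw [transfer_apply_of_ne hjX]
        exact hx j
    · have hjX : j ≠ X := fun h => hj (h ▸ hX)
      rw [transfer_apply_of_ne hjX]
      exact hx0 j hj
    · rw [← transfer_dotProduct]
      exact hxe _ (List.mem_map_of_mem ha)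
    · rw [← sub_single_transfer hXY x, h0]
      simp

/-- The condition `hδ` makes the old bound e X ≤ x X follow from e Y ≤ x Y and x Y + δ ≤ x X, so
that it may be replaced by the new one. -/
lemma transfer_image_coneSlice {X Y : ι} (hX : X ∈ F) (hY : Y ∈ F) (hXY : X ≠ Y) {δ : ℤ}
    (hδ : e X ≤ e Y + δ) (t : ℕ) :
    transfer Y X '' coneSlice F (Function.update e X δ) (eqs.map (transfer X Y)) (transfer X Y h) t
      = coneSlice F e eqs h t ∩ {x | x Y + δ ≤ x X} := by
  ext x
  constructor
  · rintro ⟨x, ⟨h1, h2, h3, h4⟩, rfl⟩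
    have hX1 := h1 X hX
    have hY1 := h1 Y hY
    rw [Function.update_self] at hX1
    rw [Function.update_of_ne hXY.symm] at hY1
    refine ⟨⟨fun j hj => ?_, fun j hj => ?_, fun a ha => ?_, ?_⟩, ?_⟩
    · by_cases hjX : j = X
      · subst hjX
        rw [transfer_apply_self]
        linarith
      · rw [transfer_apply_of_ne hjX]
        have := h1 j hj
        rwa [Function.update_of_ne hjX] at this
    · have hjX : j ≠ X := fun h => hj (h ▸ hX)
      rw [transfer_apply_of_ne hjX]
      exact h2 j hj
    · rw [← transfer_dotProduct]
      exact h3 _ (List.mem_map_of_mem ha)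
    · rw [← transfer_dotProduct]
      exact h4
    · rw [mem_ofPred_eq, transfer_apply_of_ne hXY.symm, transfer_apply_self]
      linarith
  · rintro ⟨⟨h1, h2, h3, h4⟩, h5⟩
    rw [mem_ofPred_eq] at h5
    refine ⟨x - Pi.single X (x Y), ⟨fun j hj => ?_, fun j hj => ?_, fun a ha => ?_, ?_⟩,
      transfer_sub_single hXY x⟩
    · by_cases hjX : j = X
      · subst hjX
        simp only [Function.update_self, Pi.sub_apply, Pi.single_eq_same]
        linarith
      · simp only [Function.update_of_ne hjX, Pi.sub_apply, Pi.single_eq_of_ne hjX, sub_zero]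
        exact h1 j hj
    · have hjX : j ≠ X := fun h => hj (h ▸ hX)
      simp [hjX, h2 j hj]
    · obtain ⟨a, ha', rfl⟩ := List.mem_map.mp ha
      rw [transfer_dotProduct, transfer_sub_single hXY]
      exact h3 a ha'
    · rw [transfer_dotProduct, transfer_sub_single hXY]
      exact h4

/-- Splitting a half-open cone along `x X = x Y` into two half-open cones. -/
lemma HalfOpen.quasiSlices_of_split (H : HalfOpen F e eqs h w) {X Y : ι} (hX : X ∈ F) (hY : Y ∈ F)
    (hXY : X ≠ Y)
    (h1 : ∀ δ w', HalfOpen F (Function.update e X δ) (eqs.map (WeightLifting.transfer X Y))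
      (WeightLifting.transfer X Y h) w' →
      QuasiSlices F (Function.update e X δ) (eqs.map (WeightLifting.transfer X Y))
        (WeightLifting.transfer X Y h))
    (h2 : ∀ δ w', HalfOpen F (Function.update e Y δ) (eqs.map (WeightLifting.transfer Y X))
      (WeightLifting.transfer Y X h) w' →
      QuasiSlices F (Function.update e Y δ) (eqs.map (WeightLifting.transfer Y X))
        (WeightLifting.transfer Y X h)) :
    QuasiSlices F e eqs h := by
  -- With δ + δ' = 1 the wall x X = x Y belongs to exactly one half, the one that the signs of w
  -- prescribe. The last two inequalities keep the old bounds redundant; with unequal flags they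
  -- hold because w X and w Y have opposite (weak) signs.
  obtain ⟨δ, δ', hsum, hδ, hδ', hc, hc'⟩ : ∃ δ δ' : ℤ, δ + δ' = 1 ∧
      ((δ = 0 ∧ w Y ≤ w X) ∨ (δ = 1 ∧ w X ≤ w Y)) ∧
      ((δ' = 0 ∧ w X ≤ w Y) ∨ (δ' = 1 ∧ w Y ≤ w X)) ∧ e X ≤ e Y + δ ∧ e Y ≤ e X + δ' := by
    rcases H.flag X hX with ⟨ha, hb⟩ | ⟨ha, hb⟩ <;> rcases H.flag Y hY with ⟨hc, hd⟩ | ⟨hc, hd⟩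
    · rcases le_total (w X) (w Y) with hw | hw
      · exact ⟨1, 0, by norm_num, .inr ⟨rfl, hw⟩, .inl ⟨rfl, hw⟩, by omega, by omega⟩
      · exact ⟨0, 1, by norm_num, .inl ⟨rfl, hw⟩, .inr ⟨rfl, hw⟩, by omega, by omega⟩
    · exact ⟨0, 1, by norm_num, .inl ⟨rfl, by linarith⟩, .inr ⟨rfl, by linarith⟩, by omega,
        by omega⟩
    · exact ⟨1, 0, by norm_num, .inr ⟨rfl, by linarith⟩, .inl ⟨rfl, by linarith⟩, by omega,
        by omega⟩
    · rcases le_total (w X) (w Y) with hw | hw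
      · exact ⟨1, 0, by norm_num, .inr ⟨rfl, hw⟩, .inl ⟨rfl, hw⟩, by omega, by omega⟩
      · exact ⟨0, 1, by norm_num, .inl ⟨rfl, hw⟩, .inr ⟨rfl, hw⟩, by omega, by omega⟩
  obtain ⟨hf1, hq1⟩ := h1 _ _ (H.transfer hX hXY hδ)
  obtain ⟨hf2, hq2⟩ := h2 _ _ (H.transfer hY hXY.symm hδ')
  have hinj : ∀ {X Y : ι}, X ≠ Y →
      Function.Injective (WeightLifting.transfer Y X : (ι → ℤ) → ι → ℤ) := by
    intro X Y hXY a b hab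
    rw [← sub_single_transfer hXY a, hab, sub_single_transfer hXY]
  have hunion : ∀ t, coneSlice F e eqs h t =
      (coneSlice F e eqs h t ∩ {x | x Y + δ ≤ x X}) ∪
        (coneSlice F e eqs h t ∩ {x | x X + δ' ≤ x Y}) := by
    intro t
    rw [← inter_union_distrib_left, eq_comm, inter_eq_left]
    intro x _
    rcases le_or_gt (x Y + δ) (x X) with h | h
    · exact Or.inl h
    · exact Or.inr (show x X + δ' ≤ x Y by omega)
  have hdisj : ∀ t, Disjoint (coneSlice F e eqs h t ∩ {x | x Y + δ ≤ x X})
      (coneSlice F e eqs h t ∩ {x | x X + δ' ≤ x Y}) := by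
    intro t
    rw [Set.disjoint_left]
    rintro x ⟨_, ha⟩ ⟨_, hb⟩
    rw [mem_ofPred_eq] at ha hb
    omega
  have hA := fun t => transfer_image_coneSlice (eqs := eqs) (h := h) hX hY hXY hc t
  have hB := fun t => transfer_image_coneSlice (eqs := eqs) (h := h) hY hX hXY.symm hc' t
  have hfA : ∀ t, (coneSlice F e eqs h t ∩ {x | x Y + δ ≤ x X}).Finite := fun t => by
    rw [← hA]
    exact (hf1 t).image _
  have hfB : ∀ t, (coneSlice F e eqs h t ∩ {x | x X + δ' ≤ x Y}).Finite := fun t => by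
    rw [← hB]
    exact (hf2 t).image _
  refine ⟨fun t => ?_, ?_⟩
  · rw [hunion]
    exact (hfA t).union (hfB t)
  · convert hq1.add hq2 using 1
    ext t
    rw [hunion, Set.ncard_union_eq (hdisj t) (hfA t) (hfB t), ← hA, ← hB,
      Set.ncard_image_of_injective _ (hinj hXY), Set.ncard_image_of_injective _ (hinj hXY.symm)]
    simp

lemma coneSlice_neg (F : Finset ι) (e : ι → ℤ) (α : ι → ℤ) (eqs : List (ι → ℤ)) (h : ι → ℤ) :
    coneSlice F e (-α :: eqs) h = coneSlice F e (α :: eqs) h := by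
  ext t x
  simp [coneSlice, neg_dotProduct]

lemma HalfOpen.neg {α : ι → ℤ} (H : HalfOpen F e (α :: eqs) h w) :
    HalfOpen F e (-α :: eqs) h w where
  flag := H.flag
  off := H.off
  height := H.height
  eqs_zero a ha := by
    rcases List.mem_cons.mp ha with rfl | ha
    · have : intVec (-α) = - intVec α := by ext; simp
      rw [this, neg_dotProduct, H.eqs_zero α (by simp), neg_zero]
    · exact H.eqs_zero a (by simp [ha])
  pointed x hx hx0 hxe hne := H.pointed x hx hx0 (fun a ha => by
    rcases List.mem_cons.mp ha with rfl | ha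
    · have := hxe (-a) (by simp)
      rwa [neg_dotProduct, neg_eq_zero] at this
    · exact hxe a (by simp [ha])) hne

/-- An equation with nonnegative coefficients forces variables to vanish. -/
lemma HalfOpen.quasiSlices_of_nonneg {α : ι → ℤ} (H : HalfOpen F e (α :: eqs) h w)
    (hα : ∀ j ∈ F, 0 ≤ α j)
    (ih : ∀ F, HalfOpen F e eqs h w → QuasiSlices F e eqs h) :
    QuasiSlices F e (α :: eqs) h := by
  have hterm : ∀ x : ι → ℤ, (∀ j ∈ F, 0 ≤ x j) → (∀ j, j ∉ F → x j = 0) → ∀ j, 0 ≤ α j * x j := by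
    intro x h1 h2 j
    by_cases hj : j ∈ F
    · exact mul_nonneg (hα j hj) (h1 j hj)
    · rw [h2 j hj, mul_zero]
  have hzero : ∀ t, ∀ x ∈ coneSlice F e (α :: eqs) h t, ∀ j, α j * x j = 0 := by
    rintro t x ⟨h1, h2, h3, h4⟩ j
    have hs : ∑ j, α j * x j = 0 := h3 α (by simp)
    exact (Finset.sum_eq_zero_iff_of_nonneg (fun j _ => hterm x
      (fun j hj => (H.flag_nonneg hj).trans (h1 j hj)) h2 j)).mp hs j (Finset.mem_univ j)
  -- The equation forces x j = 0 wherever α j ≠ 0; if such a facet has been removed, nothing is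
  -- left.
  by_cases hE : ∃ j ∈ F, α j ≠ 0 ∧ e j = 1
  · obtain ⟨j, hj, hαj, hej⟩ := hE
    have hempty : ∀ t, coneSlice F e (α :: eqs) h t = ∅ := by
      intro t
      rw [Set.eq_empty_iff_forall_notMem]
      intro x hx
      have h1 := hzero t x hx j
      have h2 := hx.1 j hj
      rw [mul_eq_zero] at h1
      rcases h1 with h1 | h1
      · exact hαj h1
      · omega
    refine ⟨fun t => by rw [hempty]; exact Set.finite_empty, ?_⟩
    simp only [hempty, Set.ncard_empty, Nat.cast_zero]
    exact IsQuasi.zero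
  · push Not at hE
    have he0 : ∀ j ∈ F, α j ≠ 0 → e j = 0 ∧ 0 ≤ w j := fun j hj hαj =>
      (H.flag j hj).resolve_right fun h => hE j hj hαj h.1
    -- Now w is nonnegative wherever α j ≠ 0, so the equation makes w vanish there too: w lies in
    -- the span of the remaining face and serves for it again.
    have hw0 : ∀ j ∈ F, α j ≠ 0 → w j = 0 := by
      intro j hj hαj
      have hs : ∑ j, (α j : ℝ) * w j = 0 := H.eqs_zero α (by simp)
      have hnn : ∀ j ∈ Finset.univ, 0 ≤ (α j : ℝ) * w j := by
        intro j _
        by_cases hj : j ∈ F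
        · by_cases h0 : α j = 0
          · simp [h0]
          · exact mul_nonneg (by exact_mod_cast hα j hj) (he0 j hj h0).2
        · rw [H.off j hj, mul_zero]
      have := (Finset.sum_eq_zero_iff_of_nonneg hnn).mp hs j (Finset.mem_univ j)
      rw [mul_eq_zero] at this
      exact this.resolve_left (by exact_mod_cast hαj)
    have hslice : coneSlice F e (α :: eqs) h = coneSlice (F.filter fun j => α j = 0) e eqs h := by
      ext t x
      constructor
      · intro hx
        obtain ⟨h1, h2, h3, h4⟩ := hx
        refine ⟨fun j hj => h1 j (Finset.mem_filter.mp hj).1, fun j hj => ?_,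
          fun a ha => h3 a (by simp [ha]), h4⟩
        by_cases hjF : j ∈ F
        · have hαj : α j ≠ 0 := fun h0 => hj (Finset.mem_filter.mpr ⟨hjF, h0⟩)
          exact (mul_eq_zero.mp (hzero t x ⟨h1, h2, h3, h4⟩ j)).resolve_left hαj
        · exact h2 j hjF
      · rintro ⟨h1, h2, h3, h4⟩
        have h2' : ∀ j, j ∉ F → x j = 0 := fun j hj => h2 j fun h => hj (Finset.mem_filter.mp h).1
        refine ⟨fun j hj => ?_, h2', fun a ha => ?_, h4⟩
        · by_cases h0 : α j = 0
          · exact h1 j (Finset.mem_filter.mpr ⟨hj, h0⟩)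
          · rw [(he0 j hj h0).1, h2 j fun h => h0 (Finset.mem_filter.mp h).2]
        · rcases List.mem_cons.mp ha with rfl | ha
          · refine Finset.sum_eq_zero fun j _ => ?_
            by_cases h0 : a j = 0
            · rw [h0, zero_mul]
            · rw [h2 j fun h => h0 (Finset.mem_filter.mp h).2, mul_zero]
          · exact h3 a ha
    rw [QuasiSlices, hslice]
    refine ih _ ⟨fun j hj => H.flag j (Finset.mem_filter.mp hj).1, fun j hj => ?_,
      fun a ha => H.eqs_zero a (by simp [ha]), H.height, fun x hx hx0 hxe hne => ?_⟩
    · by_cases hjF : j ∈ F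
      · exact hw0 j hjF fun h0 => hj (Finset.mem_filter.mpr ⟨hjF, h0⟩)
      · exact H.off j hjF
    · refine H.pointed x hx (fun j hj => hx0 j fun h => hj (Finset.mem_filter.mp h).1)
        (fun a ha => ?_) hne
      rcases List.mem_cons.mp ha with rfl | ha
      · refine Finset.sum_eq_zero fun j _ => ?_
        by_cases h0 : a j = 0
        · rw [h0, zero_mul]
        · rw [hx0 j fun h => h0 (Finset.mem_filter.mp h).2, mul_zero]
      · exact hxe a ha

/-- Elimination of one equation, by splitting cones along pairs of variables whose coefficients
have opposite signs. -/
lemma HalfOpen.quasiSlices_cons {n : ℕ}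
    (ih : ∀ (F : Finset ι) (e : ι → ℤ) (eqs : List (ι → ℤ)) (h : ι → ℤ) (w : ι → ℝ),
      eqs.length = n → HalfOpen F e eqs h w → QuasiSlices F e eqs h)
    (F : Finset ι) (B : ℕ) :
    ∀ (α e : ι → ℤ) (eqs : List (ι → ℤ)) (h : ι → ℤ) (w : ι → ℝ), eqs.length = n →
      (∀ j ∈ F, |α j| ≤ B) → HalfOpen F e (α :: eqs) h w → QuasiSlices F e (α :: eqs) h := by
  have hterminal : ∀ (α e : ι → ℤ) (eqs : List (ι → ℤ)) (h : ι → ℤ) (w : ι → ℝ), eqs.length = n →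
      (∀ j ∈ F, 0 ≤ α j) → HalfOpen F e (α :: eqs) h w → QuasiSlices F e (α :: eqs) h :=
    fun α e eqs h w hlen hα H => H.quasiSlices_of_nonneg hα fun F H' => ih F e eqs h w hlen H'
  induction B with
  | zero =>
    intro α e eqs h w hlen hα H
    exact hterminal α e eqs h w hlen (fun j hj => by
      have := hα j hj
      rw [Nat.cast_zero, abs_nonpos_iff] at this
      exact this.ge) H
  | succ B ihB =>
    -- The descent is lexicographic: the bound B + 1 on the coefficients, the number c of
    -- coefficients that attain it in absolute value, and the number q of negative coefficients.
    suffices key : ∀ c : ℕ, ∀ (α e : ι → ℤ) (eqs : List (ι → ℤ)) (h : ι → ℤ) (w : ι → ℝ),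
        eqs.length = n → (∀ j ∈ F, |α j| ≤ (B + 1 : ℕ)) →
        (F.filter fun j => |α j| = (B + 1 : ℕ)).card ≤ c → HalfOpen F e (α :: eqs) h w →
        QuasiSlices F e (α :: eqs) h from
      fun α e eqs h w hlen hα H => key _ α e eqs h w hlen hα le_rfl H
    have hsmall : ∀ (α e : ι → ℤ) (eqs : List (ι → ℤ)) (h : ι → ℤ) (w : ι → ℝ),
        eqs.length = n → (∀ j ∈ F, |α j| ≤ (B + 1 : ℕ)) → (∀ j ∈ F, |α j| ≠ (B + 1 : ℕ)) →
        HalfOpen F e (α :: eqs) h w → QuasiSlices F e (α :: eqs) h := by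
      intro α e eqs h w hlen hα hne H
      refine ihB α e eqs h w hlen (fun j hj => ?_) H
      have h1 := hα j hj
      have h2 := hne j hj
      push_cast at h1 h2 ⊢
      omega
    intro c
    induction c with
    | zero =>
      intro α e eqs h w hlen hα hc H
      refine hsmall α e eqs h w hlen hα (fun j hj hj' => ?_) H
      rw [Nat.le_zero, Finset.card_eq_zero] at hc
      have : j ∈ (F.filter fun j => |α j| = (B + 1 : ℕ)) := Finset.mem_filter.mpr ⟨hj, hj'⟩
      rw [hc] at this
      simp at this
    | succ c ihc =>
      suffices key : ∀ q : ℕ, ∀ (α e : ι → ℤ) (eqs : List (ι → ℤ)) (h : ι → ℤ) (w : ι → ℝ),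
          eqs.length = n → (∀ j ∈ F, |α j| ≤ (B + 1 : ℕ)) →
          (F.filter fun j => |α j| = (B + 1 : ℕ)).card ≤ c + 1 →
          ∀ X ∈ F, α X = (B + 1 : ℕ) → (F.filter fun j => α j < 0).card ≤ q →
          HalfOpen F e (α :: eqs) h w → QuasiSlices F e (α :: eqs) h by
        intro α e eqs h w hlen hα hc H
        by_cases hX : ∃ X ∈ F, |α X| = (B + 1 : ℕ)
        · obtain ⟨X, hXF, hX⟩ := hX
          rcases abs_eq (by positivity : (0 : ℤ) ≤ (B + 1 : ℕ)) |>.mp hX with hX | hX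
          · exact key _ α e eqs h w hlen hα hc X hXF hX le_rfl H
          -- Changing the sign of the equation makes the extreme coefficient positive.
          · rw [QuasiSlices, ← coneSlice_neg]
            refine key _ (-α) e eqs h w hlen (fun j hj => ?_) ?_ X hXF ?_ le_rfl H.neg
            · rw [Pi.neg_apply, abs_neg]
              exact hα j hj
            · simp only [Pi.neg_apply, abs_neg]
              exact hc
            · rw [Pi.neg_apply, hX, neg_neg]
        · push Not at hX
          exact hsmall α e eqs h w hlen hα hX H
      intro q
      induction q with
      | zero =>
        intro α e eqs h w hlen hα hc X hXF hX hq H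
        refine hterminal α e eqs h w hlen (fun j hj => ?_) H
        by_contra hneg
        rw [Nat.le_zero, Finset.card_eq_zero] at hq
        have : j ∈ (F.filter fun j => α j < 0) := Finset.mem_filter.mpr ⟨hj, not_le.mp hneg⟩
        rw [hq] at this
        simp at this
      | succ q ihq =>
        intro α e eqs h w hlen hα hc X hXF hX hq H
        by_cases hY : ∃ Y ∈ F, α Y < 0
        · obtain ⟨Y, hYF, hY⟩ := hY
          have hXY : X ≠ Y := by
            rintro rfl
            omega
          have hYB := (abs_le.mp (hα Y hYF)).1
          have hsum : 0 ≤ α Y + α X ∧ α Y + α X ≤ B := by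
            push_cast at *
            omega
          have habs : |α Y + α X| ≤ B := by
            rw [abs_of_nonneg hsum.1]
            exact hsum.2
          refine H.quasiSlices_of_split hXF hYF hXY (fun δ w' H' => ?_) (fun δ w' H' => ?_)
          -- Here α Y becomes α Y + α X, which lies between 0 and B: one negative coefficient fewer,
          -- while X stays extreme.
          · refine ihq _ _ _ _ _ (by simpa using hlen) (fun j hj => ?_) (le_trans ?_ hc) X hXF ?_ ?_
              H'
            · by_cases hjY : j = Y
              · subst hjY
                rw [transfer_apply_self]
                push_cast
                linarith
              · rw [transfer_apply_of_ne hjY]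
                exact hα j hj
            · refine Finset.card_le_card fun j hj => ?_
              rw [Finset.mem_filter] at hj ⊢
              refine ⟨hj.1, ?_⟩
              by_cases hjY : j = Y
              · subst hjY
                rw [transfer_apply_self] at hj
                have := hj.2
                push_cast at this
                omega
              · rw [transfer_apply_of_ne hjY] at hj
                exact hj.2
            · rw [transfer_apply_of_ne hXY]
              exact hX
            · rw [← Nat.lt_succ_iff]
              refine lt_of_lt_of_le (Finset.card_lt_card ?_) hq
              rw [Finset.ssubset_iff_of_subset]
              · refine ⟨Y, Finset.mem_filter.mpr ⟨hYF, hY⟩, fun hmem => ?_⟩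
                have := (Finset.mem_filter.mp hmem).2
                rw [transfer_apply_self] at this
                omega
              · intro j hj
                rw [Finset.mem_filter] at hj ⊢
                refine ⟨hj.1, ?_⟩
                by_cases hjY : j = Y
                · subst hjY
                  exact hY
                · rw [transfer_apply_of_ne hjY] at hj
                  exact hj.2
          -- Here α X becomes α X + α Y, which is at most B in absolute value: one extreme
          -- coefficient fewer.
          · refine ihc _ _ _ _ _ (by simpa using hlen) (fun j hj => ?_) ?_ H'
            · by_cases hjX : j = X
              · subst hjX
                rw [transfer_apply_self, add_comm]
                push_cast
                linarith
              · rw [transfer_apply_of_ne hjX]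
                exact hα j hj
            · rw [← Nat.lt_succ_iff]
              refine lt_of_lt_of_le (Finset.card_lt_card ?_) hc
              rw [Finset.ssubset_iff_of_subset]
              · refine ⟨X, Finset.mem_filter.mpr ⟨hXF, ?_⟩, fun hmem => ?_⟩
                · rw [hX]
                  exact abs_of_nonneg (by positivity)
                · have := (Finset.mem_filter.mp hmem).2
                  rw [transfer_apply_self, add_comm] at this
                  push_cast at this
                  omega
              · intro j hj
                rw [Finset.mem_filter] at hj ⊢
                refine ⟨hj.1, ?_⟩
                by_cases hjX : j = X
                · subst hjX
                  rw [hX]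
                  exact abs_of_nonneg (by positivity)
                · rw [transfer_apply_of_ne hjX] at hj
                  exact hj.2
        · push Not at hY
          exact hterminal α e eqs h w hlen hY H

end HalfOpenCones

end

end WeightLifting

namespace WeightLifting

noncomputable section

/-! ### Half-open orthants, where no equation is left. -/

section HalfOpenOrthants

variable {ι : Type*} [Fintype ι] [DecidableEq ι] {F : Finset ι} {e h : ι → ℤ}

lemma finite_coneSlice_nil (hh : ∀ j ∈ F, 0 < h j) (he : ∀ j ∈ F, 0 ≤ e j) (t : ℕ) :
    (coneSlice F e [] h t).Finite := by
  refine (Set.finite_Icc (0 : ι → ℤ) (fun _ => (t : ℤ))).subset ?_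
  rintro x ⟨h1, h2, _, h4⟩
  have hx0 : ∀ j, 0 ≤ x j := fun j => by
    by_cases hj : j ∈ F
    · exact (he j hj).trans (h1 j hj)
    · exact (h2 j hj).ge
  refine ⟨hx0, fun j => ?_⟩
  by_cases hj : j ∈ F
  · have hterm : ∀ i ∈ Finset.univ, 0 ≤ h i * x i := fun i _ => by
      by_cases hi : i ∈ F
      · exact mul_nonneg (hh i hi).le (hx0 i)
      · rw [h2 i hi, mul_zero]
    have h5 : h j * x j ≤ t := by
      rw [← h4]
      exact Finset.single_le_sum hterm (Finset.mem_univ j)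
    have := hh j hj
    have := hx0 j
    change x j ≤ (t : ℤ)
    nlinarith
  · change x j ≤ (t : ℤ)
    rw [h2 j hj]
    positivity

/-- Points with x j > e j come from height u - h j by a unit step in direction j; those with x j = e
j are points of the facet, at height u - h j * e j. The heights are given as `t`, `s`, `u` so that
no subtraction of naturals occurs. -/
lemma ncard_coneSlice_insert {j : ι} (hj : j ∉ F) (hh : ∀ i ∈ insert j F, 0 < h i)
    (he : ∀ i ∈ insert j F, 0 ≤ e i) {t s u : ℕ} (hu : (u : ℤ) = t + h j)
    (hs : (s : ℤ) + h j * e j = t + h j) :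
    (coneSlice (insert j F) e [] h u).ncard =
      (coneSlice (insert j F) e [] h t).ncard + (coneSlice F e [] h s).ncard := by
  have hA : (fun x => x + Pi.single j 1) '' coneSlice (insert j F) e [] h t =
      coneSlice (insert j F) e [] h u ∩ {x | e j + 1 ≤ x j} := by
    ext x
    constructor
    · rintro ⟨x, ⟨h1, h2, _, h4⟩, rfl⟩
      refine ⟨⟨fun i hi => ?_, fun i hi => ?_, by simp, ?_⟩, ?_⟩
      · have := h1 i hi
        by_cases hij : i = j
        · subst hij
          simp only [Pi.add_apply, Pi.single_eq_same]
          omega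
        · simpa [hij] using this
      · have hij : i ≠ j := fun h => hi (h ▸ Finset.mem_insert_self _ _)
        simp [hij, h2 i hi]
      · rw [dotProduct_add, h4, dotProduct_single, hu, mul_one]
      · have := h1 j (Finset.mem_insert_self _ _)
        simpa using this
    · rintro ⟨⟨h1, h2, _, h4⟩, h5⟩
      rw [mem_ofPred_eq] at h5
      refine ⟨x - Pi.single j 1, ⟨fun i hi => ?_, fun i hi => ?_, by simp, ?_⟩,
        sub_add_cancel _ _⟩
      · have := h1 i hi
        by_cases hij : i = j
        · subst hij
          simp only [Pi.sub_apply, Pi.single_eq_same]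
          omega
        · simpa [hij] using this
      · have hij : i ≠ j := fun h => hi (h ▸ Finset.mem_insert_self _ _)
        simp [hij, h2 i hi]
      · rw [dotProduct_sub, h4, dotProduct_single, hu]
        ring
  have hB : (fun x => x + Pi.single j (e j)) '' coneSlice F e [] h s =
      coneSlice (insert j F) e [] h u ∩ {x | x j = e j} := by
    ext x
    constructor
    · rintro ⟨x, ⟨h1, h2, _, h4⟩, rfl⟩
      refine ⟨⟨fun i hi => ?_, fun i hi => ?_, by simp, ?_⟩, ?_⟩
      · by_cases hij : i = j
        · subst hij
          simp [h2 i hj]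
        · simpa [hij] using h1 i ((Finset.mem_insert.mp hi).resolve_left hij)
      · have hij : i ≠ j := fun h => hi (h ▸ Finset.mem_insert_self _ _)
        simp [hij, h2 i fun h => hi (Finset.mem_insert_of_mem h)]
      · rw [dotProduct_add, h4, dotProduct_single, hs, hu]
      · simp [h2 j hj]
    · rintro ⟨⟨h1, h2, _, h4⟩, h5⟩
      rw [mem_ofPred_eq] at h5
      refine ⟨x - Pi.single j (e j), ⟨fun i hi => ?_, fun i hi => ?_, by simp, ?_⟩,
        sub_add_cancel _ _⟩
      · have hij : i ≠ j := fun h => hj (h ▸ hi)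
        simpa [hij] using h1 i (Finset.mem_insert_of_mem hi)
      · by_cases hij : i = j
        · subst hij
          simp [h5]
        · simp [hij, h2 i fun h => hi ((Finset.mem_insert.mp h).resolve_left hij)]
      · rw [dotProduct_sub, h4, dotProduct_single]
        linarith
  have hunion : coneSlice (insert j F) e [] h u =
      (coneSlice (insert j F) e [] h u ∩ {x | e j + 1 ≤ x j}) ∪
        (coneSlice (insert j F) e [] h u ∩ {x | x j = e j}) := by
    rw [← inter_union_distrib_left, eq_comm, inter_eq_left]
    rintro x ⟨h1, _⟩
    have := h1 j (Finset.mem_insert_self _ _)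
    rcases eq_or_lt_of_le this with h | h
    · exact Or.inr h.symm
    · exact Or.inl h
  have hdisj : Disjoint (coneSlice (insert j F) e [] h u ∩ {x | e j + 1 ≤ x j})
        (coneSlice (insert j F) e [] h u ∩ {x | x j = e j}) := by
    rw [Set.disjoint_left]
    rintro x ⟨_, ha⟩ ⟨_, hb⟩
    rw [mem_ofPred_eq] at ha hb
    omega
  have hfin := finite_coneSlice_nil hh he u
  rw [hunion, Set.ncard_union_eq hdisj (hfin.inter_of_left _) (hfin.inter_of_left _), ← hA, ← hB,
    Set.ncard_image_of_injective _ (add_left_injective _),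
    Set.ncard_image_of_injective _ (add_left_injective _)]

lemma HalfOpen.quasiSlices_nil {w : ι → ℝ} (H : HalfOpen F e [] h w) :
    QuasiSlices F e [] h := by
  have hh : ∀ j ∈ F, 0 < h j := by
    intro j hj
    have := H.pointed (Pi.single j 1) (fun i => ?_) (fun i hi => ?_) (by simp) (by simp)
    · simpa [dotProduct_single] using this
    · by_cases hij : i = j
      · subst hij; simp
      · simp [hij]
    · have hij : i ≠ j := fun h => hi (h ▸ hj)
      simp [hij]
  have he : ∀ j ∈ F, 0 ≤ e j := fun j hj => H.flag_nonneg hj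
  refine ⟨finite_coneSlice_nil hh he, ?_⟩
  -- If all facets were removed, w would be nonpositive and could not have positive height.
  obtain ⟨j₀, hj₀, he₀⟩ : ∃ j ∈ F, e j = 0 := by
    by_contra hne
    push Not at hne
    refine absurd H.height (not_lt.mpr (Finset.sum_nonpos fun j _ => ?_))
    by_cases hj : j ∈ F
    · have hw := ((H.flag j hj).resolve_left fun h => hne j hj h.1).2
      have := hh j hj
      exact mul_nonpos_of_nonneg_of_nonpos (by simpa using this.le) hw
    · rw [H.off j hj, mul_zero]
  suffices key : ∀ G : Finset ι, G ⊆ F → j₀ ∉ G →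
      IsQuasi (fun t => ((coneSlice (insert j₀ G) e [] h t).ncard : ℝ)) by
    have := key (F.erase j₀) (Finset.erase_subset _ _) (Finset.notMem_erase _ _)
    rwa [Finset.insert_erase hj₀] at this
  intro G
  induction G using Finset.induction_on with
  | empty =>
    intro _ _
    obtain ⟨k, hk⟩ := Int.eq_ofNat_of_zero_le (hh j₀ hj₀).le
    have hk0 : 0 < k := by have := hh j₀ hj₀; omega
    -- Periodicity from t = 0 on rests on e j₀ = 0: the facet {0} is then taken at height t + k > 0,
    -- where its slice is empty.
    refine IsQuasi.zero.of_step (s := 0) hk0 fun t => ?_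
    rw [ncard_coneSlice_insert (t := t) (s := t + k) (u := t + k) (by simp)
      (fun i hi => hh i (by simp at hi; exact hi ▸ hj₀))
      (fun i hi => he i (by simp at hi; exact hi ▸ hj₀)) (by rw [hk]; simp)
      (by rw [he₀, hk]; simp)]
    have : coneSlice (∅ : Finset ι) e [] h (t + k) = ∅ := by
      rw [Set.eq_empty_iff_forall_notMem]
      rintro x ⟨_, h2, _, h4⟩
      have hx : x = 0 := funext fun j => h2 j (by simp)
      rw [hx, dotProduct_zero] at h4
      omega
    rw [this]
    simp
  | insert j G hjG ih =>
    intro hGF hj₀G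
    have hjF : j ∈ F := hGF (Finset.mem_insert_self _ _)
    have hne : j ≠ j₀ := fun h => hj₀G (h ▸ Finset.mem_insert_self _ _)
    have hq := ih (fun i hi => hGF (Finset.mem_insert_of_mem hi))
      fun h => hj₀G (Finset.mem_insert_of_mem h)
    obtain ⟨k, hk⟩ := Int.eq_ofNat_of_zero_le (hh j hjF).le
    have hk0 : 0 < k := by have := hh j hjF; omega
    rw [Finset.insert_comm]
    have hsub : ∀ i ∈ insert j (insert j₀ G), i ∈ F := by
      intro i hi
      rcases Finset.mem_insert.mp hi with rfl | hi
      · exact hjF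
      rcases Finset.mem_insert.mp hi with rfl | hi
      · exact hj₀
      · exact hGF (Finset.mem_insert_of_mem hi)
    have hnot : j ∉ insert j₀ G := by
      simp [hne, hjG]
    -- The new facet is counted at height t + k if it is present and at height t if it is removed;
    -- `IsQuasi.of_step` allows either shift.
    rcases H.flag j hjF with ⟨hej, _⟩ | ⟨hej, _⟩
    · refine hq.of_step (s := k) hk0 fun t => ?_
      rw [ncard_coneSlice_insert (t := t) (s := t + k) (u := t + k) hnot
        (fun i hi => hh i (hsub i hi)) (fun i hi => he i (hsub i hi)) (by rw [hk]; simp)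
        (by rw [hej, hk]; simp)]
      push_cast
      rfl
    · refine hq.of_step (s := 0) hk0 fun t => ?_
      rw [ncard_coneSlice_insert (t := t) (s := t) (u := t + k) hnot
        (fun i hi => hh i (hsub i hi)) (fun i hi => he i (hsub i hi)) (by rw [hk]; simp)
        (by rw [hej, hk]; simp)]
      push_cast
      rfl

/-- The slices of a half-open cone that is visible from a point of positive height are counted by
a quasi-polynomial. -/
theorem HalfOpen.quasiSlices {eqs : List (ι → ℤ)} {w : ι → ℝ} (H : HalfOpen F e eqs h w) :
    QuasiSlices F e eqs h := by
  obtain ⟨n, hn⟩ : ∃ n, eqs.length = n := ⟨_, rfl⟩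
  induction n generalizing F e eqs h w with
  | zero =>
    rw [List.length_eq_zero_iff] at hn
    subst hn
    exact H.quasiSlices_nil
  | succ n ih =>
    obtain ⟨α, eqs, rfl⟩ := List.exists_cons_of_length_eq_add_one hn
    refine HalfOpen.quasiSlices_cons (n := n) (fun F e eqs h w hlen H => ih H hlen) F
      (∑ j, (α j).natAbs) α e eqs h w (by simpa using hn) (fun j _ => ?_) H
    rw [Int.abs_eq_natAbs]
    exact_mod_cast Finset.single_le_sum (f := fun j => (α j).natAbs)
      (fun _ _ => Nat.zero_le _) (Finset.mem_univ j)

end HalfOpenOrthants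

/-! ### Quasi-polynomiality of lattice point counts. -/

section Ehrhart

variable {σ ι : Type*} [Fintype σ] [Fintype ι]

/-- The lattice points of the dilates of a rational polytope are counted by a quasi-polynomial,
for all `t ≥ 0`. -/
theorem isQuasi_latticeCount {A : Matrix σ ι ℤ} {b : σ → ℤ}
    (hb : Bornology.IsBounded (stdPolytope A b)) (hne : (stdPolytope A b).Nonempty) :
    IsQuasi (fun t => (latticeCount ((t : ℝ) • stdPolytope A b) : ℝ)) := by
  classical
  -- Homogenization: the coordinate `none` carries the dilation factor t and is the height.
  set row : σ → Option ι → ℤ := fun i j => j.elim (-b i) (A i) with hrow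
  set h : Option ι → ℤ := fun j => j.elim 1 (fun _ => 0) with hh
  obtain ⟨x₀, hx₀⟩ := hne
  have hdot : ∀ (i : σ) (x : Option ι → ℤ),
      row i ⬝ᵥ x = A.mulVec (fun j => x (some j)) i - b i * x none := by
    intro i x
    simp only [hrow, dotProduct, Fintype.sum_option, Matrix.mulVec, Option.elim]
    ring
  have hheight : ∀ x : Option ι → ℤ, h ⬝ᵥ x = x none := by
    intro x
    simp [hh, dotProduct, Fintype.sum_option]
  -- No facet is removed, and a real point of the polytope placed at height one serves as w.
  have H : HalfOpen Finset.univ 0 (Finset.univ.toList.map row) h (fun j => j.elim 1 x₀) := by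
    refine ⟨fun j _ => Or.inl ⟨rfl, ?_⟩, by simp, ?_, ?_, ?_⟩
    · cases j with
      | none => simp
      | some j => exact hx₀.2 j
    · intro a ha
      obtain ⟨i, _, rfl⟩ := List.mem_map.mp ha
      have h1 : realMap A x₀ i = b i := congrFun hx₀.1 i
      rw [realMap_apply] at h1
      simp only [hrow, dotProduct, Fintype.sum_option, Option.elim, intVec_apply, h1]
      push_cast
      ring
    · simp [hh, dotProduct, Fintype.sum_option]
    · intro x hx _ hxe hx0
      rw [hheight]
      refine lt_of_le_of_ne (hx none) fun hnone => hx0 ?_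
      -- A point of the cone at height zero is a direction of recession.
      have hv : intVec (fun j => x (some j)) = 0 := by
        refine eq_zero_of_mem_recession hb ⟨x₀, hx₀⟩ ?_ (fun j => ?_)
        · rw [realMap_intVec]
          ext i
          have := hxe (row i) (List.mem_map_of_mem (by simp))
          rw [hdot, ← hnone, mul_zero, sub_zero] at this
          simp [this]
        · simpa using hx (some j)
      ext j
      cases j with
      | none => exact hnone.symm
      | some j => simpa using congrFun hv j
  have hcount : ∀ t : ℕ, latticeCount ((t : ℝ) • stdPolytope A b) =
      (coneSlice Finset.univ 0 (Finset.univ.toList.map row) h t).ncard := by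
    intro t
    rw [latticeCount, smul_stdPolytope hb ⟨x₀, hx₀⟩]
    symm
    refine Set.ncard_congr' ⟨fun x => ⟨fun j => x.1 (some j), ?_⟩,
      fun z => ⟨fun j => j.elim (t : ℤ) z.1, ?_⟩, ?_, ?_⟩
    · obtain ⟨x, h1, _, h3, h4⟩ := x
      rw [hheight] at h4
      rw [mem_latticePoints, mem_stdPolytope, realMap_intVec]
      refine ⟨congrArg intVec (funext fun i => ?_), fun j => ?_⟩
      · have := h3 (row i) (List.mem_map_of_mem (by simp))
        rw [hdot, h4, sub_eq_zero] at this
        rw [this, Pi.smul_apply, smul_eq_mul, mul_comm]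
      · simpa using h1 (some j)
    · obtain ⟨z, hz⟩ := z
      rw [mem_latticePoints, mem_stdPolytope, realMap_intVec, intVec_injective.eq_iff] at hz
      refine ⟨fun j _ => ?_, by simp, fun a ha => ?_, by rw [hheight]; rfl⟩
      · cases j with
        | none => simp
        | some j => simpa using hz.2 j
      · obtain ⟨i, _, rfl⟩ := List.mem_map.mp ha
        rw [hdot]
        have := congrFun hz.1 i
        simp only [Pi.smul_apply, smul_eq_mul, Option.elim] at this ⊢
        rw [this]
        ring
    · rintro ⟨x, h1, _, h3, h4⟩
      rw [hheight] at h4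
      ext j
      cases j with
      | none => exact h4.symm
      | some j => rfl
    · rintro ⟨z, hz⟩
      rfl
  simp only [hcount]
  exact H.quasiSlices.2

end Ehrhart

end

end WeightLifting

namespace WeightLifting

noncomputable section

/-! ### The leading coefficient and the periodicity of the affine lattice. -/

section LeadingCoefficient

open Polynomial in
-- Growth along one unbounded sequence determines the coefficient of degree d. The limit v may be
-- zero, in which case the degree may be smaller than d.
lemma natDegree_le_and_coeff_eq_of_tendsto {Q : ℝ[X]} {d : ℕ} {v : ℝ} {t : ℕ → ℕ}
    (ht : Tendsto t atTop atTop)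
    (h : Tendsto (fun k => Q.eval (t k : ℝ) / (t k : ℝ) ^ d) atTop (𝓝 v)) :
    Q.natDegree ≤ d ∧ Q.coeff d = v := by
  have ht' : Tendsto (fun k => (t k : ℝ)) atTop atTop := tendsto_natCast_atTop_atTop.comp ht
  have hX : ∀ x : ℝ, (X ^ d : ℝ[X]).eval x = x ^ d := fun x => by simp
  have hdegX : (X ^ d : ℝ[X]).degree = d := degree_X_pow d
  have hle : Q.natDegree ≤ d := by
    by_contra hlt
    rw [not_le] at hlt
    have h1 := abs_div_tendsto_atTop_atTop_of_degree_gt Q (X ^ d)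
      (degree_lt_degree (by rwa [natDegree_X_pow])) (pow_ne_zero _ X_ne_zero)
    have h2 := h1.comp ht'
    simp only [Function.comp_def, hX] at h2
    exact not_tendsto_nhds_of_tendsto_atTop h2 _ h.abs
  refine ⟨hle, ?_⟩
  rcases hle.lt_or_eq with hlt | heq
  · have h1 := div_tendsto_atTop_zero_of_degree_lt Q (X ^ d)
      (degree_lt_degree (by rwa [natDegree_X_pow]))
    have h2 := h1.comp ht'
    simp only [Function.comp_def, hX] at h2
    rw [coeff_eq_zero_of_natDegree_lt hlt]
    exact tendsto_nhds_unique h2 h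
  · by_cases hQ : Q = 0
    · subst hQ
      simp only [eval_zero, zero_div] at h
      rw [coeff_zero]
      exact tendsto_nhds_unique tendsto_const_nhds h
    · have h1 := div_tendsto_atTop_leadingCoeff_div_of_degree_eq Q (X ^ d)
        (by rw [hdegX, degree_eq_natDegree hQ, heq])
      have h2 := h1.comp ht'
      simp only [Function.comp_def, hX] at h2
      rw [← heq, coeff_natDegree]
      have := tendsto_nhds_unique h2 h
      rwa [leadingCoeff_X_pow, div_one] at this

variable {σ ι : Type*}

lemma latticePoints_subset_affLattice (S : Set (ι → ℝ)) (t : ℕ) :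
    latticePoints ((t : ℝ) • S) ⊆ affLattice S t :=
  fun _ hz => subset_affineSpan ℝ _ hz

variable [Fintype ι]

/-- Some multiple of the affine hull of a polytope contains an integer vector. -/
lemma exists_translation {A : Matrix σ ι ℤ} {b : σ → ℤ}
    (hne : (stdPolytope A b).Nonempty) :
    ∃ q : ℕ, 0 < q ∧ ∃ z : ι → ℤ, ∀ k : ℤ, ∀ t u : ℕ, 1 ≤ t → 1 ≤ u → (u : ℤ) = t + k * q →
      ∀ x ∈ affLattice (stdPolytope A b) t, x + k • z ∈ affLattice (stdPolytope A b) u := by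
  obtain ⟨x, hx, hmax⟩ := exists_maximal_support (convex_stdPolytope A b) hne fun x hx => hx.2
  -- An integer point z in the hull of the q-th dilate; adding k • z, for k of either sign, leads
  -- from the hull of the t-th dilate to that of the (t + kq)-th.
  obtain ⟨q, hq, z, hz, hz0⟩ := exists_integer_multiple_solution hx.1
  refine ⟨q, hq, z, fun k t u ht hu htu y hy => ?_⟩
  rw [mem_affLattice_stdPolytope hx hmax ht] at hy
  rw [mem_affLattice_stdPolytope hx hmax hu]
  refine ⟨?_, fun i hi => ?_⟩
  · rw [Matrix.mulVec_add, Matrix.mulVec_smul, hy.1, hz, smul_smul, htu, add_smul]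
  · simp [hy.2 i hi, hz0 i hi]

/-- Ehrhart's theorem for rational polytopes, with the leading coefficient. -/
theorem exists_ehrhart_quasiPolynomial [Fintype σ] {A : Matrix σ ι ℤ} {b : σ → ℤ}
    (hb : Bornology.IsBounded (stdPolytope A b)) (hne : (stdPolytope A b).Nonempty) :
    ∃ (p : ℕ) (E : ℕ → ℕ → ℝ),
      IsQuasiPolynomial (fun t => (latticeCount ((t : ℝ) • stdPolytope A b) : ℝ))
        (affDim (stdPolytope A b)) p E ∧
      (∀ t : ℕ, 1 ≤ t → (affLattice (stdPolytope A b) t).Nonempty →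
        E (affDim (stdPolytope A b)) t = normVol (stdPolytope A b)) ∧
      (∀ t : ℕ, 1 ≤ t → ¬ (affLattice (stdPolytope A b) t).Nonempty →
        E (affDim (stdPolytope A b)) t = 0) := by
  set P := stdPolytope A b with hP
  obtain ⟨p₀, hp₀, hQ⟩ := (isQuasi_latticeCount hb hne).exists_polynomial
  choose Q hQ using hQ
  obtain ⟨q, hq, z, hz⟩ := exists_translation hne
  -- On a class modulo p the count is one polynomial, and the hulls of the positive dilates either
  -- all contain integer points or none does.
  set p := p₀ * q with hp
  have hppos : 0 < p := Nat.mul_pos hp₀ hq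
  have hQ' : ∀ r m : ℕ, (latticeCount (((r + p * m : ℕ) : ℝ) • P) : ℝ) =
      (Q r).eval ((r + p * m : ℕ) : ℝ) := by
    intro r m
    have h1 := hQ r (q * m)
    rw [← mul_assoc, ← hp] at h1
    exact h1
  have hper : ∀ t u : ℕ, 1 ≤ t → 1 ≤ u → t % p = u % p → (affLattice P t).Nonempty →
      (affLattice P u).Nonempty := by
    rintro t u ht hu htu ⟨x, hx⟩
    obtain ⟨k, hk⟩ : (p : ℤ) ∣ (u : ℤ) - t :=
      (Nat.modEq_iff_dvd (a := t) (b := u) (n := p)).mp htu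
    refine ⟨_, hz (k * p₀) t u ht hu ?_ x hx⟩
    rw [hp] at hk
    push_cast at hk
    linarith
  -- The shift m + 1 avoids the dilate 0, where the hull says nothing about the class.
  have hseq : ∀ r, Tendsto (fun m => r + p * (m + 1)) atTop atTop := fun r =>
    tendsto_atTop_mono (fun m => by rw [id]; nlinarith) tendsto_id
  have hcoef : ∀ r, ∃ v : ℝ, ((Q r).natDegree ≤ affDim P ∧ (Q r).coeff (affDim P) = v) ∧
      (∀ t : ℕ, 1 ≤ t → t % p = r % p → (affLattice P t).Nonempty → v = normVol P) ∧
      (∀ t : ℕ, 1 ≤ t → t % p = r % p → ¬ (affLattice P t).Nonempty → v = 0) := by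
    intro r
    have h1 : ∀ m, 1 ≤ r + p * (m + 1) := fun m => by nlinarith
    have hmod : ∀ m, (r + p * (m + 1)) % p = r % p := fun m => by simp
    by_cases hr : (affLattice P (r + p * (0 + 1))).Nonempty
    · refine ⟨normVol P, natDegree_le_and_coeff_eq_of_tendsto (hseq r) ?_, fun _ _ _ _ => rfl,
        fun t ht htr hE => ?_⟩
      · have := tendsto_latticeCount hne (isCompact_stdPolytope hb) (convex_stdPolytope A b)
          (rationalDirection_stdPolytope hne) h1 (hseq r) fun m =>
            hper _ _ (h1 0) (h1 m) (by rw [hmod, hmod]) hr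
        simp only [← hQ']
        exact this
      · exact absurd (hper _ _ (h1 0) ht (by rw [hmod, htr]) hr) hE
    · refine ⟨0, natDegree_le_and_coeff_eq_of_tendsto (hseq r) ?_, fun t ht htr hE => ?_,
        fun _ _ _ _ => rfl⟩
      · have hzero : ∀ m, latticeCount (((r + p * (m + 1) : ℕ) : ℝ) • P) = 0 := by
          intro m
          have : latticePoints (((r + p * (m + 1) : ℕ) : ℝ) • P) = ∅ := by
            rw [Set.eq_empty_iff_forall_notMem]
            intro x hx
            exact hr (hper _ _ (h1 m) (h1 0) (by rw [hmod, hmod])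
              ⟨x, latticePoints_subset_affLattice P _ hx⟩)
          rw [latticeCount, this, Set.ncard_empty]
        simp only [← hQ', hzero]
        simp
      · exact absurd (hper _ _ ht (h1 0) (by rw [hmod, htr]) hE) hr
  refine ⟨p, fun j t => (Q (t % p)).coeff j, ⟨hppos, fun j t => by simp, fun t => ?_⟩,
    fun t ht hE => ?_, fun t ht hE => ?_⟩
  · obtain ⟨v, ⟨hdeg, _⟩, _⟩ := hcoef (t % p)
    have h1 := hQ' (t % p) (t / p)
    rw [Nat.mod_add_div] at h1
    dsimp only
    rw [h1, Polynomial.eval_eq_sum_range' (Nat.lt_succ_of_le hdeg)]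
  · obtain ⟨v, ⟨_, hc⟩, h1, _⟩ := hcoef (t % p)
    dsimp only
    rw [hc]
    exact h1 t ht (by simp) hE
  · obtain ⟨v, ⟨_, hc⟩, _, h1⟩ := hcoef (t % p)
    dsimp only
    rw [hc]
    exact h1 t ht (by simp) hE

end LeadingCoefficient

end

end WeightLifting

namespace WeightLifting

/-! ### The linear structure of the projection from P* to P. -/

noncomputable section

/-- The vectors that vanish where `y₀` does. -/
def vanishing (R : Type*) [Ring R] {μ : Type*} (y₀ : μ → ℝ) : Submodule R (μ → R) where
  carrier := {y | ∀ j, y₀ j = 0 → y j = 0}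
  zero_mem' := by simp
  add_mem' := by
    intro y z hy hz j hj
    rw [Pi.add_apply, hy j hj, hz j hj, add_zero]
  smul_mem' := by
    intro c y hy j hj
    rw [Pi.smul_apply, hy j hj, smul_zero]

section Frames

variable {σ ρ ι μ : Type*} [Fintype ι] [Fintype μ]

/-- The parameters `x` for which `C y = D x` has a real solution `y` that vanishes where `y₀`
does. -/
def paramSpace (C : Matrix ρ μ ℤ) (D : Matrix ρ ι ℤ) (y₀ : μ → ℝ) : Submodule ℝ (ι → ℝ) :=
  ((vanishing ℝ y₀).map (realMap C)).comap (realMap D)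

lemma mem_paramSpace {C : Matrix ρ μ ℤ} {D : Matrix ρ ι ℤ} {y₀ : μ → ℝ} {x : ι → ℝ} :
    x ∈ paramSpace C D y₀ ↔ ∃ y ∈ vanishing ℝ y₀, realMap C y = realMap D x := Iff.rfl

/-- A linear right inverse of C onto its range, extended to the whole space and composed with D.
Linearity in x is what lets fibres be compared in fixed coordinates and rescaled. -/
lemma exists_section [Fintype ρ] (C : Matrix ρ μ ℤ) (D : Matrix ρ ι ℤ) (y₀ : μ → ℝ) :
    ∃ s : (ι → ℝ) →ₗ[ℝ] (μ → ℝ), ∀ x ∈ paramSpace C D y₀,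
      s x ∈ vanishing ℝ y₀ ∧ realMap C (s x) = realMap D x := by
  set f := (realMap C).domRestrict (vanishing ℝ y₀) with hf
  obtain ⟨g, hg⟩ := f.rangeRestrict.exists_rightInverse_of_surjective
    (LinearMap.range_eq_top.mpr f.surjective_rangeRestrict)
  obtain ⟨g', hg'⟩ := g.exists_extend
  refine ⟨(vanishing ℝ y₀).subtype ∘ₗ g' ∘ₗ realMap D, fun x hx => ⟨(g' (realMap D x)).2, ?_⟩⟩
  obtain ⟨y, hy, hyx⟩ := mem_paramSpace.mp hx
  have h1 : g' (realMap D x) = g (f.rangeRestrict ⟨y, hy⟩) := by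
    rw [← hg', ← hyx]
    rfl
  have h2 : f.rangeRestrict (g (f.rangeRestrict ⟨y, hy⟩)) = f.rangeRestrict ⟨y, hy⟩ :=
    LinearMap.congr_fun hg _
  have h3 : realMap C (g (f.rangeRestrict ⟨y, hy⟩)) = realMap C y :=
    congrArg Subtype.val h2
  change realMap C (g' (realMap D x)) = _
  rw [h1, h3, hyx]

/-- A point of maximal support of the lifting polytope, and a linear solution of `C y = D x` for the
parameters `x` in the polytope. -/
structure LiftFrame (A : Matrix σ ι ℤ) (b : σ → ℤ) (C : Matrix ρ μ ℤ) (D : Matrix ρ ι ℤ) where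
  /-- The parameter of the point. -/
  base : ι → ℝ
  /-- The point in the fibre. -/
  top : μ → ℝ
  /-- The linear solution. -/
  sec : (ι → ℝ) →ₗ[ℝ] (μ → ℝ)
  base_mem : base ∈ stdPolytope A b
  top_mem : top ∈ paramPolytope C D base
  maximal : ∀ j, top j = 0 → ∀ x ∈ stdPolytope A b, ∀ y ∈ paramPolytope C D x, y j = 0
  mem_paramSpace : ∀ x ∈ stdPolytope A b, x ∈ paramSpace C D top
  sec_spec : ∀ x ∈ paramSpace C D top,
    sec x ∈ vanishing ℝ top ∧ realMap C (sec x) = realMap D x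
  affDim_add : affDim (stdPolytope A b) + affDim (paramPolytope C D base) =
    affDim (liftPolytope A b C D)

lemma nonempty_liftPolytope {A : Matrix σ ι ℤ} {b : σ → ℤ} {C : Matrix ρ μ ℤ} {D : Matrix ρ ι ℤ}
    (hne : (stdPolytope A b).Nonempty)
    (haff : affineSpan ℝ {x ∈ stdPolytope A b | (paramPolytope C D x).Nonempty} =
      affineSpan ℝ (stdPolytope A b)) : (liftPolytope A b C D).Nonempty := by
  rw [← affineSpan_nonempty (k := ℝ), ← haff, affineSpan_nonempty] at hne
  obtain ⟨x, hx, y, hy⟩ := hne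
  exact ⟨Sum.elim x y, mem_liftPolytope.mpr ⟨hx, hy⟩⟩

lemma vectorSpan_paramPolytope {C : Matrix ρ μ ℤ} {D : Matrix ρ ι ℤ} {x : ι → ℝ} {y : μ → ℝ}
    (hy : y ∈ paramPolytope C D x) (hmax : ∀ j, y j = 0 → ∀ z ∈ paramPolytope C D x, z j = 0) :
    vectorSpan ℝ (paramPolytope C D x) = facialKernel C y :=
  vectorSpan_eq_facialKernel (fun _ => Iff.rfl) hy hmax

/-- The hypothesis on affine hulls is used twice: solvability of C y = D x passes from the
parameters with nonempty fibre to all of P, and the directions of P* project onto those of P. Rank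
and nullity of this projection give the dimension formula. -/
theorem nonempty_liftFrame [Fintype ρ] {A : Matrix σ ι ℤ} {b : σ → ℤ} {C : Matrix ρ μ ℤ}
    {D : Matrix ρ ι ℤ} (hne : (stdPolytope A b).Nonempty)
    (haff : affineSpan ℝ {x ∈ stdPolytope A b | (paramPolytope C D x).Nonempty} =
      affineSpan ℝ (stdPolytope A b)) : Nonempty (LiftFrame A b C D) := by
  obtain ⟨z, hz, hmax⟩ := exists_maximal_support
    (convex_stdPolytope (liftMatrix A C D) (Sum.elim b 0)) (nonempty_liftPolytope hne haff)
    fun x hx => hx.2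
  have hz' := mem_liftPolytope.mp hz
  set x₀ : ι → ℝ := z ∘ Sum.inl with hx₀
  set y₀ : μ → ℝ := z ∘ Sum.inr with hy₀
  have hmax' : ∀ j, y₀ j = 0 → ∀ x ∈ stdPolytope A b, ∀ y ∈ paramPolytope C D x, y j = 0 := by
    intro j hj x hx y hy
    exact hmax (Sum.inr j) hj (Sum.elim x y) (mem_liftPolytope.mpr ⟨hx, hy⟩)
  obtain ⟨s, hs⟩ := exists_section C D y₀
  -- Solvability is a linear condition on x, so it holds on the whole affine hull once it holds
  -- where the fibre is nonempty.
  have hsub : affineSpan ℝ {x ∈ stdPolytope A b | (paramPolytope C D x).Nonempty} ≤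
      (paramSpace C D y₀).toAffineSubspace := by
    rw [affineSpan_le]
    rintro x ⟨hx, y, hy⟩
    exact mem_paramSpace.mpr ⟨y, fun j hj => hmax' j hj x hx y hy, hy.1⟩
  refine ⟨⟨x₀, y₀, s, hz'.1, hz'.2, hmax', fun x hx => ?_, hs, ?_⟩⟩
  · rw [haff] at hsub
    exact hsub (subset_affineSpan ℝ _ hx)
  · set V := vectorSpan ℝ (liftPolytope A b C D) with hV
    have hVker : V = facialKernel (liftMatrix A C D) z :=
      vectorSpan_eq_facialKernel (fun _ => Iff.rfl) hz hmax
    set π : (ι ⊕ μ → ℝ) →ₗ[ℝ] (ι → ℝ) := LinearMap.funLeft ℝ ℝ Sum.inl with hπ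
    have hrange : LinearMap.range (π.domRestrict V) = vectorSpan ℝ (stdPolytope A b) := by
      have himg : π.toAffineMap '' (liftPolytope A b C D) =
          {x ∈ stdPolytope A b | (paramPolytope C D x).Nonempty} := by
        ext x
        constructor
        · rintro ⟨u, hu, rfl⟩
          have hu' := mem_liftPolytope.mp hu
          exact ⟨hu'.1, _, hu'.2⟩
        · rintro ⟨hx, y, hy⟩
          exact ⟨Sum.elim x y, mem_liftPolytope.mpr ⟨hx, hy⟩, rfl⟩
      rw [← direction_affineSpan, ← haff, direction_affineSpan, ← himg,
        ← AffineMap.map_vectorSpan, LinearMap.range_domRestrict]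
      rfl
    have hW : vectorSpan ℝ (paramPolytope C D x₀) = facialKernel C y₀ :=
      vectorSpan_paramPolytope hz'.2 fun j hj => hmax' j hj x₀ hz'.1
    have hmem : ∀ y ∈ facialKernel C y₀, Sum.elim (0 : ι → ℝ) y ∈ V := by
      rintro y ⟨hy, hy0⟩
      rw [hVker, mem_facialKernel]
      constructor
      · ext i
        have hy' := fun i => congrFun hy i
        simp only [realMap_apply, Pi.zero_apply] at hy'
        rcases i with i | i
        · simp [realMap_apply, liftMatrix]
        · simp [realMap_apply, liftMatrix, hy']
      · rintro (i | j) h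
        · rfl
        · exact hy0 j h
    set f : facialKernel C y₀ →ₗ[ℝ] V :=
      { toFun := fun y => ⟨Sum.elim 0 y.1, hmem y.1 y.2⟩
        map_add' := by
          intro y y'
          ext (i | i) <;> simp
        map_smul' := by
          intro c y
          ext (i | i) <;> simp } with hf
    have hfinj : Function.Injective f := by
      intro y y' h
      ext j
      exact congrFun (congrArg Subtype.val h) (Sum.inr j)
    -- The kernel of the projection consists of the directions of the fibre over the base point.
    have hker : LinearMap.range f = LinearMap.ker (π.domRestrict V) := by
      apply le_antisymm
      · rintro _ ⟨y, rfl⟩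
        rfl
      · rintro ⟨v, hv⟩ hvk
        have hv0 : ∀ i, v (Sum.inl i) = 0 := fun i => congrFun hvk i
        have hv' := hv
        rw [hVker, mem_facialKernel] at hv'
        refine ⟨⟨v ∘ Sum.inr, ?_, fun j hj => hv'.2 (Sum.inr j) hj⟩, ?_⟩
        · ext i
          have := congrFun hv'.1 (Sum.inr i)
          simpa [realMap_apply, liftMatrix, hv0] using this
        · ext (i | j)
          · exact (hv0 i).symm
          · rfl
    have h1 := LinearMap.finrank_range_add_finrank_ker (π.domRestrict V)
    rw [hrange, ← hker, LinearMap.finrank_range_of_inj hfinj, ← hW] at h1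
    exact h1

end Frames

end

end WeightLifting

namespace WeightLifting

/-! ### Volumes of fibres and their continuity. -/

noncomputable section

lemma volume_affine_hyperplane {κ : Type*} [Fintype κ] {ℓ : (κ → ℝ) →ₗ[ℝ] ℝ} (hℓ : ℓ ≠ 0) (a : ℝ) :
    volume {c : κ → ℝ | a + ℓ c = 0} = 0 := by
  obtain ⟨v, hv⟩ : ∃ v, ℓ v ≠ 0 := by
    by_contra h
    push Not at h
    exact hℓ (LinearMap.ext h)
  have h0 : ℓ ((-a / ℓ v) • v) = -a := by rw [map_smul, smul_eq_mul, div_mul_cancel₀ _ hv]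
  have hset : {c : κ → ℝ | a + ℓ c = 0} =
      (AffineSubspace.mk' ((-a / ℓ v) • v) (LinearMap.ker ℓ) : Set (κ → ℝ)) := by
    ext c
    rw [SetLike.mem_coe, AffineSubspace.mem_mk', LinearMap.mem_ker, vsub_eq_sub, map_sub, h0,
      sub_neg_eq_add, add_comm, mem_ofPred_eq]
  rw [hset]
  refine Measure.addHaar_affineSubspace volume _ fun htop => hv ?_
  have h1 := congrArg AffineSubspace.direction htop
  rw [AffineSubspace.direction_mk', AffineSubspace.direction_top] at h1
  rw [← LinearMap.mem_ker, h1]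
  trivial

lemma eventually_nonneg_iff {α : Type*} {l : Filter α} {p : α → ℝ} {p₀ : ℝ}
    (h : Tendsto p l (𝓝 p₀)) (h0 : p₀ ≠ 0) : ∀ᶠ a in l, (0 ≤ p a ↔ 0 ≤ p₀) := by
  rcases h0.lt_or_gt with h0 | h0
  · filter_upwards [h.eventually (gt_mem_nhds h0)] with a ha
    exact ⟨fun h => absurd ha (not_lt.mpr h), fun h => absurd h0 (not_lt.mpr h)⟩
  · filter_upwards [h.eventually (lt_mem_nhds h0)] with a ha
    exact ⟨fun _ => h0.le, fun _ => ha.le⟩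

namespace LiftFrame

variable {σ ρ ι μ : Type*} [Fintype ι] [Fintype μ] {A : Matrix σ ι ℤ} {b : σ → ℤ}
  {C : Matrix ρ μ ℤ} {D : Matrix ρ ι ℤ} (Φ : LiftFrame A b C D)

/-- The fibre over the base point. -/
abbrev fiber : Set (μ → ℝ) := paramPolytope C D Φ.base

lemma vectorSpan_fiber : vectorSpan ℝ Φ.fiber = facialKernel C Φ.top :=
  vectorSpan_paramPolytope Φ.top_mem fun j hj => Φ.maximal j hj _ Φ.base_mem

lemma rationalDirection_fiber : RationalDirection Φ.fiber :=
  rationalDirection_of_eq_facialKernel Φ.vectorSpan_fiber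

lemma range_latticeMap_fiber : LinearMap.range (latticeMap Φ.fiber) = facialKernel C Φ.top :=
  (range_latticeMap Φ.rationalDirection_fiber).trans Φ.vectorSpan_fiber

lemma latticeMap_mem (c : LatticeIndex Φ.fiber → ℝ) :
    latticeMap Φ.fiber c ∈ facialKernel C Φ.top := by
  rw [← Φ.range_latticeMap_fiber]
  exact LinearMap.mem_range_self _ c

/-- The point with coordinates `c` in the affine space that contains the fibre over `x`. -/
def point (x : ι → ℝ) (c : LatticeIndex Φ.fiber → ℝ) : μ → ℝ := Φ.sec x + latticeMap Φ.fiber c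

lemma point_smul (t : ℝ) (x : ι → ℝ) (c : LatticeIndex Φ.fiber → ℝ) :
    Φ.point (t • x) (t • c) = t • Φ.point x c := by
  rw [point, point, map_smul, map_smul, smul_add]

lemma point_eq_zero {x : ι → ℝ} (hx : x ∈ paramSpace C D Φ.top) (c : LatticeIndex Φ.fiber → ℝ)
    {j : μ} (hj : Φ.top j = 0) : Φ.point x c j = 0 := by
  rw [point, Pi.add_apply, (Φ.sec_spec x hx).1 j hj, (Φ.latticeMap_mem c).2 j hj, add_zero]

lemma realMap_point {x : ι → ℝ} (hx : x ∈ paramSpace C D Φ.top)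
    (c : LatticeIndex Φ.fiber → ℝ) : realMap C (Φ.point x c) = realMap D x := by
  rw [point, map_add, (Φ.sec_spec x hx).2, (Φ.latticeMap_mem c).1, add_zero]

lemma tendsto_point {α : Type*} {l : Filter α} {x : α → ι → ℝ} {u : ι → ℝ}
    {c : α → LatticeIndex Φ.fiber → ℝ} {v : LatticeIndex Φ.fiber → ℝ} (hx : Tendsto x l (𝓝 u))
    (hc : Tendsto c l (𝓝 v)) (j : μ) :
    Tendsto (fun a => Φ.point (x a) (c a) j) l (𝓝 (Φ.point u v j)) := by
  have h1 := ((LinearMap.continuous_of_finiteDimensional Φ.sec).tendsto u).comp hx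
  have h2 := ((continuous_latticeMap Φ.fiber).tendsto v).comp hc
  exact ((continuous_apply j).tendsto _).comp (h1.add h2)

open Classical in
/-- The indicator function of the fibre over `x`, in coordinates. -/
def fiberIndicator (x : ι → ℝ) (c : LatticeIndex Φ.fiber → ℝ) : ℝ :=
  if ∀ j, 0 ≤ Φ.point x c j then 1 else 0

lemma abs_fiberIndicator_le (x : ι → ℝ) (c : LatticeIndex Φ.fiber → ℝ) :
    |Φ.fiberIndicator x c| ≤ 1 := by
  rw [fiberIndicator]
  split_ifs <;> simp

lemma fiberIndicator_congr {x x' : ι → ℝ} {c c' : LatticeIndex Φ.fiber → ℝ}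
    (h : ∀ j, 0 ≤ Φ.point x c j ↔ 0 ≤ Φ.point x' c' j) :
    Φ.fiberIndicator x c = Φ.fiberIndicator x' c' := by
  rw [fiberIndicator, fiberIndicator]
  simp only [h]

lemma fiberIndicator_smul {t : ℝ} (ht : 0 < t) (x : ι → ℝ) (c : LatticeIndex Φ.fiber → ℝ) :
    Φ.fiberIndicator (t • x) (t • c) = Φ.fiberIndicator x c := by
  refine Φ.fiberIndicator_congr fun j => ?_
  rw [point_smul, Pi.smul_apply, smul_eq_mul, mul_nonneg_iff_of_pos_left ht]

lemma measurable_fiberIndicator (x : ι → ℝ) : Measurable (Φ.fiberIndicator x) := by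
  refine Measurable.ite ?_ measurable_const measurable_const
  rw [ofPred_forall]
  refine MeasurableSet.iInter fun j => (isClosed_le continuous_const ?_).measurableSet
  exact (continuous_apply j).comp (continuous_const.add (continuous_latticeMap Φ.fiber))

/-- In the common coordinates all fibres over P lie in one ball: Q(x) is bounded by a multiple of
‖x‖, and `latticeMap` is bounded below. This supplies the dominating functions below. -/
lemma exists_norm_le_of_fiberIndicator_ne_zero [Fintype ρ]
    (hP : Bornology.IsBounded (stdPolytope A b))
    (hQ : ∀ x : ι → ℝ, Bornology.IsBounded (paramPolytope C D x)) :
    ∃ R : ℝ, ∀ x ∈ stdPolytope A b, ∀ c, Φ.fiberIndicator x c ≠ 0 → ‖c‖ ≤ R := by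
  obtain ⟨K, hK0, hK⟩ := exists_norm_le_of_mem_paramPolytope hQ
  obtain ⟨R, hR⟩ := hP.exists_norm_le
  obtain ⟨K', _, hK'⟩ := (latticeMap Φ.fiber).exists_antilipschitzWith
    (LinearMap.ker_eq_bot.mpr (latticeMap_injective Φ.fiber))
  set s := LinearMap.toContinuousLinearMap Φ.sec with hs
  refine ⟨K' * (K * R + ‖s‖ * R), fun x hx c hc => ?_⟩
  have hpt : ∀ j, 0 ≤ Φ.point x c j := by
    by_contra h
    exact hc (if_neg h)
  have hxs := Φ.mem_paramSpace x hx
  have h1 := hK x _ ⟨Φ.realMap_point hxs c, hpt⟩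
  have h2 : ‖Φ.sec x‖ ≤ ‖s‖ * ‖x‖ := s.le_opNorm x
  have h3 : ‖latticeMap Φ.fiber c‖ ≤ ‖Φ.point x c‖ + ‖Φ.sec x‖ := by
    have : latticeMap Φ.fiber c = Φ.point x c - Φ.sec x := by rw [point, add_sub_cancel_left]
    rw [this]
    exact norm_sub_le _ _
  have h4 := hK'.le_mul_dist c 0
  rw [map_zero, dist_zero_right, dist_zero_right] at h4
  have h5 := hR x hx
  calc ‖c‖ ≤ K' * ‖latticeMap Φ.fiber c‖ := h4
    _ ≤ K' * (K * ‖x‖ + ‖s‖ * ‖x‖) := by gcongr; linarith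
    _ ≤ K' * (K * R + ‖s‖ * R) := by gcongr

/-- The normalized volume of the fibre over `x`. -/
def fiberVolume (x : ι → ℝ) : ℝ := ∫ c, Φ.fiberIndicator x c

lemma fiberVolume_smul {t : ℝ} (ht : 0 < t) (x : ι → ℝ) :
    Φ.fiberVolume (t • x) = t ^ affDim Φ.fiber * Φ.fiberVolume x := by
  have h1 : ∀ c, Φ.fiberIndicator (t • x) c = Φ.fiberIndicator x (t⁻¹ • c) := by
    intro c
    rw [← Φ.fiberIndicator_smul ht x, smul_inv_smul₀ ht.ne']
  simp only [fiberVolume, h1]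
  rw [Measure.integral_comp_inv_smul_of_nonneg volume (Φ.fiberIndicator x) ht.le,
    Module.finrank_fintype_fun_eq_card, card_latticeIndex Φ.rationalDirection_fiber, smul_eq_mul]

lemma norm_fiberIndicator_le {R : ℝ} {x : ι → ℝ}
    (hR : ∀ c, Φ.fiberIndicator x c ≠ 0 → ‖c‖ ≤ R) (c : LatticeIndex Φ.fiber → ℝ) :
    ‖Φ.fiberIndicator x c‖ ≤
      (Metric.closedBall (0 : LatticeIndex Φ.fiber → ℝ) R).indicator (fun _ => 1) c := by
  by_cases hc : c ∈ Metric.closedBall (0 : LatticeIndex Φ.fiber → ℝ) R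
  · rw [indicator_of_mem hc]
    exact Φ.abs_fiberIndicator_le x c
  · rw [indicator_of_notMem hc, norm_le_zero_iff]
    by_contra hne
    exact hc (mem_closedBall_zero_iff.mpr (hR c hne))

lemma abs_fiberVolume_le {R : ℝ} {x : ι → ℝ} (hR : ∀ c, Φ.fiberIndicator x c ≠ 0 → ‖c‖ ≤ R) :
    |Φ.fiberVolume x| ≤
      ∫ c, (Metric.closedBall (0 : LatticeIndex Φ.fiber → ℝ) R).indicator (fun _ => (1 : ℝ)) c :=
  norm_integral_le_of_norm_le (integrable_indicator_closedBall 1 R)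
    (Eventually.of_forall (Φ.norm_fiberIndicator_le hR))

/-- Almost no point lies on a wall of the fibre over `u`. -/
lemma ae_point_ne_zero (u : ι → ℝ) :
    ∀ᵐ c, ∀ j, (∀ v, latticeMap Φ.fiber v j = 0) ∨ Φ.point u c j ≠ 0 := by
  rw [ae_all_iff]
  intro j
  by_cases h : ∀ v, latticeMap Φ.fiber v j = 0
  · exact Eventually.of_forall fun c => Or.inl h
  · have hℓ : (LinearMap.proj j) ∘ₗ latticeMap Φ.fiber ≠ 0 := fun h0 =>
      h fun v => LinearMap.congr_fun h0 v
    have := measure_eq_zero_iff_ae_notMem.mp (volume_affine_hyperplane hℓ (Φ.sec u j))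
    filter_upwards [this] with c hc
    exact Or.inr hc

/-- Almost no parameter has a fibre in a coordinate hyperplane. -/
lemma ae_sec_ne_zero :
    ∀ᵐ x ∂(latticeMeasure (stdPolytope A b)).restrict (stdPolytope A b),
      ∀ j, Φ.top j = 0 ∨ (∃ v, latticeMap Φ.fiber v j ≠ 0) ∨ Φ.sec x j ≠ 0 := by
  refine ae_restrict_of_ae ?_
  have hne : (stdPolytope A b).Nonempty := ⟨_, Φ.base_mem⟩
  rw [latticeMeasure_eq hne, (measurableEmbedding_latticeChart hne).ae_map_iff, ae_all_iff]
  intro j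
  by_cases hj : Φ.top j = 0
  · exact Eventually.of_forall fun c => Or.inl hj
  by_cases hv : ∃ v, latticeMap Φ.fiber v j ≠ 0
  · exact Eventually.of_forall fun c => Or.inr (Or.inl hv)
  push Not at hv
  set ℓ := (LinearMap.proj j) ∘ₗ Φ.sec ∘ₗ latticeMap (stdPolytope A b) with hℓdef
  have hval : ∀ c, Φ.sec (latticeChart _ hne c) j = Φ.sec hne.some j + ℓ c := by
    intro c
    rw [latticeChart, map_add]
    rfl
  -- Coordinate j is constant along fibres, so over the base point it equals `Φ.top j`, which is
  -- nonzero.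
  have hbase : Φ.sec Φ.base j ≠ 0 := by
    have hmem : Φ.top - Φ.sec Φ.base ∈ facialKernel C Φ.top := by
      obtain ⟨h1, h2⟩ := Φ.sec_spec _ (Φ.mem_paramSpace _ Φ.base_mem)
      refine ⟨?_, fun i hi => ?_⟩
      · rw [map_sub, h2, sub_eq_zero]
        exact Φ.top_mem.1
      · rw [Pi.sub_apply, hi, h1 i hi, sub_zero]
    rw [← Φ.range_latticeMap_fiber] at hmem
    obtain ⟨v, hv'⟩ := hmem
    have := congrFun hv' j
    rw [hv v, Pi.sub_apply] at this
    intro h0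
    rw [h0, sub_zero] at this
    exact hj this.symm
  -- An affine function on the hull of P, nonzero at the base point, is a nonzero constant or
  -- vanishes on a hyperplane only.
  by_cases hℓ : ℓ = 0
  · refine Eventually.of_forall fun c => Or.inr (Or.inr ?_)
    have h2 := vsub_mem_vectorSpan ℝ Φ.base_mem hne.some_mem
    rw [← range_latticeMap (rationalDirection_stdPolytope hne)] at h2
    obtain ⟨c₀, hc₀⟩ := h2
    have hc₀' : latticeChart _ hne c₀ = Φ.base := by
      rw [latticeChart, hc₀, vsub_eq_sub, add_sub_cancel]
    have h3 := hval c₀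
    rw [hc₀', hℓ, LinearMap.zero_apply, add_zero] at h3
    rw [hval, hℓ, LinearMap.zero_apply, add_zero, ← h3]
    exact hbase
  · have := measure_eq_zero_iff_ae_notMem.mp (volume_affine_hyperplane hℓ (Φ.sec hne.some j))
    filter_upwards [this] with c hc
    refine Or.inr (Or.inr ?_)
    rw [hval]
    exact hc

/-- The indicator at c can jump at u only if some coordinate that is not identically zero vanishes
at (u, c). If the coordinate varies along fibres, this excludes a null set of c; otherwise it
excludes a null set of u. Dominated convergence does the rest. -/
lemma ae_continuousWithinAt_fiberVolume [Fintype ρ] (hP : Bornology.IsBounded (stdPolytope A b))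
    (hQ : ∀ x : ι → ℝ, Bornology.IsBounded (paramPolytope C D x)) :
    ∀ᵐ x ∂(latticeMeasure (stdPolytope A b)).restrict (stdPolytope A b),
      ContinuousWithinAt Φ.fiberVolume (stdPolytope A b) x := by
  obtain ⟨R, hR⟩ := Φ.exists_norm_le_of_fiberIndicator_ne_zero hP hQ
  filter_upwards [Φ.ae_sec_ne_zero, ae_restrict_mem (isClosed_stdPolytope A b).measurableSet]
    with u hu huP
  refine continuousWithinAt_of_dominated
    (bound := (Metric.closedBall (0 : LatticeIndex Φ.fiber → ℝ) R).indicator (fun _ => 1))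
    (Eventually.of_forall fun x => (Φ.measurable_fiberIndicator x).aestronglyMeasurable) ?_
    (integrable_indicator_closedBall 1 R) ?_
  · filter_upwards [self_mem_nhdsWithin] with x hx
    exact Eventually.of_forall (Φ.norm_fiberIndicator_le (hR x hx))
  · filter_upwards [Φ.ae_point_ne_zero u] with c hc
    have hev : ∀ j, ∀ᶠ x in 𝓝[stdPolytope A b] u, (0 ≤ Φ.point x c j ↔ 0 ≤ Φ.point u c j) := by
      intro j
      by_cases hj : Φ.top j = 0
      · filter_upwards [self_mem_nhdsWithin] with x hx
        rw [Φ.point_eq_zero (Φ.mem_paramSpace x hx) c hj,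
          Φ.point_eq_zero (Φ.mem_paramSpace u huP) c hj]
      · refine eventually_nonneg_iff (Φ.tendsto_point (tendsto_id.mono_left nhdsWithin_le_nhds)
          tendsto_const_nhds j) ?_
        -- In the first case the coordinate equals `Φ.sec u j`, which is nonzero for almost every u.
        rcases hc j with h | h
        · have := ((hu j).resolve_left hj).resolve_left (by push Not; exact h)
          rwa [point, Pi.add_apply, h, add_zero]
        · exact h
    refine (tendsto_const_nhds (x := Φ.fiberIndicator u c)).congr' ?_
    filter_upwards [eventually_all.mpr hev] with x hx
    exact (Φ.fiberIndicator_congr hx).symm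

/-- Replacing a fibre by its discretization does not change the volume in the limit. -/
lemma tendsto_integral_fiberIndicator_sub [Fintype ρ] (hP : Bornology.IsBounded (stdPolytope A b))
    (hQ : ∀ x : ι → ℝ, Bornology.IsBounded (paramPolytope C D x)) {u : ℕ → ι → ℝ} {u₀ : ι → ℝ}
    (hu : ∀ k, u k ∈ stdPolytope A b) (hu₀ : Tendsto u atTop (𝓝 u₀)) {δ : ℕ → ℝ}
    (hδ : ∀ k, 0 < δ k) (hδ0 : Tendsto δ atTop (𝓝 0)) (θ : ℕ → LatticeIndex Φ.fiber → ℝ) :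
    Tendsto (fun k => (∫ c, Φ.fiberIndicator (u k) (gridFloor (δ k) (θ k) c)) -
      Φ.fiberVolume (u k)) atTop (𝓝 0) := by
  obtain ⟨R, hR⟩ := Φ.exists_norm_le_of_fiberIndicator_ne_zero hP hQ
  have hmeas : ∀ k, Measurable fun c => Φ.fiberIndicator (u k) (gridFloor (δ k) (θ k) c) :=
    fun k => measurable_comp_gridFloor (hδ k) (θ k)
      (finite_support_grid (hR (u k) (hu k)) (hδ k) (θ k))
  set ball := (Metric.closedBall (0 : LatticeIndex Φ.fiber → ℝ) (R + 1)).indicator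
    (fun _ => (1 : ℝ)) with hball
  have hb1 : ∀ᶠ k in atTop, ∀ c, ‖Φ.fiberIndicator (u k) (gridFloor (δ k) (θ k) c)‖ ≤ ball c := by
    filter_upwards [hδ0.eventually (gt_mem_nhds one_pos)] with k hk c
    exact norm_comp_gridFloor_le (Φ.abs_fiberIndicator_le (u k)) (hR (u k) (hu k)) (hδ k) hk.le _ c
  have hb2 : ∀ k c, ‖Φ.fiberIndicator (u k) c‖ ≤ ball c := fun k c =>
    Φ.norm_fiberIndicator_le (fun c hc => (hR (u k) (hu k) c hc).trans (by linarith)) c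
  have hint := integrable_indicator_closedBall (κ := LatticeIndex Φ.fiber) 1 (R + 1)
  have hu₀P : u₀ ∈ stdPolytope A b :=
    (isClosed_stdPolytope A b).mem_of_tendsto hu₀ (Eventually.of_forall hu)
  have key : Tendsto (fun k => ∫ c, (Φ.fiberIndicator (u k) (gridFloor (δ k) (θ k) c) -
      Φ.fiberIndicator (u k) c)) atTop (𝓝 (∫ _ : LatticeIndex Φ.fiber → ℝ, (0 : ℝ))) := by
    refine tendsto_integral_filter_of_dominated_convergence (fun c => ball c + ball c) ?_ ?_
      (hint.add hint) ?_
    · exact Eventually.of_forall fun k =>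
        ((hmeas k).sub (Φ.measurable_fiberIndicator _)).aestronglyMeasurable
    · filter_upwards [hb1] with k hk
      exact Eventually.of_forall fun c => (norm_sub_le _ _).trans (add_le_add (hk c) (hb2 k c))
    · filter_upwards [Φ.ae_point_ne_zero u₀] with c hc
      have hev : ∀ j, ∀ᶠ k in atTop, (0 ≤ Φ.point (u k) (gridFloor (δ k) (θ k) c) j ↔
          0 ≤ Φ.point (u k) c j) := by
        intro j
        -- A coordinate that is constant along fibres has the same value at c and at its grid
        -- corner, whatever its sign. So the difference tends to zero at every limit point u₀, even
        -- where the fibre volume is discontinuous.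
        rcases hc j with h | h
        · refine Eventually.of_forall fun k => ?_
          rw [point, point, Pi.add_apply, Pi.add_apply, h, h]
        · filter_upwards [eventually_nonneg_iff
            (Φ.tendsto_point hu₀ (tendsto_gridFloor hδ hδ0 θ c) j) h,
            eventually_nonneg_iff (Φ.tendsto_point hu₀ tendsto_const_nhds j) h] with k h1 h2
          rw [h1, h2]
      refine (tendsto_const_nhds (x := (0 : ℝ))).congr' ?_
      filter_upwards [eventually_all.mpr hev] with k hk
      rw [Φ.fiberIndicator_congr hk, sub_self]
  rw [integral_zero] at key
  refine key.congr' ?_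
  filter_upwards [hb1] with k hk
  rw [integral_sub, fiberVolume]
  · exact hint.mono' (hmeas k).aestronglyMeasurable (Eventually.of_forall hk)
  · exact hint.mono' (Φ.measurable_fiberIndicator _).aestronglyMeasurable
      (Eventually.of_forall (hb2 k))

end LiftFrame

end

end WeightLifting

namespace WeightLifting

noncomputable section

/-! ### Integer solvability and residue classes. -/

section Residues

variable {ι : Type*}

lemma residue_eq_iff {N : ℕ} {x y : ι → ℤ} :
    residue N x = residue N y ↔ ∀ i, (N : ℤ) ∣ x i - y i := by
  simp only [residue, funext_iff, eq_comm (a := ((x _ : ℤ) : ZMod N)),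
    ZMod.intCast_eq_intCast_iff_dvd_sub]

lemma exists_eq_add_smul_of_residue_eq {N : ℕ} {x y : ι → ℤ} (h : residue N x = residue N y) :
    ∃ u : ι → ℤ, x = y + (N : ℤ) • u := by
  choose u hu using residue_eq_iff.mp h
  refine ⟨u, funext fun i => ?_⟩
  have := hu i
  simp only [Pi.add_apply, Pi.smul_apply, smul_eq_mul]
  linarith

end Residues

section Classes

variable {ρ ι μ : Type*} [Fintype ι] [Fintype μ]

/-- The integer parameters `x` for which `C y = D x` has an integer solution `y` that vanishes
where `y₀` does. -/
def integerParams (C : Matrix ρ μ ℤ) (D : Matrix ρ ι ℤ) (y₀ : μ → ℝ) : Submodule ℤ (ι → ℤ) :=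
  ((vanishing ℤ y₀).map C.mulVecLin).comap D.mulVecLin

lemma mem_integerParams {C : Matrix ρ μ ℤ} {D : Matrix ρ ι ℤ} {y₀ : μ → ℝ} {x : ι → ℤ} :
    x ∈ integerParams C D y₀ ↔ ∃ y ∈ vanishing ℤ y₀, C.mulVec y = D.mulVec x := Iff.rfl

/-- The integer vectors in the space of parameters. -/
def realParams (C : Matrix ρ μ ℤ) (D : Matrix ρ ι ℤ) (y₀ : μ → ℝ) : Submodule ℤ (ι → ℤ) where
  carrier := {x | intVec x ∈ paramSpace C D y₀}
  zero_mem' := by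
    rw [mem_ofPred_eq, intVec_zero]
    exact Submodule.zero_mem _
  add_mem' := by
    intro x y hx hy
    rw [mem_ofPred_eq, intVec_add]
    exact Submodule.add_mem _ hx hy
  smul_mem' := by
    intro k x hx
    rw [mem_ofPred_eq, intVec_smul]
    exact Submodule.smul_mem _ _ hx

lemma mem_realParams {C : Matrix ρ μ ℤ} {D : Matrix ρ ι ℤ} {y₀ : μ → ℝ} {x : ι → ℤ} :
    x ∈ realParams C D y₀ ↔ intVec x ∈ paramSpace C D y₀ := Iff.rfl

lemma integerParams_le_realParams (C : Matrix ρ μ ℤ) (D : Matrix ρ ι ℤ) (y₀ : μ → ℝ) :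
    integerParams C D y₀ ≤ realParams C D y₀ := by
  rintro x hx
  obtain ⟨y, hy, hyx⟩ := mem_integerParams.mp hx
  refine mem_paramSpace.mpr ⟨intVec y, fun j hj => ?_, ?_⟩
  · rw [intVec_apply, hy j hj, Int.cast_zero]
  · rw [realMap_intVec, realMap_intVec, hyx]

/-- A fixed multiple of each integer parameter has an integer solution. -/
lemma exists_smul_mem_integerParams (C : Matrix ρ μ ℤ) (D : Matrix ρ ι ℤ) (y₀ : μ → ℝ) :
    ∃ N : ℕ, 0 < N ∧ ∀ x ∈ realParams C D y₀, (N : ℤ) • x ∈ integerParams C D y₀ := by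
  have h1 : ∀ x ∈ realParams C D y₀, ∃ N : ℕ, 0 < N ∧ (N : ℤ) • x ∈ integerParams C D y₀ := by
    intro x hx
    obtain ⟨y, hy, hyx⟩ := mem_paramSpace.mp hx
    rw [realMap_intVec] at hyx
    obtain ⟨N, hN, z, hz, hz0⟩ := exists_integer_multiple_solution hyx
    refine ⟨N, hN, mem_integerParams.mpr ⟨z, fun j hj => hz0 j (hy j hj), ?_⟩⟩
    rw [hz, Matrix.mulVec_smul]
  -- Finitely many generators suffice, so the product of their multipliers works for all parameters
  -- at once.
  obtain ⟨S, hS⟩ := IsNoetherian.noetherian (realParams C D y₀)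
  have hmem : ∀ x : S, (x : ι → ℤ) ∈ realParams C D y₀ := fun x => by
    rw [← hS]
    exact Submodule.subset_span x.2
  choose N hN hNx using fun x : S => h1 x (hmem x)
  refine ⟨∏ x, N x, Finset.prod_pos fun x _ => hN x, ?_⟩
  have hle : realParams C D y₀ ≤
      (integerParams C D y₀).comap (LinearMap.lsmul ℤ (ι → ℤ) ((∏ x, N x : ℕ) : ℤ)) := by
    rw [← hS, Submodule.span_le]
    intro x hx
    obtain ⟨k, hk⟩ := Finset.dvd_prod_of_mem N (Finset.mem_univ (⟨x, hx⟩ : S))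
    rw [SetLike.mem_coe, Submodule.mem_comap, LinearMap.lsmul_apply, hk, Nat.cast_mul, mul_comm,
      mul_smul]
    exact Submodule.smul_mem _ _ (hNx ⟨x, hx⟩)
  exact fun x hx => hle hx

end Classes

/-! ### The fibre volume as a leading part of the weight. -/

namespace LiftFrame

variable {σ ρ ι μ : Type*} [Fintype ι] [Fintype μ] {A : Matrix σ ι ℤ} {b : σ → ℤ}
  {C : Matrix ρ μ ℤ} {D : Matrix ρ ι ℤ} (Φ : LiftFrame A b C D)

lemma eq_zero_of_mem_smul {t : ℕ} (ht : 1 ≤ t) {x : ι → ℝ}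
    (hx : x ∈ (t : ℝ) • stdPolytope A b) {y : μ → ℝ} (hy : y ∈ paramPolytope C D x) {j : μ}
    (hj : Φ.top j = 0) : y j = 0 := by
  have ht0 : (t : ℝ) ≠ 0 := by positivity
  have hmem : (t : ℝ)⁻¹ • y ∈ paramPolytope C D ((t : ℝ)⁻¹ • x) := by
    refine ⟨?_, fun i => mul_nonneg (by positivity) (hy.2 i)⟩
    change realMap C _ = realMap D _
    rw [map_smul, map_smul]
    exact congrArg _ hy.1
  have := Φ.maximal j hj _ ((Set.mem_smul_set_iff_inv_smul_mem₀ ht0 _ _).mp hx) _ hmem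
  simpa [ht0] using this

lemma mem_realParams_of_mem_smul {t : ℕ} (ht : 1 ≤ t) {x : ι → ℤ}
    (hx : x ∈ latticePoints ((t : ℝ) • stdPolytope A b)) : x ∈ realParams C D Φ.top := by
  have ht0 : (t : ℝ) ≠ 0 := by positivity
  have := Φ.mem_paramSpace _ ((Set.mem_smul_set_iff_inv_smul_mem₀ ht0 _ _).mp hx)
  exact ((paramSpace C D Φ.top).smul_mem_iff (inv_ne_zero ht0)).mp this

lemma weight_eq_zero {t : ℕ} (ht : 1 ≤ t) {x : ι → ℤ}
    (hx : x ∈ latticePoints ((t : ℝ) • stdPolytope A b))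
    (hint : x ∉ integerParams C D Φ.top) : weight C D x = 0 := by
  have : latticePoints (paramPolytope C D (intVec x)) = ∅ := by
    rw [Set.eq_empty_iff_forall_notMem]
    intro y hy
    refine hint (mem_integerParams.mpr ⟨y, fun j hj => ?_, ?_⟩)
    · have := Φ.eq_zero_of_mem_smul ht hx hy hj
      rw [intVec_apply] at this
      exact_mod_cast this
    · rw [mem_latticePoints, mem_paramPolytope, realMap_intVec, realMap_intVec,
        intVec_injective.eq_iff] at hy
      exact hy.1
  rw [weight, latticeCount, this, Set.ncard_empty]

/-- The weight is a lattice point count in the coordinates of the fibre. -/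
lemma weight_eq_finsum {t : ℕ} (ht : 1 ≤ t) {x : ι → ℤ}
    (hx : x ∈ latticePoints ((t : ℝ) • stdPolytope A b))
    (hint : x ∈ integerParams C D Φ.top) :
    ∃ θ, (weight C D x : ℝ) = ∑ᶠ c, Φ.fiberIndicator ((t : ℝ)⁻¹ • intVec x)
      (θ + (t : ℝ)⁻¹ • intVec c) := by
  classical
  obtain ⟨y, hy, hyx⟩ := mem_integerParams.mp hint
  have hxs := integerParams_le_realParams C D Φ.top hint
  obtain ⟨h1, h2⟩ := Φ.sec_spec _ hxs
  have hmem : intVec y - Φ.sec (intVec x) ∈ facialKernel C Φ.top := by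
    refine ⟨?_, fun j hj => ?_⟩
    · rw [map_sub, h2, realMap_intVec, realMap_intVec, hyx, sub_self]
    · rw [Pi.sub_apply, h1 j hj, intVec_apply, hy j hj, Int.cast_zero, sub_zero]
  rw [← Φ.range_latticeMap_fiber] at hmem
  -- The offset of an integer solution from the linear one. It varies with x without control, so the
  -- grids must be allowed arbitrary shifts.
  obtain ⟨θ, hθ⟩ := hmem
  have ht0 : (0 : ℝ) < (t : ℝ)⁻¹ := by positivity
  refine ⟨(t : ℝ)⁻¹ • θ, ?_⟩
  have hpoint : ∀ c, Φ.point (intVec x) (θ + intVec c) = intVec (y + latticeVec Φ.fiber c) := by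
    intro c
    rw [point, map_add, hθ, latticeMap_intVec, intVec_add]
    abel
  have hset : latticePoints (paramPolytope C D (intVec x)) =
      (fun c => y + latticeVec Φ.fiber c) '' {c | ∀ j, 0 ≤ Φ.point (intVec x) (θ + intVec c) j} := by
    ext z
    constructor
    · intro hz
      have hz' : intVec (z - y) ∈ vectorSpan ℝ Φ.fiber := by
        rw [Φ.vectorSpan_fiber, intVec_sub]
        refine ⟨?_, fun j hj => ?_⟩
        · rw [map_sub, realMap_intVec C y, hyx, ← realMap_intVec D x, sub_eq_zero]
          exact hz.1
        · rw [Pi.sub_apply, Φ.eq_zero_of_mem_smul ht hx hz hj, intVec_apply, hy j hj,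
            Int.cast_zero, sub_zero]
      obtain ⟨c, hc⟩ := exists_latticeVec_eq hz'
      have hzc : y + latticeVec Φ.fiber c = z := by rw [hc, add_sub_cancel]
      refine ⟨c, ?_, hzc⟩
      rw [mem_ofPred_eq, hpoint, hzc]
      exact hz.2
    · rintro ⟨c, hc, rfl⟩
      rw [mem_ofPred_eq] at hc
      rw [mem_latticePoints, mem_paramPolytope, ← hpoint]
      exact ⟨Φ.realMap_point hxs _, hc⟩
  have hinj : Function.Injective (fun c => y + latticeVec Φ.fiber c) :=
    (add_right_injective y).comp (latticeVec_injective Φ.fiber)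
  have hind : ∀ c, Φ.fiberIndicator ((t : ℝ)⁻¹ • intVec x) ((t : ℝ)⁻¹ • θ + (t : ℝ)⁻¹ • intVec c) =
      {c | ∀ j, 0 ≤ Φ.point (intVec x) (θ + intVec c) j}.indicator (fun _ => (1 : ℝ)) c := by
    intro c
    rw [← smul_add, Φ.fiberIndicator_smul ht0, fiberIndicator, indicator_apply]
    rfl
  simp only [hind]
  rw [← finsum_mem_def, weight, latticeCount, hset, Set.ncard_image_of_injective _ hinj]
  -- For an infinite set both `ncard` and `finsum` are zero, so the identity needs no boundedness.
  by_cases hfin : {c | ∀ j, 0 ≤ Φ.point (intVec x) (θ + intVec c) j}.Finite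
  · rw [finsum_mem_eq_finite_toFinset_sum _ hfin, Set.ncard_eq_toFinset_card _ hfin]
    simp
  · rw [Set.Infinite.ncard hfin, finsum_mem_eq_zero_of_infinite]
    · simp
    · rw [Function.support_const one_ne_zero, inter_univ]
      exact hfin

open Classical in
/-- The weight has a homogeneous leading part: the volume of the fibres, on the classes of those
parameters whose fibres span integer points. -/
theorem exists_isLeadingPart [Fintype ρ] (hP : Bornology.IsBounded (stdPolytope A b))
    (hQ : ∀ x : ι → ℝ, Bornology.IsBounded (paramPolytope C D x)) :
    ∃ (N : ℕ) (g : (ι → ZMod N) → (ι → ℝ) → ℝ),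
      IsLeadingPart (stdPolytope A b) (weight C D) (affDim Φ.fiber) N g := by
  obtain ⟨N, hN, hNx⟩ := exists_smul_mem_integerParams C D Φ.top
  obtain ⟨R, hR⟩ := Φ.exists_norm_le_of_fiberIndicator_ne_zero hP hQ
  refine ⟨N, fun r x => if ∃ x' ∈ integerParams C D Φ.top, residue N x' = r then
    Φ.fiberVolume x else 0, hN, fun r x _ t ht => ?_, ?_, fun r => ?_, fun ε hε => ?_⟩
  · split_ifs
    · exact Φ.fiberVolume_smul ht x
    · rw [mul_zero]
  · refine ⟨∫ c, (Metric.closedBall (0 : LatticeIndex Φ.fiber → ℝ) R).indicator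
      (fun _ => (1 : ℝ)) c, fun r x hx => ?_⟩
    have := Φ.abs_fiberVolume_le (hR x hx)
    split_ifs
    · exact this
    · rw [abs_zero]
      exact (abs_nonneg _).trans this
  · split_ifs
    · exact Φ.ae_continuousWithinAt_fiberVolume hP hQ
    · exact Eventually.of_forall fun x => continuousWithinAt_const
  -- Uniformity by contradiction: a sequence of bad points, divided by t, has a convergent
  -- subsequence in the compact P.
  · by_contra hcon
    push Not at hcon
    choose t ht x hx hbad using fun k : ℕ => hcon (k + 1)
    have ht1 : ∀ k, 1 ≤ t k := fun k => le_trans (by omega) (ht k)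
    have ht0 : ∀ k, (0 : ℝ) < t k := fun k => by exact_mod_cast ht1 k
    -- Congruent points differ by N v with v a real parameter, and N v is an integer parameter by
    -- the choice of N. So integer solvability depends on the class only.
    have hclass : ∀ k, (∃ x' ∈ integerParams C D Φ.top, residue N x' = residue N (x k)) ↔
        x k ∈ integerParams C D Φ.top := by
      intro k
      refine ⟨fun ⟨x', hx', hres⟩ => ?_, fun h => ⟨_, h, rfl⟩⟩
      obtain ⟨v, hv⟩ := exists_eq_add_smul_of_residue_eq hres.symm
      rw [hv]
      refine Submodule.add_mem _ hx' (hNx v ?_)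
      have h1 := Submodule.sub_mem _ (Φ.mem_realParams_of_mem_smul (ht1 k) (hx k))
        (integerParams_le_realParams C D Φ.top hx')
      rw [hv, add_sub_cancel_left, mem_realParams, intVec_smul] at h1
      exact ((paramSpace C D Φ.top).smul_mem_iff (by exact_mod_cast hN.ne')).mp h1
    have hint : ∀ k, x k ∈ integerParams C D Φ.top := by
      intro k
      by_contra hnot
      have h1 := hbad k
      rw [if_neg (by rw [hclass]; exact hnot), Φ.weight_eq_zero (ht1 k) (hx k) hnot] at h1
      simp only [Nat.cast_zero, sub_zero, abs_zero] at h1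
      exact absurd h1 (not_lt.mpr (mul_nonneg hε.le (pow_nonneg (ht0 k).le _)))
    choose θ hθ using fun k => Φ.weight_eq_finsum (ht1 k) (hx k) (hint k)
    set u : ℕ → ι → ℝ := fun k => (t k : ℝ)⁻¹ • intVec (x k) with hu
    have huP : ∀ k, u k ∈ stdPolytope A b := fun k =>
      (Set.mem_smul_set_iff_inv_smul_mem₀ (ht0 k).ne' _ _).mp (hx k)
    obtain ⟨u₀, _, φ, hφ, hφu⟩ := (isCompact_stdPolytope hP).tendsto_subseq huP
    have httop : Tendsto t atTop atTop :=
      tendsto_atTop_mono (fun k => (Nat.le_succ k).trans (ht k)) tendsto_id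
    have hδ0 : Tendsto (fun k => (t (φ k) : ℝ)⁻¹) atTop (𝓝 0) :=
      tendsto_inv_atTop_zero.comp
        (tendsto_natCast_atTop_atTop.comp (httop.comp hφ.tendsto_atTop))
    have key := Φ.tendsto_integral_fiberIndicator_sub hP hQ (fun k => huP (φ k)) hφu
      (fun k => inv_pos.mpr (ht0 (φ k))) hδ0 (fun k => θ (φ k))
    obtain ⟨k, hk⟩ := (Metric.tendsto_nhds.mp key ε hε).exists
    -- The integral of the sampled indicator is exactly the weight divided by t^M.
    rw [Real.dist_eq, sub_zero, integral_comp_gridFloor (inv_pos.mpr (ht0 (φ k))) _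
      (finite_support_grid (hR _ (huP (φ k))) (inv_pos.mpr (ht0 (φ k))) _), ← hθ,
      card_latticeIndex Φ.rationalDirection_fiber] at hk
    have h1 := hbad (φ k)
    have hxu : intVec (x (φ k)) = (t (φ k) : ℝ) • u (φ k) := by
      rw [hu, smul_inv_smul₀ (ht0 (φ k)).ne']
    rw [if_pos ((hclass _).mpr (hint _)), hxu, Φ.fiberVolume_smul (ht0 (φ k))] at h1
    have hpow : (0 : ℝ) < (t (φ k) : ℝ) ^ affDim Φ.fiber := pow_pos (ht0 _) _
    have h2 : (weight C D (x (φ k)) : ℝ) -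
        (t (φ k) : ℝ) ^ affDim Φ.fiber * Φ.fiberVolume (u (φ k)) =
        (t (φ k) : ℝ) ^ affDim Φ.fiber * ((t (φ k) : ℝ)⁻¹ ^ affDim Φ.fiber *
          (weight C D (x (φ k)) : ℝ) - Φ.fiberVolume (u (φ k))) := by
      rw [mul_sub, ← mul_assoc, ← mul_pow, mul_inv_cancel₀ (ht0 _).ne', one_pow, one_mul]
    rw [h2, abs_mul, abs_of_pos hpow, mul_comm ε] at h1
    exact absurd hk (not_lt.mpr (lt_of_mul_lt_mul_left h1 hpow.le).le)

end LiftFrame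

end

end WeightLifting

namespace WeightLifting

noncomputable section

/-! ### Weighted sums over dilates and the mean of integrals. -/

section QuasiIntegral

variable {ι : Type*} [Fintype ι] {S : Set (ι → ℝ)} {N : ℕ}

open Classical in
-- Each class that occurs is a grid of mesh N / t, whence the factor N^(-dim). The set of classes is
-- assumed constant along the sequence; the dilates are chosen later to ensure this.
lemma tendsto_sum_residue (hS : S.Nonempty) (hcomp : IsCompact S)
    (hconv : Convex ℝ S) (hrat : RationalDirection S) (hN : 1 ≤ N)
    {g : (ι → ZMod N) → (ι → ℝ) → ℝ} {B : ℝ} (hB : ∀ r, ∀ x ∈ S, |g r x| ≤ B)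
    (hg : ∀ r, ∀ᵐ x ∂(latticeMeasure S).restrict S, ContinuousWithinAt (g r) S x)
    {t : ℕ → ℕ} (ht : ∀ k, 1 ≤ t k) (ht' : Tendsto t atTop atTop) {I : Finset (ι → ZMod N)}
    (hI : ∀ k, residue N '' affLattice S (t k) = I)
    (hfin : ∀ k, (latticePoints ((t k : ℝ) • S)).Finite) :
    Tendsto (fun k => (∑ z ∈ (hfin k).toFinset, g (residue N z) ((t k : ℝ)⁻¹ • intVec z)) /
      (t k : ℝ) ^ affDim S) atTop
      (𝓝 ((∑ r ∈ I, ∫ x in S, g r x ∂(latticeMeasure S)) / (N : ℝ) ^ affDim S)) := by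
  have hNpow : (N : ℝ) ^ affDim S ≠ 0 := by positivity
  have h1 : ∀ r ∈ I, Tendsto (fun k => (∑ z ∈ (hfin k).toFinset with residue N z = r,
      g r ((t k : ℝ)⁻¹ • intVec z)) / (t k : ℝ) ^ affDim S) atTop
      (𝓝 ((∫ x in S, g r x ∂(latticeMeasure S)) / (N : ℝ) ^ affDim S)) := by
    intro r hr
    have hx : ∀ k, ∃ x ∈ affLattice S (t k), residue N x = r := fun k => by
      have : r ∈ residue N '' affLattice S (t k) := by
        rw [hI k]
        exact hr
      exact this
    choose x hx hxr using hx
    have h2 := (tendsto_congruent_sum hS hcomp hconv hrat (hB r) (hg r) hN ht ht' hx).div_const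
      ((N : ℝ) ^ affDim S)
    refine h2.congr fun k => ?_
    have hset : {z ∈ latticePoints ((t k : ℝ) • S) | ∀ i, (N : ℤ) ∣ z i - x k i} =
        ((hfin k).toFinset.filter fun z => residue N z = r : Finset (ι → ℤ)) := by
      ext z
      simp only [Finset.coe_filter, Set.Finite.mem_toFinset, mem_ofPred_eq, ← hxr k,
        residue_eq_iff]
    rw [hset, finsum_mem_coe_finset, div_pow]
    have := ht k
    field_simp
  have h3 := tendsto_finsetSum I h1
  rw [← Finset.sum_div] at h3
  refine h3.congr fun k => ?_
  rw [← Finset.sum_div]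
  congr 1
  rw [← Finset.sum_fiberwise_of_maps_to (s := (hfin k).toFinset) (t := I) (g := residue N)]
  · refine Finset.sum_congr rfl fun r _ => Finset.sum_congr rfl fun z hz => ?_
    rw [(Finset.mem_filter.mp hz).2]
  · intro z hz
    rw [← Finset.mem_coe, ← hI k]
    exact ⟨z, latticePoints_subset_affLattice S _ ((Set.Finite.mem_toFinset _).mp hz), rfl⟩

lemma tendsto_card_latticePoints (hS : S.Nonempty) (hcomp : IsCompact S)
    (hconv : Convex ℝ S) (hrat : RationalDirection S)
    {t : ℕ → ℕ} (ht : ∀ k, 1 ≤ t k) (ht' : Tendsto t atTop atTop)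
    (hne : ∀ k, (affLattice S (t k)).Nonempty)
    (hfin : ∀ k, (latticePoints ((t k : ℝ) • S)).Finite) :
    Tendsto (fun k => ((hfin k).toFinset.card : ℝ) / (t k : ℝ) ^ affDim S) atTop
      (𝓝 (normVol S)) := by
  refine (tendsto_latticeCount hS hcomp hconv hrat ht ht' hne).congr fun k => ?_
  rw [latticeCount, Set.ncard_eq_toFinset_card _ (hfin k)]

/-- The classes modulo `N` in the affine hull of a dilate are equidistributed, so that they are
`N ^ dim S` in number. -/
lemma card_residues (hS : S.Nonempty) (hcomp : IsCompact S)
    (hconv : Convex ℝ S) (hrat : RationalDirection S) (hvol : 0 < normVol S) (hN : 1 ≤ N)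
    {t : ℕ → ℕ} (ht : ∀ k, 1 ≤ t k) (ht' : Tendsto t atTop atTop) {I : Finset (ι → ZMod N)}
    (hI : ∀ k, residue N '' affLattice S (t k) = I)
    (hne : ∀ k, (affLattice S (t k)).Nonempty) : (I.card : ℝ) = (N : ℝ) ^ affDim S := by
  have hfin : ∀ k, (latticePoints ((t k : ℝ) • S)).Finite := fun k =>
    finite_latticePoints (hcomp.smul (t k : ℝ)).isBounded
  -- Counting all points with weight 1, by classes and at once, gives |I| · vol / N^dim = vol.
  have h1 := tendsto_sum_residue hS hcomp hconv hrat hN (g := fun _ _ => 1) (B := 1) (by simp)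
    (fun r => Eventually.of_forall fun x => continuousWithinAt_const) ht ht' hI hfin
  have h2 := tendsto_card_latticePoints hS hcomp hconv hrat ht ht' hne hfin
  simp only [Finset.sum_const, nsmul_eq_mul, mul_one, ← normVol_eq_setIntegral] at h1
  have h3 := tendsto_nhds_unique h1 h2
  have hNpow : (N : ℝ) ^ affDim S ≠ 0 := by positivity
  rw [div_eq_iff hNpow, mul_comm] at h3
  exact mul_left_cancel₀ hvol.ne' h3

/-- Weighted sums over dilates grow like the integral of the leading part of the weight. -/
theorem tendsto_weightedSum_of_residues (hS : S.Nonempty) (hcomp : IsCompact S)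
    (hconv : Convex ℝ S) (hrat : RationalDirection S) (hvol : 0 < normVol S)
    {w : (ι → ℤ) → ℕ} {M : ℕ} {g : (ι → ZMod N) → (ι → ℝ) → ℝ} (hg : IsLeadingPart S w M N g)
    {t : ℕ → ℕ} (ht : ∀ k, 1 ≤ t k) (ht' : Tendsto t atTop atTop) {I : Finset (ι → ZMod N)}
    (hI : ∀ k, residue N '' affLattice S (t k) = I)
    (hne : ∀ k, (affLattice S (t k)).Nonempty) :
    Tendsto (fun k => (weightedSum S w (t k) : ℝ) / (t k : ℝ) ^ (affDim S + M)) atTop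
      (𝓝 ((∑ r ∈ I, ∫ x in S, g r x ∂(latticeMeasure S)) / (I.card : ℝ))) := by
  have hN : 1 ≤ N := hg.period_pos
  have hfin : ∀ k, (latticePoints ((t k : ℝ) • S)).Finite := fun k =>
    finite_latticePoints (hcomp.smul (t k : ℝ)).isBounded
  have ht0 : ∀ k, (0 : ℝ) < t k := fun k => by exact_mod_cast ht k
  obtain ⟨B, hB⟩ := hg.bounded
  have h1 := tendsto_sum_residue hS hcomp hconv hrat hN hB hg.ae_continuous ht ht' hI hfin
  have h2 := tendsto_card_latticePoints hS hcomp hconv hrat ht ht' hne hfin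
  rw [card_residues hS hcomp hconv hrat hvol hN ht ht' hI hne]
  have hhom : ∀ k, ∀ z ∈ (hfin k).toFinset, g (residue N z) (intVec z) =
      (t k : ℝ) ^ M * g (residue N z) ((t k : ℝ)⁻¹ • intVec z) := by
    intro k z hz
    have hzS : z ∈ latticePoints ((t k : ℝ) • S) := (hfin k).mem_toFinset.mp hz
    have hz' : (t k : ℝ)⁻¹ • intVec z ∈ S :=
      (Set.mem_smul_set_iff_inv_smul_mem₀ (ht0 k).ne' _ _).mp hzS
    rw [← hg.homogeneous _ _ hz' _ (ht0 k), smul_inv_smul₀ (ht0 k).ne']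
  have herr : Tendsto (fun k => (weightedSum S w (t k) : ℝ) / (t k : ℝ) ^ (affDim S + M) -
      (∑ z ∈ (hfin k).toFinset, g (residue N z) ((t k : ℝ)⁻¹ • intVec z)) /
        (t k : ℝ) ^ affDim S) atTop (𝓝 0) := by
    rw [Metric.tendsto_nhds]
    intro ε hε
    -- Eventually there are fewer than (vol + 1) t^dim points, so this tolerance keeps the total
    -- error below ε t^(dim + M).
    obtain ⟨T, hT⟩ := hg.approx (ε / (normVol S + 1)) (by positivity)
    filter_upwards [ht'.eventually_ge_atTop T, h2.eventually (gt_mem_nhds (lt_add_one _))]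
      with k hk hcard
    have hpowd : (0 : ℝ) < (t k : ℝ) ^ affDim S := pow_pos (ht0 k) _
    have hpowM : (0 : ℝ) < (t k : ℝ) ^ M := pow_pos (ht0 k) _
    rw [div_lt_iff₀ hpowd] at hcard
    have hsum : (weightedSum S w (t k) : ℝ) = ∑ z ∈ (hfin k).toFinset, (w z : ℝ) := by
      rw [weightedSum, finsum_mem_eq_finite_toFinset_sum _ (hfin k), Nat.cast_sum]
    have hdiff : (weightedSum S w (t k) : ℝ) / (t k : ℝ) ^ (affDim S + M) -
        (∑ z ∈ (hfin k).toFinset, g (residue N z) ((t k : ℝ)⁻¹ • intVec z)) /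
          (t k : ℝ) ^ affDim S =
        (∑ z ∈ (hfin k).toFinset, ((w z : ℝ) - g (residue N z) (intVec z))) /
          (t k : ℝ) ^ (affDim S + M) := by
      rw [Finset.sum_sub_distrib, ← hsum, Finset.sum_congr rfl (hhom k), ← Finset.mul_sum, sub_div,
        pow_add]
      congr 1
      field_simp
    rw [Real.dist_eq, sub_zero, hdiff, abs_div, abs_of_pos (pow_pos (ht0 k) _),
      div_lt_iff₀ (pow_pos (ht0 k) _)]
    have hle : |∑ z ∈ (hfin k).toFinset, ((w z : ℝ) - g (residue N z) (intVec z))| ≤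
        (hfin k).toFinset.card * (ε / (normVol S + 1) * (t k : ℝ) ^ M) := by
      refine (Finset.abs_sum_le_sum_abs _ _).trans ?_
      rw [← nsmul_eq_mul]
      exact Finset.sum_le_card_nsmul _ _ _ fun z hz =>
        hT (t k) hk z ((Set.Finite.mem_toFinset _).mp hz)
    refine hle.trans_lt ?_
    have hc : 0 < ε / (normVol S + 1) * (t k : ℝ) ^ M := by positivity
    calc _ < (normVol S + 1) * (t k : ℝ) ^ affDim S * (ε / (normVol S + 1) * (t k : ℝ) ^ M) :=
          mul_lt_mul_of_pos_right hcard hc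
      _ = ε * (t k : ℝ) ^ (affDim S + M) := by
          rw [pow_add]
          have : normVol S + 1 ≠ 0 := by positivity
          field_simp
  have := herr.add h1
  rw [zero_add] at this
  refine this.congr fun k => ?_
  ring

variable {σ : Type*} {A : Matrix σ ι ℤ} {b : σ → ℤ}

/-- Along suitable dilates, weighted sums grow like the quasi-integral of the leading part. -/
theorem exists_tendsto_quasiIntegral (hb : Bornology.IsBounded (stdPolytope A b))
    (hne : (stdPolytope A b).Nonempty) {w : (ι → ℤ) → ℕ} {M : ℕ}
    {g : (ι → ZMod N) → (ι → ℝ) → ℝ} (hg : IsLeadingPart (stdPolytope A b) w M N g)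
    {p : ℕ} (hp : 0 < p) {t₀ : ℕ} (ht₀ : 1 ≤ t₀) :
    ∃ m : ℕ → ℕ, Tendsto (fun k => t₀ + p * m k) atTop atTop ∧
      Tendsto (fun k => (weightedSum (stdPolytope A b) w (t₀ + p * m k) : ℝ) /
        ((t₀ + p * m k : ℕ) : ℝ) ^ (affDim (stdPolytope A b) + M)) atTop
        (𝓝 (quasiIntegral (stdPolytope A b) N g t₀)) := by
  obtain ⟨q, hq, z, hz⟩ := exists_translation hne
  have hN : 0 < N := hg.period_pos
  have : NeZero N := ⟨hN.ne'⟩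
  have hqN : 0 < q * N := Nat.mul_pos hq hN
  have ht : ∀ k, 1 ≤ t₀ + p * (q * N * k) := fun k => by omega
  have htop : Tendsto (fun k => t₀ + p * (q * N * k)) atTop atTop := by
    refine tendsto_atTop_mono (fun k => ?_) tendsto_id
    have := Nat.le_mul_of_pos_left k (Nat.mul_pos hp hqN)
    rw [id]
    calc k ≤ p * (q * N) * k := this
      _ = p * (q * N * k) := by ring
      _ ≤ _ := Nat.le_add_left _ _
  have hres : ∀ k, residue N '' affLattice (stdPolytope A b) (t₀ + p * (q * N * k)) =
      residue N '' affLattice (stdPolytope A b) t₀ := by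
    intro k
    have hshift : ∀ x : ι → ℤ, ∀ c : ℤ, residue N (x + (c * N) • z) = residue N x := by
      intro x c
      rw [residue_eq_iff]
      intro i
      exact ⟨c * z i, by simp only [Pi.add_apply, Pi.smul_apply, smul_eq_mul]; ring⟩
    ext r
    constructor
    · rintro ⟨x, hx, rfl⟩
      exact ⟨_, hz ((-(p * k : ℤ)) * N) _ t₀ (ht k) ht₀ (by push_cast; ring) x hx, hshift x _⟩
    · rintro ⟨x, hx, rfl⟩
      exact ⟨_, hz ((p * k : ℤ) * N) t₀ _ ht₀ (ht k) (by push_cast; ring) x hx, hshift x _⟩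
  -- The factor q relates the hulls by multiples of z, the factor N makes these multiples vanish
  -- modulo N, and p keeps the dilates in one class of the given period.
  refine ⟨fun k => q * N * k, htop, ?_⟩
  set I := (Set.toFinite (residue N '' affLattice (stdPolytope A b) t₀)).toFinset with hIdef
  have hI : ∀ k, residue N '' affLattice (stdPolytope A b) (t₀ + p * (q * N * k)) = I := fun k => by
    rw [hres, hIdef, Set.Finite.coe_toFinset]
  have hquasi : quasiIntegral (stdPolytope A b) N g t₀ =
      (∑ r ∈ I, ∫ x in stdPolytope A b, g r x ∂(latticeMeasure (stdPolytope A b))) /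
        (I.card : ℝ) := by
    rw [quasiIntegral, Set.ncard_eq_toFinset_card _ (Set.toFinite _),
      finsum_mem_eq_finite_toFinset_sum _ (Set.toFinite _)]
  rw [hquasi]
  by_cases hE : (affLattice (stdPolytope A b) t₀).Nonempty
  · refine tendsto_weightedSum_of_residues hne (isCompact_stdPolytope hb) (convex_stdPolytope A b)
      (rationalDirection_stdPolytope hne) (normVol_stdPolytope_pos hb hne) hg ht htop hI
      fun k => ?_
    rw [← Set.image_nonempty (f := residue N), hres]
    exact hE.image _
  -- If no class occurs, the dilates have no lattice points and the mean is 0 / 0 = 0.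
  · rw [Set.not_nonempty_iff_eq_empty] at hE
    have hIe : I = ∅ := by
      rw [← Finset.coe_eq_empty, ← hI 0, hres, hE, Set.image_empty]
    have hzero : ∀ k, weightedSum (stdPolytope A b) w (t₀ + p * (q * N * k)) = 0 := by
      intro k
      have h1 := hres k
      rw [hE, Set.image_empty, Set.image_eq_empty] at h1
      have : latticePoints (((t₀ + p * (q * N * k) : ℕ) : ℝ) • stdPolytope A b) = ∅ :=
        Set.subset_eq_empty (latticePoints_subset_affLattice _ _) h1
      rw [weightedSum, this, finsum_mem_empty]
    simp only [hzero, hIe]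
    simp

end QuasiIntegral

end

end WeightLifting

namespace WeightLifting

noncomputable section

/-! ### The integral of the weight and the volume of P*. -/

section Integration

variable {σ ρ ι μ : Type*} [Fintype ι] [Fintype μ] {A : Matrix σ ι ℤ}
  {b : σ → ℤ} {C : Matrix ρ μ ℤ} {D : Matrix ρ ι ℤ}

lemma smul_sumElim_zero (t : ℕ) (b : σ → ℤ) :
    (t : ℤ) • (Sum.elim b 0 : σ ⊕ ρ → ℤ) = Sum.elim ((t : ℤ) • b) 0 := by
  ext (i | i) <;> simp

lemma affLattice_nonempty_of_lift {t : ℕ}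
    (h : (affLattice (liftPolytope A b C D) t).Nonempty) :
    (affLattice (stdPolytope A b) t).Nonempty := by
  obtain ⟨z, hz⟩ := h
  refine ⟨z ∘ Sum.inl, ?_⟩
  set π : (ι ⊕ μ → ℝ) →ₗ[ℝ] (ι → ℝ) := LinearMap.funLeft ℝ ℝ Sum.inl with hπ
  have h1 : affineSpan ℝ ((t : ℝ) • liftPolytope A b C D) ≤
      (affineSpan ℝ ((t : ℝ) • stdPolytope A b)).comap π.toAffineMap := by
    rw [affineSpan_le]
    rintro _ ⟨v, hv, rfl⟩
    refine subset_affineSpan ℝ _ ?_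
    change π ((t : ℝ) • v) ∈ _
    rw [map_smul]
    exact Set.smul_mem_smul_set (mem_liftPolytope.mp hv).1
  exact h1 hz

variable [Fintype ρ]

lemma weightedSum_eq_of_smul_eq (hP : Bornology.IsBounded (stdPolytope A b))
    (hQ : ∀ x : ι → ℝ, Bornology.IsBounded (paramPolytope C D x)) {t : ℕ}
    (h1 : (t : ℝ) • stdPolytope A b = stdPolytope A ((t : ℤ) • b))
    (h2 : (t : ℝ) • liftPolytope A b C D =
      stdPolytope (liftMatrix A C D) ((t : ℤ) • Sum.elim b 0)) :
    weightedSum (stdPolytope A b) (weight C D) t =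
      latticeCount ((t : ℝ) • liftPolytope A b C D) := by
  have hb : Bornology.IsBounded (stdPolytope A ((t : ℤ) • b)) := by
    rw [← h1]
    exact hP.smul₀ _
  rw [weightedSum, h1, finsum_weight_eq_latticeCount hb hQ, h2, smul_sumElim_zero]
  rfl

/-- The weighted sums over the positive dilates. -/
lemma weightedSum_eq_latticeCount_of_pos (hP : Bornology.IsBounded (stdPolytope A b))
    (hQ : ∀ x : ι → ℝ, Bornology.IsBounded (paramPolytope C D x)) {t : ℕ} (ht : 1 ≤ t) :
    weightedSum (stdPolytope A b) (weight C D) t =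
      latticeCount ((t : ℝ) • liftPolytope A b C D) :=
  weightedSum_eq_of_smul_eq hP hQ (smul_stdPolytope_of_pos A b ht)
    (smul_stdPolytope_of_pos _ _ ht)

/-- The weighted sums over all dilates. -/
lemma weightedSum_eq_latticeCount (hP : Bornology.IsBounded (stdPolytope A b))
    (hQ : ∀ x : ι → ℝ, Bornology.IsBounded (paramPolytope C D x))
    (hne : (stdPolytope A b).Nonempty) (hne' : (liftPolytope A b C D).Nonempty) (t : ℕ) :
    weightedSum (stdPolytope A b) (weight C D) t =
      latticeCount ((t : ℝ) • liftPolytope A b C D) :=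
  weightedSum_eq_of_smul_eq hP hQ (smul_stdPolytope hP hne t)
    (smul_stdPolytope (isBounded_liftPolytope hP hQ) hne' t)

/-- Along a progression of step p the coefficients are constant, so f agrees with a polynomial whose
coefficient of degree d is E d t₀, and the limit must be that coefficient. -/
lemma IsQuasiPolynomial.leadingCoeff_eq {f : ℕ → ℝ} {d p : ℕ} {E : ℕ → ℕ → ℝ}
    (hE : IsQuasiPolynomial f d p E) {t₀ : ℕ} {m : ℕ → ℕ}
    (hm : Tendsto (fun k => t₀ + p * m k) atTop atTop) {v : ℝ}
    (hv : Tendsto (fun k => f (t₀ + p * m k) / ((t₀ + p * m k : ℕ) : ℝ) ^ d) atTop (𝓝 v)) :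
    v = E d t₀ := by
  obtain ⟨_, hper, hf⟩ := hE
  have hper' : ∀ j k, E j (t₀ + p * k) = E j t₀ := by
    intro j k
    induction k with
    | zero => simp
    | succ k ih => rw [Nat.mul_succ, ← add_assoc, hper, ih]
  set Q : Polynomial ℝ :=
    ∑ j ∈ Finset.range (d + 1), Polynomial.C (E j t₀) * Polynomial.X ^ j with hQ
  have hQf : ∀ k, f (t₀ + p * k) = Q.eval ((t₀ + p * k : ℕ) : ℝ) := by
    intro k
    rw [hf, hQ, Polynomial.eval_finsetSum]
    refine Finset.sum_congr rfl fun j _ => ?_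
    rw [hper']
    simp
  simp only [hQf] at hv
  rw [← (natDegree_le_and_coeff_eq_of_tendsto hm hv).2, hQ, Polynomial.finsetSum_coeff]
  simp only [Polynomial.coeff_C_mul, Polynomial.coeff_X_pow]
  rw [Finset.sum_eq_single d]
  · simp
  · intro j _ hj
    simp [hj.symm]
  · simp

lemma quasiIntegral_one {S : Set (ι → ℝ)} {t : ℕ} (hne : (affLattice S t).Nonempty)
    (f : (ι → ℝ) → ℝ) :
    quasiIntegral S 1 (fun _ => f) t = ∫ x in S, f x ∂(latticeMeasure S) := by
  have h : residue 1 '' affLattice S t = {0} :=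
    (Set.Nonempty.subset_singleton_iff (hne.image _)).mp fun x _ => Subsingleton.elim x 0
  rw [quasiIntegral, h, finsum_mem_singleton, Set.ncard_singleton, Nat.cast_one, div_one]

/-- Some dilate of a rational polytope has a lattice point in its affine hull. -/
lemma exists_affLattice_nonempty (hne : (stdPolytope A b).Nonempty) :
    ∃ t : ℕ, 1 ≤ t ∧ (affLattice (stdPolytope A b) t).Nonempty := by
  obtain ⟨x, hx, hmax⟩ := exists_maximal_support (convex_stdPolytope A b) hne fun x hx => hx.2
  obtain ⟨q, hq, z, hz, hz0⟩ := exists_integer_multiple_solution hx.1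
  exact ⟨q, hq, z, (mem_affLattice_stdPolytope hx hmax hq).mpr ⟨hz, hz0⟩⟩

variable [Fintype σ]

/-- The integral of a weight is the normalized volume of the weight lifting polytope. -/
theorem integrate_weight (hP : Bornology.IsBounded (stdPolytope A b))
    (hQ : ∀ x : ι → ℝ, Bornology.IsBounded (paramPolytope C D x))
    (hne : (stdPolytope A b).Nonempty)
    (haff : affineSpan ℝ {x ∈ stdPolytope A b | (paramPolytope C D x).Nonempty} =
      affineSpan ℝ (stdPolytope A b)) :
    ∃ M : ℕ, affDim (stdPolytope A b) + M = affDim (liftPolytope A b C D) ∧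
      (∀ t : ℕ, weightedSum (stdPolytope A b) (weight C D) t =
        latticeCount ((t : ℝ) • liftPolytope A b C D)) ∧
      0 < normVol (liftPolytope A b C D) ∧
      (∃ (N : ℕ) (g : (ι → ZMod N) → (ι → ℝ) → ℝ),
        IsLeadingPart (stdPolytope A b) (weight C D) M N g) ∧
      (∃ (p : ℕ) (E : ℕ → ℕ → ℝ),
        IsQuasiPolynomial (fun t => (weightedSum (stdPolytope A b) (weight C D) t : ℝ))
          (affDim (liftPolytope A b C D)) p E ∧
        IsQuasiPolynomial (fun t => (latticeCount ((t : ℝ) • liftPolytope A b C D) : ℝ))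
          (affDim (liftPolytope A b C D)) p E ∧
        (∀ t : ℕ, 1 ≤ t → (affLattice (liftPolytope A b C D) t).Nonempty →
          E (affDim (liftPolytope A b C D)) t = normVol (liftPolytope A b C D)) ∧
        (∀ t : ℕ, 1 ≤ t → ¬ (affLattice (liftPolytope A b C D) t).Nonempty →
          E (affDim (liftPolytope A b C D)) t = 0) ∧
        (∀ (N : ℕ) (g : (ι → ZMod N) → (ι → ℝ) → ℝ),
          IsLeadingPart (stdPolytope A b) (weight C D) M N g →
          ∀ t : ℕ, 1 ≤ t → quasiIntegral (stdPolytope A b) N g t =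
            E (affDim (liftPolytope A b C D)) t)) ∧
      (∀ f : (ι → ℝ) → ℝ,
        IsLeadingPart (stdPolytope A b) (weight C D) M 1 (fun _ => f) →
        ∫ x in stdPolytope A b, f x ∂(latticeMeasure (stdPolytope A b)) =
          normVol (liftPolytope A b C D)) := by
  obtain ⟨Φ⟩ := nonempty_liftFrame hne haff
  have hne' := nonempty_liftPolytope hne haff
  have hb' := isBounded_liftPolytope hP hQ
  have hsum := weightedSum_eq_latticeCount hP hQ hne hne'
  obtain ⟨p, E, hE, hE1, hE0⟩ : ∃ (p : ℕ) (E : ℕ → ℕ → ℝ),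
      IsQuasiPolynomial (fun t => (latticeCount ((t : ℝ) • liftPolytope A b C D) : ℝ))
        (affDim (liftPolytope A b C D)) p E ∧
      (∀ t : ℕ, 1 ≤ t → (affLattice (liftPolytope A b C D) t).Nonempty →
        E (affDim (liftPolytope A b C D)) t = normVol (liftPolytope A b C D)) ∧
      (∀ t : ℕ, 1 ≤ t → ¬ (affLattice (liftPolytope A b C D) t).Nonempty →
        E (affDim (liftPolytope A b C D)) t = 0) :=
    exists_ehrhart_quasiPolynomial hb' hne'
  have hE' : IsQuasiPolynomial (fun t => (weightedSum (stdPolytope A b) (weight C D) t : ℝ))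
      (affDim (liftPolytope A b C D)) p E := by
    simp only [hsum]
    exact hE
  have hquasi : ∀ (N : ℕ) (g : (ι → ZMod N) → (ι → ℝ) → ℝ),
      IsLeadingPart (stdPolytope A b) (weight C D) (affDim Φ.fiber) N g →
      ∀ t : ℕ, 1 ≤ t → quasiIntegral (stdPolytope A b) N g t =
        E (affDim (liftPolytope A b C D)) t := by
    intro N g hg t ht
    obtain ⟨m, hm, hv⟩ := exists_tendsto_quasiIntegral hP hne hg hE.1 ht
    rw [Φ.affDim_add] at hv
    exact hE'.leadingCoeff_eq hm hv
  refine ⟨affDim Φ.fiber, Φ.affDim_add, hsum, normVol_stdPolytope_pos hb' hne',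
    Φ.exists_isLeadingPart hP hQ, ⟨p, E, hE', hE, hE1, hE0, hquasi⟩, fun f hf => ?_⟩
  -- At a dilate whose lifted hull contains an integer point, the top coefficient is the volume, and
  -- for N = 1 the mean is the integral.
  obtain ⟨t, ht, htne⟩ := exists_affLattice_nonempty hne'
  rw [← quasiIntegral_one (affLattice_nonempty_of_lift htne) f, hquasi 1 _ hf t ht,
    hE1 t ht htne]

end Integration

end

end WeightLifting

namespace WeightLifting

noncomputable section

/-! ### Power sums and power means. -/

section PowerSums

variable {α : Type*} {F : Finset α} {a : α → ℝ} {m : ℝ}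

lemma le_powerSum_rpow (ha : ∀ x ∈ F, 0 ≤ a x) {x : α} (hx : x ∈ F) {k : ℕ} (hk : 1 ≤ k) :
    a x ≤ (∑ x ∈ F, a x ^ k) ^ ((1 : ℝ) / k) := by
  rw [one_div, ← Real.pow_rpow_inv_natCast (ha x hx) (by omega : k ≠ 0)]
  refine Real.rpow_le_rpow (pow_nonneg (ha x hx) _) ?_ (by positivity)
  exact Finset.single_le_sum (f := fun x => a x ^ k) (fun y hy => pow_nonneg (ha y hy) k) hx

lemma powerSum_rpow_le (ha : ∀ x ∈ F, 0 ≤ a x) (hm : ∀ x ∈ F, a x ≤ m) (hm0 : 0 ≤ m) {k : ℕ}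
    (hk : 1 ≤ k) : (∑ x ∈ F, a x ^ k) ^ ((1 : ℝ) / k) ≤ (F.card : ℝ) ^ ((1 : ℝ) / k) * m := by
  have h1 : ∑ x ∈ F, a x ^ k ≤ F.card * m ^ k := by
    rw [← nsmul_eq_mul]
    exact Finset.sum_le_card_nsmul _ _ _ fun x hx => pow_le_pow_left₀ (ha x hx) (hm x hx) k
  have h2 := Real.rpow_le_rpow (Finset.sum_nonneg fun x hx => pow_nonneg (ha x hx) k) h1
    (by positivity : (0 : ℝ) ≤ 1 / k)
  rwa [Real.mul_rpow (by positivity) (by positivity), one_div,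
    Real.pow_rpow_inv_natCast hm0 (by omega), ← one_div] at h2

/-- Each a x is at most U, the ℓ^k norm, so Σ a^l = Σ a^k a^(l-k) ≤ U^k U^(l-k). -/
lemma powerSum_antitone (ha : ∀ x ∈ F, 0 ≤ a x) {k l : ℕ} (hk : 1 ≤ k) (hkl : k ≤ l) :
    (∑ x ∈ F, a x ^ l) ^ ((1 : ℝ) / l) ≤ (∑ x ∈ F, a x ^ k) ^ ((1 : ℝ) / k) := by
  set U := (∑ x ∈ F, a x ^ k) ^ ((1 : ℝ) / k) with hU
  have hS0 : 0 ≤ ∑ x ∈ F, a x ^ k := Finset.sum_nonneg fun x hx => pow_nonneg (ha x hx) k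
  have hU0 : 0 ≤ U := Real.rpow_nonneg hS0 _
  have hUk : U ^ k = ∑ x ∈ F, a x ^ k := by
    rw [hU, one_div, Real.rpow_inv_natCast_pow hS0 (by omega)]
  have h1 : ∑ x ∈ F, a x ^ l ≤ U ^ l := by
    obtain ⟨j, rfl⟩ := Nat.exists_eq_add_of_le hkl
    rw [pow_add, hUk, Finset.sum_mul]
    refine Finset.sum_le_sum fun x hx => ?_
    rw [pow_add]
    exact mul_le_mul_of_nonneg_left
      (pow_le_pow_left₀ (ha x hx) (le_powerSum_rpow ha hx hk) j) (pow_nonneg (ha x hx) k)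
  have h2 := Real.rpow_le_rpow (Finset.sum_nonneg fun x hx => pow_nonneg (ha x hx) l) h1
    (by positivity : (0 : ℝ) ≤ 1 / l)
  rwa [one_div, Real.pow_rpow_inv_natCast hU0 (by omega), ← one_div] at h2

/-- Jensen's inequality for the convex power l / k ≥ 1 and the uniform mean. -/
lemma powerMean_monotone (hF : F.Nonempty) (ha : ∀ x ∈ F, 0 ≤ a x) {k l : ℕ} (hk : 1 ≤ k)
    (hkl : k ≤ l) : ((∑ x ∈ F, a x ^ k) / F.card) ^ ((1 : ℝ) / k) ≤
      ((∑ x ∈ F, a x ^ l) / F.card) ^ ((1 : ℝ) / l) := by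
  have hcard : (0 : ℝ) < F.card := by exact_mod_cast hF.card_pos
  have hk0 : (0 : ℝ) < k := by exact_mod_cast hk
  have hl0 : (0 : ℝ) < l := by exact_mod_cast hk.trans hkl
  have h1 := Real.rpow_arith_mean_le_arith_mean_rpow F (fun _ => (F.card : ℝ)⁻¹) (fun x => a x ^ k)
    (fun _ _ => by positivity) (by rw [Finset.sum_const, nsmul_eq_mul, mul_inv_cancel₀ hcard.ne'])
    (fun x hx => pow_nonneg (ha x hx) k) (p := (l : ℝ) / k)
    (by rw [le_div_iff₀ hk0, one_mul]; exact_mod_cast hkl)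
  rw [← Finset.mul_sum, ← Finset.mul_sum, inv_mul_eq_div, inv_mul_eq_div] at h1
  have h2 : ∑ x ∈ F, (a x ^ k) ^ ((l : ℝ) / k) = ∑ x ∈ F, a x ^ l := by
    refine Finset.sum_congr rfl fun x hx => ?_
    rw [← Real.rpow_natCast, ← Real.rpow_mul (ha x hx), mul_div_cancel₀ _ hk0.ne',
      Real.rpow_natCast]
  rw [h2] at h1
  have h0 : 0 ≤ (∑ x ∈ F, a x ^ k) / F.card :=
    div_nonneg (Finset.sum_nonneg fun x hx => pow_nonneg (ha x hx) k) hcard.le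
  have h3 := Real.rpow_le_rpow (Real.rpow_nonneg h0 _) h1 (by positivity : (0 : ℝ) ≤ 1 / l)
  rwa [← Real.rpow_mul h0, div_mul_div_cancel₀' hl0.ne'] at h3

lemma tendsto_const_rpow_one_div {c : ℝ} (hc : 0 < c) :
    Tendsto (fun k : ℕ => c ^ ((1 : ℝ) / k)) atTop (𝓝 1) := by
  have := (Real.continuousAt_const_rpow hc.ne' (b := 0)).tendsto.comp
    tendsto_one_div_atTop_nhds_zero_nat
  rwa [Real.rpow_zero] at this

lemma powerMean_eq (ha : ∀ x ∈ F, 0 ≤ a x) (k : ℕ) :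
    ((∑ x ∈ F, a x ^ k) / F.card) ^ ((1 : ℝ) / k) =
      (∑ x ∈ F, a x ^ k) ^ ((1 : ℝ) / k) / (F.card : ℝ) ^ ((1 : ℝ) / k) :=
  Real.div_rpow (Finset.sum_nonneg fun x hx => pow_nonneg (ha x hx) k) (by positivity) _

lemma powerMean_le (hF : F.Nonempty) (ha : ∀ x ∈ F, 0 ≤ a x) (hm : ∀ x ∈ F, a x ≤ m) (hm0 : 0 ≤ m)
    {k : ℕ} (hk : 1 ≤ k) : ((∑ x ∈ F, a x ^ k) / F.card) ^ ((1 : ℝ) / k) ≤ m := by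
  have hcard : (0 : ℝ) < F.card := by exact_mod_cast hF.card_pos
  rw [powerMean_eq ha, div_le_iff₀ (Real.rpow_pos_of_pos hcard _), mul_comm]
  exact powerSum_rpow_le ha hm hm0 hk

/-- The ℓ^k norm lies between m and |F|^(1/k) m. -/
lemma tendsto_powerSum_rpow (hF : F.Nonempty) (ha : ∀ x ∈ F, 0 ≤ a x) (hm : ∀ x ∈ F, a x ≤ m)
    {x : α} (hx : x ∈ F) (hxm : a x = m) :
    Tendsto (fun k : ℕ => (∑ x ∈ F, a x ^ k) ^ ((1 : ℝ) / k)) atTop (𝓝 m) := by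
  have hcard : (0 : ℝ) < F.card := by exact_mod_cast hF.card_pos
  have h1 := (tendsto_const_rpow_one_div hcard).mul_const m
  rw [one_mul] at h1
  refine tendsto_of_tendsto_of_tendsto_of_le_of_le' tendsto_const_nhds h1 ?_ ?_
  · filter_upwards [eventually_ge_atTop 1] with k hk
    rw [← hxm]
    exact le_powerSum_rpow ha hx hk
  · filter_upwards [eventually_ge_atTop 1] with k hk
    exact powerSum_rpow_le ha hm (hxm ▸ ha x hx) hk

lemma tendsto_powerMean (hF : F.Nonempty) (ha : ∀ x ∈ F, 0 ≤ a x) (hm : ∀ x ∈ F, a x ≤ m)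
    {x : α} (hx : x ∈ F) (hxm : a x = m) :
    Tendsto (fun k : ℕ => ((∑ x ∈ F, a x ^ k) / F.card) ^ ((1 : ℝ) / k)) atTop (𝓝 m) := by
  have hcard : (0 : ℝ) < F.card := by exact_mod_cast hF.card_pos
  have h1 := (tendsto_powerSum_rpow hF ha hm hx hxm).div (tendsto_const_rpow_one_div hcard)
    one_ne_zero
  rw [div_one] at h1
  exact h1.congr fun k => (powerMean_eq ha k).symm

end PowerSums

/-! ### The polytopes P*_k as fibre powers. -/

section PowerLift

lemma dropLast_dupLast {ι μ : Type*} (k : ℕ) :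
    Function.LeftInverse (dropLast (ι := ι) (μ := μ) k) (dupLast k) := by
  intro z
  ext (i | ⟨j, p⟩)
  · rfl
  · change z (Sum.inr (j, Fin.predAbove (Fin.last k) p.castSucc)) = _
    rw [Fin.predAbove_castSucc_of_le _ _ (Fin.le_last p)]

variable {σ ρ ι μ : Type*} [Fintype ι] [Fintype μ] {A : Matrix σ ι ℤ} {b : σ → ℤ}
  {C : Matrix ρ μ ℤ} {D : Matrix ρ ι ℤ}

lemma mem_paramPolytope_pow {k : ℕ} {x : ι → ℝ} {y : μ × Fin k → ℝ} :
    y ∈ paramPolytope (powC C k) (powD D k) x ↔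
      ∀ p, (fun j => y (j, p)) ∈ paramPolytope C D x := by
  simp only [mem_paramPolytope, funext_iff, realMap_apply, Prod.forall, powC, powD,
    Matrix.blockDiagonal_apply, Matrix.of_apply, Fintype.sum_prod_type]
  have h : ∀ (i : ρ) (p : Fin k), (∑ j, ∑ q, (((if p = q then C i j else 0 : ℤ)) : ℝ) * y (j, q)) =
      ∑ j, (C i j : ℝ) * y (j, p) := by
    intro i p
    refine Finset.sum_congr rfl fun j _ => ?_
    rw [Finset.sum_eq_single p]
    · simp
    · intro q _ hq
      simp [hq.symm]
    · simp
  simp only [h]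
  exact ⟨fun ⟨h1, h2⟩ p => ⟨fun i => h1 i p, fun j => h2 j p⟩,
    fun h => ⟨fun i p => (h p).1 i, fun j p => (h p).2 j⟩⟩

lemma isBounded_paramPolytope_pow (hQ : ∀ x : ι → ℝ, Bornology.IsBounded (paramPolytope C D x))
    (k : ℕ) (x : ι → ℝ) : Bornology.IsBounded (paramPolytope (powC C k) (powD D k) x) := by
  obtain ⟨R, hR⟩ := (hQ x).exists_norm_le
  refine isBounded_iff_forall_norm_le.mpr ⟨|R|, fun y hy => ?_⟩
  rw [pi_norm_le_iff_of_nonneg (abs_nonneg R)]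
  rintro ⟨j, p⟩
  exact ((norm_le_pi_norm (fun j => y (j, p)) j).trans (hR _ (mem_paramPolytope_pow.mp hy p))).trans
    (le_abs_self R)

/-- The family `Q(x)^k` has the weight `w ^ k`. -/
lemma weight_pow (C : Matrix ρ μ ℤ) (D : Matrix ρ ι ℤ) (k : ℕ) (x : ι → ℤ) :
    weight (powC C k) (powD D k) x = weight C D x ^ k := by
  have e : latticePoints (paramPolytope (powC C k) (powD D k) (intVec x)) ≃
      (Fin k → latticePoints (paramPolytope C D (intVec x))) :=
    { toFun := fun y p => ⟨fun j => y.1 (j, p), mem_paramPolytope_pow.mp y.2 p⟩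
      invFun := fun y => ⟨fun q => (y q.2).1 q.1, mem_paramPolytope_pow.mpr fun p => (y p).2⟩
      left_inv := fun _ => rfl
      right_inv := fun _ => rfl }
  rw [weight, weight, latticeCount, latticeCount, ← Nat.card_coe_set_eq, ← Nat.card_coe_set_eq,
    Nat.card_congr e, Nat.card_fun, Nat.card_fin]

lemma mem_powLift {k : ℕ} {z : ι ⊕ μ × Fin k → ℝ} :
    z ∈ powLift A b C D k ↔ z ∘ Sum.inl ∈ stdPolytope A b ∧
      ∀ p, (fun j => z (Sum.inr (j, p))) ∈ paramPolytope C D (z ∘ Sum.inl) := by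
  rw [powLift, mem_liftPolytope, mem_paramPolytope_pow]
  rfl

/-- For k = 0 the right side would be the whole space: it takes at least one projection to impose
the constraints on x. -/
lemma powLift_eq {k : ℕ} (hk : 1 ≤ k) :
    powLift A b C D k = {z | ∀ j : Fin k, projAt j z ∈ liftPolytope A b C D} := by
  ext z
  rw [mem_powLift, mem_ofPred_eq]
  have h : ∀ p, projAt p z ∈ liftPolytope A b C D ↔ z ∘ Sum.inl ∈ stdPolytope A b ∧
      (fun j => z (Sum.inr (j, p))) ∈ paramPolytope C D (z ∘ Sum.inl) := fun p => mem_liftPolytope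
  simp only [h]
  exact ⟨fun hz p => ⟨hz.1, hz.2 p⟩, fun hz => ⟨(hz ⟨0, hk⟩).1, fun p => (hz p).2⟩⟩

lemma dupLast_mem {k : ℕ} {z : ι ⊕ μ × Fin (k + 1) → ℝ} (hz : z ∈ powLift A b C D (k + 1)) :
    dupLast k z ∈ powLift A b C D (k + 2) := by
  rw [mem_powLift] at hz ⊢
  exact ⟨hz.1, fun p => hz.2 _⟩

lemma dropLast_mem {k : ℕ} {z : ι ⊕ μ × Fin (k + 2) → ℝ} (hz : z ∈ powLift A b C D (k + 2)) :
    dropLast k z ∈ powLift A b C D (k + 1) := by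
  rw [mem_powLift] at hz ⊢
  exact ⟨hz.1, fun p => hz.2 _⟩

lemma dropLast_image (k : ℕ) :
    dropLast k '' powLift A b C D (k + 2) = powLift A b C D (k + 1) := by
  apply Subset.antisymm
  · rintro _ ⟨z, hz, rfl⟩
    exact dropLast_mem hz
  · intro z hz
    exact ⟨_, dupLast_mem hz, dropLast_dupLast k z⟩

end PowerLift

/-! ### The program that writes the description of P*_k. -/

section Program

/-- All instructions for a cell write the same value and never read the output, so order and
repetitions do not matter. The induction needs an arbitrary initial output. -/
lemma run_map {α β : Type*} [DecidableEq β] (cells : List β) (src : β → Option α)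
    (input : α → ℤ) {q : β} (hq : q ∈ cells) :
    CopyProgram.run (cells.map fun p => (p, src p)) input q = (src q).elim 0 input := by
  suffices h : ∀ (cells : List β) (out : β → ℤ),
      (cells.map fun p => (p, src p)).foldl
        (fun out c => Function.update out c.1 (c.2.elim 0 input)) out q =
        if q ∈ cells then (src q).elim 0 input else out q by
    rw [CopyProgram.run, h, if_pos hq]
  intro cells
  induction cells with
  | nil => simp
  | cons p cells ih =>
    intro out
    rw [List.map_cons, List.foldl_cons, ih]
    by_cases h1 : q ∈ cells
    · simp [h1]
    · by_cases h2 : q = p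
      · subst h2
        simp [h1]
      · simp [h1, h2]

variable {n m s r : ℕ}

lemma powSource_elim (A : Matrix (Fin s) (Fin n) ℤ) (b : Fin s → ℤ) (C : Matrix (Fin r) (Fin m) ℤ)
    (D : Matrix (Fin r) (Fin n) ℤ) (k : ℕ)
    (q : (Fin s ⊕ Fin r × Fin k) × ((Fin n ⊕ Fin m × Fin k) ⊕ Unit)) :
    (powSource k q).elim 0 (description (liftMatrix A C D) (Sum.elim b 0)) =
      description (liftMatrix A (powC C k) (powD D k)) (Sum.elim b 0) q := by
  rcases q with ⟨i | ⟨i, p⟩, (j | ⟨j, q⟩) | u⟩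
  · rfl
  · rfl
  · rfl
  · rfl
  · simp only [powSource, description, liftMatrix, powC, Sum.elim_inl, Matrix.fromBlocks_apply₂₂,
      Matrix.neg_apply, Matrix.blockDiagonal_apply]
    split_ifs
    · rfl
    · simp
  · rfl

lemma powProgram_run (A : Matrix (Fin s) (Fin n) ℤ) (b : Fin s → ℤ) (C : Matrix (Fin r) (Fin m) ℤ)
    (D : Matrix (Fin r) (Fin n) ℤ) (k : ℕ) :
    (powProgram n m s r k).run (description (liftMatrix A C D) (Sum.elim b 0)) =
      description (liftMatrix A (powC C k) (powD D k)) (Sum.elim b 0) := by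
  ext q
  rw [← powSource_elim]
  refine run_map _ _ _ ?_
  obtain ⟨i, j⟩ := q
  refine List.mem_product.mpr ⟨?_, ?_⟩
  · rcases i with i | ⟨i, p⟩
    · exact List.mem_append_left _ (List.mem_map_of_mem (List.mem_finRange i))
    · exact List.mem_append_right _ (List.mem_map_of_mem
        (List.mem_product.mpr ⟨List.mem_finRange i, List.mem_finRange p⟩))
  · rcases j with (j | ⟨j, p⟩) | u
    · exact List.mem_append_left _ (List.mem_map_of_mem
        (List.mem_append_left _ (List.mem_map_of_mem (List.mem_finRange j))))
    · exact List.mem_append_left _ (List.mem_map_of_mem (List.mem_append_right _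
        (List.mem_map_of_mem
          (List.mem_product.mpr ⟨List.mem_finRange j, List.mem_finRange p⟩))))
    · exact List.mem_append_right _ (List.mem_singleton.mpr rfl)

lemma powProgram_steps (n m s r : ℕ) {k : ℕ} (hk : 1 ≤ k) :
    (powProgram n m s r k).steps ≤ k ^ 2 * ((s + r) * (n + m + 1)) := by
  have h : (powProgram n m s r k).steps = (s + r * k) * (n + m * k + 1) := by
    change ((List.product _ _).map _).length = _
    have hp : ∀ {α β : Type} (l : List α) (l' : List β),
        (l.product l').length = l.length * l'.length := List.length_product
    simp [hp, add_assoc]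
  rw [h]
  -- Since k ≥ 1, the parts that are not repeated are bounded by k copies of them.
  have h1 : s + r * k ≤ k * (s + r) := by nlinarith
  have h2 : n + m * k + 1 ≤ k * (n + m + 1) := by nlinarith
  calc (s + r * k) * (n + m * k + 1) ≤ (k * (s + r)) * (k * (n + m + 1)) := Nat.mul_le_mul h1 h2
    _ = k ^ 2 * ((s + r) * (n + m + 1)) := by ring

end Program

end

end WeightLifting

namespace WeightLifting

noncomputable section

/-! ### The maximum of the weight between its two bounds. -/

section Maximization

/-- Either condition leaves room for only one integer between L and U, and ⌈L⌉ is the least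
candidate. -/
lemma eq_ceil_of_sub_lt_one {L U : ℝ} {k : ℕ} (hL : L ≤ k) (hU : (k : ℝ) ≤ U)
    (h : U - L < 1 ∨ ⌊U⌋ - ⌈L⌉ < 1) : (k : ℤ) = ⌈L⌉ := by
  rcases h with h | h
  · symm
    rw [Int.ceil_eq_iff]
    push_cast
    exact ⟨by linarith, hL⟩
  · have h1 : ⌈L⌉ ≤ (k : ℤ) := Int.ceil_le.mpr (by exact_mod_cast hL)
    have h2 : (k : ℤ) ≤ ⌊U⌋ := Int.le_floor.mpr (by exact_mod_cast hU)
    omega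

variable {σ ρ ι μ : Type*} [Fintype ρ] [Fintype ι] [Fintype μ] {A : Matrix σ ι ℤ}
  {b : σ → ℤ} {C : Matrix ρ μ ℤ} {D : Matrix ρ ι ℤ}

lemma finsum_weight_pow_eq (hP : Bornology.IsBounded (stdPolytope A b))
    (hQ : ∀ x : ι → ℝ, Bornology.IsBounded (paramPolytope C D x)) (k : ℕ) :
    ∑ᶠ x ∈ latticePoints (stdPolytope A b), weight C D x ^ k =
      latticeCount (powLift A b C D k) := by
  simp only [← weight_pow]
  exact finsum_weight_eq_latticeCount hP (isBounded_paramPolytope_pow hQ k)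

lemma weightedSum_pow_eq (hP : Bornology.IsBounded (stdPolytope A b))
    (hQ : ∀ x : ι → ℝ, Bornology.IsBounded (paramPolytope C D x)) (k : ℕ) {t : ℕ} (ht : 1 ≤ t) :
    weightedSum (stdPolytope A b) (fun x => weight C D x ^ k) t =
      latticeCount ((t : ℝ) • powLift A b C D k) := by
  simp only [← weight_pow]
  exact weightedSum_eq_latticeCount_of_pos hP (isBounded_paramPolytope_pow hQ k) ht

/-- The lattice point counts of the polytopes `P*_k` determine the maximum of the weight. -/
theorem maximize_weight (hP : Bornology.IsBounded (stdPolytope A b))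
    (hQ : ∀ x : ι → ℝ, Bornology.IsBounded (paramPolytope C D x))
    (hne : (latticePoints (stdPolytope A b)).Nonempty) :
    ∃ m : ℕ, IsGreatest (weight C D '' latticePoints (stdPolytope A b)) m ∧
      (∀ k : ℕ, 1 ≤ k → lowerBound A b C D k ≤ (m : ℝ) ∧ (m : ℝ) ≤ upperBound A b C D k) ∧
      MonotoneOn (lowerBound A b C D) (Set.Ici 1) ∧
      AntitoneOn (upperBound A b C D) (Set.Ici 1) ∧
      Tendsto (lowerBound A b C D) atTop (𝓝 (m : ℝ)) ∧
      Tendsto (upperBound A b C D) atTop (𝓝 (m : ℝ)) := by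
  classical
  have hfin := finite_latticePoints hP
  set F := hfin.toFinset with hF
  have hFne : F.Nonempty := hfin.toFinset_nonempty.mpr hne
  obtain ⟨x, hx, hmax⟩ := F.exists_max_image (weight C D) hFne
  set a : (ι → ℤ) → ℝ := fun x => (weight C D x : ℝ)
  have ha : ∀ y ∈ F, 0 ≤ a y := fun y _ => Nat.cast_nonneg _
  have ham : ∀ y ∈ F, a y ≤ (weight C D x : ℝ) := fun y hy => Nat.cast_le.mpr (hmax y hy)
  have hsum : ∀ k, (latticeCount (powLift A b C D k) : ℝ) = ∑ y ∈ F, a y ^ k := by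
    intro k
    rw [← finsum_weight_pow_eq hP hQ, finsum_mem_eq_finite_toFinset_sum _ hfin]
    push_cast
    rfl
  have hcard : latticeCount (stdPolytope A b) = F.card := Set.ncard_eq_toFinset_card _ hfin
  have hU : upperBound A b C D = fun k : ℕ => (∑ y ∈ F, a y ^ k) ^ ((1 : ℝ) / k) := by
    ext k
    rw [upperBound, hsum]
  have hL : lowerBound A b C D =
      fun k : ℕ => ((∑ y ∈ F, a y ^ k) / F.card) ^ ((1 : ℝ) / k) := by
    ext k
    rw [lowerBound, hsum, hcard]
  rw [hU, hL]
  refine ⟨weight C D x, ⟨⟨x, hfin.mem_toFinset.mp hx, rfl⟩, ?_⟩,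
    fun k hk => ⟨powerMean_le hFne ha ham (Nat.cast_nonneg _) hk, le_powerSum_rpow ha hx hk⟩,
    fun k hk l _ hkl => powerMean_monotone hFne ha hk hkl,
    fun k hk l _ hkl => powerSum_antitone ha hk hkl,
    tendsto_powerMean hFne ha ham hx rfl, tendsto_powerSum_rpow hFne ha ham hx rfl⟩
  rintro _ ⟨y, hy, rfl⟩
  exact hmax y (hfin.mem_toFinset.mpr hy)

end Maximization

end

end WeightLifting

/-! ### Assembly of integration and maximization. -/

theorem corollary1p2 {n m s r : ℕ}
    (A : Matrix (Fin s) (Fin n) ℤ) (b : Fin s → ℤ)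
    (C : Matrix (Fin r) (Fin m) ℤ) (D : Matrix (Fin r) (Fin n) ℤ)
    (hP : Bornology.IsBounded (stdPolytope A b))
    (hQ : ∀ x : Fin n → ℝ, Bornology.IsBounded (paramPolytope C D x)) :
    -- Integration.
    ((stdPolytope A b).Nonempty →
      affineSpan ℝ {x ∈ stdPolytope A b |
          (paramPolytope C D x).Nonempty} =
        affineSpan ℝ (stdPolytope A b) →
      ∃ M : ℕ,
        affDim (stdPolytope A b) + M =
          affDim (liftPolytope A b C D) ∧
        -- the weighted sums over `tP` are the lattice point counts of `tP*`
        (∀ t : ℕ, weightedSum (stdPolytope A b)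
            (weight C D) t =
          latticeCount ((t : ℝ) • liftPolytope A b C D)) ∧
        0 < normVol (liftPolytope A b C D) ∧
        -- the weight has a homogeneous leading part of degree `M`
        (∃ (N : ℕ) (g : (Fin n → ZMod N) → (Fin n → ℝ) → ℝ),
          IsLeadingPart (stdPolytope A b)
            (weight C D) M N g) ∧
        -- the two quasi-polynomials, and their common leading coefficient, which is the volume
        -- of `P*` and the integral of the weight over `P`
        (∃ (p : ℕ) (E : ℕ → ℕ → ℝ),
          IsQuasiPolynomial
            (fun t => (weightedSum (stdPolytope A b)
              (weight C D) t : ℝ))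
            (affDim (liftPolytope A b C D)) p E ∧
          IsQuasiPolynomial
            (fun t => (latticeCount
              ((t : ℝ) • liftPolytope A b C D) : ℝ))
            (affDim (liftPolytope A b C D)) p E ∧
          (∀ t : ℕ, 1 ≤ t →
            (affLattice (liftPolytope A b C D) t).Nonempty →
            E (affDim (liftPolytope A b C D)) t =
              normVol (liftPolytope A b C D)) ∧
          (∀ t : ℕ, 1 ≤ t →
            ¬ (affLattice (liftPolytope A b C D) t).Nonempty →
            E (affDim (liftPolytope A b C D)) t = 0) ∧
          (∀ (N : ℕ) (g : (Fin n → ZMod N) → (Fin n → ℝ) → ℝ),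
            IsLeadingPart (stdPolytope A b)
              (weight C D) M N g →
            ∀ t : ℕ, 1 ≤ t → quasiIntegral (stdPolytope A b) N g t =
              E (affDim (liftPolytope A b C D)) t)) ∧
        -- in particular, for a leading part without periodic coefficients
        (∀ f : (Fin n → ℝ) → ℝ,
          IsLeadingPart (stdPolytope A b)
            (weight C D) M 1 (fun _ => f) →
          ∫ x in stdPolytope A b, f x
              ∂(latticeMeasure (stdPolytope A b)) =
            normVol (liftPolytope A b C D))) ∧
    -- Maximization.
    ((latticePoints (stdPolytope A b)).Nonempty →
      ∃ μ : ℕ,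
        IsGreatest (weight C D ''
          latticePoints (stdPolytope A b)) μ ∧
        -- `P*_k` is a weight lifting polytope for `w ^ k`
        (∀ k : ℕ, 1 ≤ k → ∀ x : Fin n → ℤ,
          weight (powC C k) (powD D k) x =
            weight C D x ^ k) ∧
        (∀ k : ℕ, 1 ≤ k →
          ∑ᶠ x ∈ latticePoints (stdPolytope A b),
              weight C D x ^ k =
            latticeCount (powLift A b C D k)) ∧
        (∀ k : ℕ, 1 ≤ k → ∀ t : ℕ, 1 ≤ t →
          weightedSum (stdPolytope A b)
              (fun x => weight C D x ^ k) t =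
            latticeCount ((t : ℝ) • powLift A b C D k)) ∧
        -- the bounds, computed from the lattice point counts of `P*_k` and `P`
        (∀ k : ℕ, 1 ≤ k → lowerBound A b C D k ≤ (μ : ℝ) ∧
          (μ : ℝ) ≤ upperBound A b C D k) ∧
        MonotoneOn (lowerBound A b C D) (Set.Ici 1) ∧
        AntitoneOn (upperBound A b C D) (Set.Ici 1) ∧
        Tendsto (lowerBound A b C D) atTop (𝓝 (μ : ℝ)) ∧
        Tendsto (upperBound A b C D) atTop (𝓝 (μ : ℝ)) ∧
        -- finitely many `k` suffice, and the stopping rule is correct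
        (∃ K : ℕ, 1 ≤ K ∧ ∀ k : ℕ, K ≤ k →
          upperBound A b C D k - lowerBound A b C D k < 1) ∧
        (∀ k : ℕ, 1 ≤ k →
          (upperBound A b C D k - lowerBound A b C D k < 1 ∨
            ⌊upperBound A b C D k⌋ - ⌈lowerBound A b C D k⌉ < 1) →
          (μ : ℤ) = ⌈lowerBound A b C D k⌉) ∧
        -- the polytopes `P*_k` contain each other, through integral coordinate maps
        (∀ k : ℕ,
          Function.LeftInverse (dropLast (ι := Fin n) (μ := Fin m) k)
            (dupLast k) ∧
          dupLast k '' powLift A b C D (k + 1) ⊆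
            powLift A b C D (k + 2) ∧
          dropLast k '' powLift A b C D (k + 2) =
            powLift A b C D (k + 1)) ∧
        -- and can be read from `P*`, in at most `k ^ 2` steps per entry of its description
        (∀ k : ℕ, 1 ≤ k →
          powLift A b C D k =
              {z | ∀ j : Fin k, projAt j z ∈
                liftPolytope A b C D} ∧
          (powProgram n m s r k).run
              (description (liftMatrix A C D) (Sum.elim b 0)) =
            description
              (liftMatrix A (powC C k) (powD D k))
              (Sum.elim b 0) ∧
          (powProgram n m s r k).steps ≤ k ^ 2 * ((s + r) * (n + m + 1)))) := by
  refine ⟨fun hne haff => integrate_weight hP hQ hne haff, fun hne => ?_⟩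
  obtain ⟨μ, hμ, hbound, hmono, hanti, hlow, hupp⟩ := maximize_weight hP hQ hne
  refine ⟨μ, hμ, fun k _ x => weight_pow C D k x, fun k _ => finsum_weight_pow_eq hP hQ k,
    fun k _ t ht => weightedSum_pow_eq hP hQ k ht, hbound, hmono, hanti, hlow, hupp, ?_,
    fun k hk h => eq_ceil_of_sub_lt_one (hbound k hk).1 (hbound k hk).2 h,
    fun k => ⟨dropLast_dupLast k, ?_, dropLast_image k⟩,
    fun k hk => ⟨powLift_eq hk, powProgram_run A b C D k, powProgram_steps n m s r hk⟩⟩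
  · have h := hupp.sub hlow
    rw [sub_self] at h
    obtain ⟨K, hK⟩ := eventually_atTop.mp (h.eventually_lt_const one_pos)
    exact ⟨max K 1, le_max_right _ _, fun k hk => hK k ((le_max_left _ _).trans hk)⟩
  · rintro _ ⟨z, hz, rfl⟩
    exact dupLast_mem hz
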